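/- Let $p$ be a prime and $K$ a complete discretely valued extension of $\mathbb{Q}_p$; all Banach spaces over $K$ are ultrametric, $\widehat\otimes$ denotes their completed projective tensor product, and "noetherian" and "module" refer to left ideals and left modules. **Triangular decompositions.** A triangular decomposition $(A,B,H,\partial)$ of a non-zero noetherian $K$-algebra $R$ consists of subalgebras $A,B,H\subset R$ and $\partial\in R$ such that: $R=\bigoplus_{n\in\mathbb{Z}}R_n$ with $R_n=\{x\in R:[\partial,x]=nx\}$; multiplication $A\otimes_KH\otimes_KB\to R$ is bijective; $BH=HB$ and $HA=AH$; $A=\bigoplus_{n\ge 0}A_n$ and $B=\bigoplus_{n\le 0}B_n$ with $A_n=A\cap R_n$, $B_n=B\cap R_n$ finite dimensional and $A_0=B_0=K$; $H\subset R_0$; and $H$ is a finite-dimensional split semi-simple $K$-algebra. Put $B^{>0}=\bigoplus_{n<0}B_n$ and $BH^{>0}=B^{>0}\cdot H$. Let $\operatorname{Irr}(H)$ be the set of isomorphism classes of irreducible $H$-modules. For $W\in\operatorname{Irr}(H)$ let $\Delta(W)=R\otimes_{BH}(BH/BH^{>0}\otimes_HW)$ and let $L(W)$ be its unique simple quotient.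 **Weights.** For an endomorphism $T$ of a $K$-vector space $V$ and $\lambda\in K$ put $V^\lambda=\{v:(T-\lambda)^nv=0\text{ for some }n\}$ and $V^{\mathrm{ws}}=\bigoplus_\lambda V^\lambda$. If $V$ is a topological vector space and $T$ is continuous, $V$ admits a weight space decomposition if there is a set $I$ of $\lambda$ with $V^\lambda\neq0$ such that every $v\in V$ is a convergent sum $\sum_{\lambda\in I}v_\lambda$ with $v_\lambda\in V^\lambda$; it is semi-simple if $T$ acts as $\lambda$ on $V^\lambda$ for all $\lambda\in I$. **Banach algebras.** Let $\mathscr{R}$ be a noetherian Banach $K$-algebra with a triangular decomposition $(R,A,B,H,\partial)$: that is, $R\subset\mathscr{R}$ is a dense subalgebra with a triangular decomposition $(A,B,H,\partial)$ and, for the closures $\mathscr{A},\mathscr{B}$ of $A,B$ in $\mathscr{R}$, multiplication induces an isomorphism of Banach spaces $\mathscr{A}\widehat\otimes_KH\widehat\otimes_K\mathscr{B}\cong\mathscr{R}$, and $\mathscr{A}$, $\mathscr{B}$ have semi-simple weight space decompositions for $\operatorname{ad}(\partial)=[\partial,-]$ with $\mathscr{A}^{\mathrm{ws}}=A$, $\mathscr{B}^{\mathrm{ws}}=B$.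 Assume that $\mathscr{A}$ and $\mathscr{B}$ are noetherian. Let $\operatorname{Mod}(\mathscr{R})$ be the category of finitely generated $\mathscr{R}$-modules; each of its objects $M$ carries the quotient topology of any surjection $\mathscr{R}^r\to M$. Let $\widehat{\mathcal{O}}\subset\operatorname{Mod}(\mathscr{R})$ be the full subcategory of the $M$ which admit a weight space decomposition for the action of $\partial$ and are finite $\mathscr{A}$-modules. For $W\in\operatorname{Irr}(H)$ let $\widehat\Delta(W)=\mathscr{R}\otimes_{\mathscr{B}H}(\mathscr{B}H/\mathscr{B}H^{>0}\otimes_HW)$ be the analytic Verma module, where $\mathscr{B}H=\mathscr{B}\cdot H$ and $\mathscr{B}H^{>0}$ is its two-sided ideal generated by $BH^{>0}$, and let $\widehat L(W)$ be its quotient by the sum of all proper submodules. **Proposition.** (a) For every $W\in\operatorname{Irr}(H)$, $L(W)$ is a simple $R$-module, $\widehat L(W)$ is a simple $\mathscr{R}$-module and $\widehat L(W)\cong\mathscr{R}\otimes_RL(W)$. (b) Every $M\in\widehat{\mathcal{O}}$ has a finite Jordan–Hölder series in $\widehat{\mathcal{O}}$: there is a finite filtration $0=M_0\subset M_1\subset\cdots\subset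 M_n=M$ by $\mathscr{R}$-submodules that are objects of $\widehat{\mathcal{O}}$, such that for each $1\le i\le n$ there is $W_i\in\operatorname{Irr}(H)$ with $M_i/M_{i-1}\cong\widehat L(W_i)$. **Corollary.** $\widehat{\mathcal{O}}$ is a full abelian subcategory of $\operatorname{Mod}(\mathscr{R})$ (it is abelian and its inclusion into the category of $\mathscr{R}$-modules is exact), and it is closed under $\mathscr{R}$-submodules and finite direct sums. -/

import Mathlib

open scoped TensorProduct

universe u v w

noncomputable section

namespace AnalyticO

/-! ### Tensor products over noncommutative rings -/

section NoncommutativeTensor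

/-- Restriction of scalars of a `T`-module `N` along a ring homomorphism `f : S → T`. -/
def Restrict {S : Type u} {T : Type v} [Ring S] [Ring T] (_f : S →+* T) (N : Type w) : Type w := N

instance {S : Type u} {T : Type v} [Ring S] [Ring T] (f : S →+* T) (N : Type w)
    [i : AddCommGroup N] : AddCommGroup (Restrict f N) := i

instance {S : Type u} {T : Type v} [Ring S] [Ring T] (f : S →+* T) (N : Type w)
    [AddCommGroup N] [Module T N] : Module S (Restrict f N) := Module.compHom N f

/-- The relations `x f(s) ⊗ m = x ⊗ s m`, as a `T`-submodule of `T ⊗_ℤ M`. -/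
def balancingRelations {S : Type u} {T : Type v} [Ring S] [Ring T] (f : S →+* T) (M : Type w)
    [AddCommGroup M] [Module S M] : Submodule T (T ⊗[ℤ] M) :=
  Submodule.span T {t | ∃ (x : T) (s : S) (m : M), t = (x * f s) ⊗ₜ[ℤ] m - x ⊗ₜ[ℤ] (s • m)}

/-- The extension of scalars `T ⊗_S M` of a left `S`-module `M` along a homomorphism `f : S → T` of
(not necessarily commutative) rings, as a left `T`-module. -/
abbrev ExtendScalars {S : Type u} {T : Type v} [Ring S] [Ring T] (f : S →+* T) (M : Type w)
    [AddCommGroup M] [Module S M] : Type (max v w) :=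
  (T ⊗[ℤ] M) ⧸ balancingRelations f M

/-- The sum of all proper submodules. If `N` has a unique maximal submodule which contains every
proper submodule (for instance if `N` is finitely generated with a unique maximal submodule), this
is that submodule. -/
def maxSubmodule (T : Type u) (N : Type v) [Ring T] [AddCommGroup N] [Module T N] :
    Submodule T N :=
  sSup {P : Submodule T N | P ≠ ⊤}

/-- The quotient of `N` by its maximal submodule. -/
abbrev SimpleQuotient (T : Type u) (N : Type v) [Ring T] [AddCommGroup N] [Module T N] : Type v :=
  N ⧸ maxSubmodule T N

/-- For a subring `P` of `T`, a subset `S` of `P` generating the two-sided ideal `I` of `P`, and a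
ring homomorphism `f : H → P`, the `T`-module `T ⊗_P (P/I ⊗_H W)`. -/
abbrev InducedModule {K : Type u} {T H : Type v} [Field K] [Ring T] [Algebra K T] [Ring H]
    (P : Subalgebra K T) (S : Set P) (f : H →+* P) (W : Type w) [AddCommGroup W] [Module H W] :
    Type (max v w) :=
  ExtendScalars (P.val : P →+* T)
    (Restrict (TwoSidedIdeal.span S).ringCon.mk'
      (ExtendScalars ((TwoSidedIdeal.span S).ringCon.mk'.comp f) W))

end NoncommutativeTensor

/-! ### Completed tensor products of ultrametric Banach spaces -/

section CompletedTensor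

variable (K : Type u) [NontriviallyNormedField K]

/-- The algebraic tensor product `E ⊗_K F`, to be equipped with the ultrametric projective
seminorm `t ↦ inf max_i ‖x_i‖ ‖y_i‖`, over all expressions `t = ∑ x_i ⊗ y_i`. -/
def ProjTensor (E : Type v) (F : Type w) [SeminormedAddCommGroup E] [NormedSpace K E]
    [SeminormedAddCommGroup F] [NormedSpace K F] : Type (max v w) := E ⊗[K] F

variable {E : Type v} {F : Type w} [SeminormedAddCommGroup E] [NormedSpace K E]
    [SeminormedAddCommGroup F] [NormedSpace K F]

instance : AddCommGroup (ProjTensor K E F) := inferInstanceAs (AddCommGroup (E ⊗[K] F))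

instance : Module K (ProjTensor K E F) := inferInstanceAs (Module K (E ⊗[K] F))

/-- The pure tensor `x ⊗ y`. -/
def ProjTensor.tmul (x : E) (y : F) : ProjTensor K E F := x ⊗ₜ[K] y

/-- `t` has an expression `∑ x_i ⊗ y_i` with `‖x_i‖ ‖y_i‖ ≤ r` for all `i`. -/
def ProjTensor.Bounded (t : ProjTensor K E F) (r : ℝ) : Prop :=
  0 ≤ r ∧ ∃ (n : ℕ) (x : Fin n → E) (y : Fin n → F),
    t = ∑ i, ProjTensor.tmul K (x i) (y i) ∧ ∀ i, ‖x i‖ * ‖y i‖ ≤ r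

/-- The ultrametric projective seminorm. -/
def ProjTensor.projNorm (t : ProjTensor K E F) : ℝ := sInf {r | ProjTensor.Bounded K t r}

variable {K}

theorem ProjTensor.bounded_nonempty (t : ProjTensor K E F) :
    {r | ProjTensor.Bounded K t r}.Nonempty := by
  obtain ⟨n, x, y, h⟩ : ∃ (n : ℕ) (x : Fin n → E) (y : Fin n → F),
      t = ∑ i, ProjTensor.tmul K (x i) (y i) := by
    obtain ⟨S, hS⟩ := TensorProduct.exists_finset (R := K) (M := E) (N := F) t
    refine ⟨S.card, fun i => (S.equivFin.symm i).1.1, fun i => (S.equivFin.symm i).1.2, ?_⟩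
    refine hS.trans ?_
    rw [← Finset.sum_coe_sort]
    exact (Equiv.sum_comp S.equivFin.symm (fun i : S => (i.1.1 ⊗ₜ[K] i.1.2 : E ⊗[K] F))).symm
  refine ⟨∑ i, ‖x i‖ * ‖y i‖, by positivity, n, x, y, h, fun i => ?_⟩
  exact Finset.single_le_sum (f := fun i => ‖x i‖ * ‖y i‖) (fun j _ => by positivity)
    (Finset.mem_univ i)

theorem ProjTensor.bddBelow (t : ProjTensor K E F) :
    BddBelow {r | ProjTensor.Bounded K t r} := ⟨0, fun _ hr => hr.1⟩

theorem ProjTensor.projNorm_nonneg (t : ProjTensor K E F) : 0 ≤ ProjTensor.projNorm K t :=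
  le_csInf (ProjTensor.bounded_nonempty t) fun _ hr => hr.1

theorem ProjTensor.Bounded.smul {t : ProjTensor K E F} {r : ℝ} (h : ProjTensor.Bounded K t r)
    (c : K) : ProjTensor.Bounded K (c • t) (‖c‖ * r) := by
  obtain ⟨h0, n, x, y, rfl, hr⟩ := h
  refine ⟨by positivity, n, fun i => c • x i, y, ?_, fun i => ?_⟩
  · rw [Finset.smul_sum]
    exact Finset.sum_congr rfl fun i _ => TensorProduct.smul_tmul' c (x i) (y i)
  · rw [norm_smul, mul_assoc]
    exact mul_le_mul_of_nonneg_left (hr i) (norm_nonneg c)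

theorem ProjTensor.Bounded.add {s t : ProjTensor K E F} {a b : ℝ} (hs : ProjTensor.Bounded K s a)
    (ht : ProjTensor.Bounded K t b) : ProjTensor.Bounded K (s + t) (max a b) := by
  obtain ⟨h0, n, x, y, rfl, hr⟩ := hs
  obtain ⟨h0', n', x', y', rfl, hr'⟩ := ht
  refine ⟨le_max_of_le_left h0, n + n', Fin.append x x', Fin.append y y', ?_, fun i => ?_⟩
  · simp [Fin.sum_univ_add]
  · refine Fin.addCases (fun j => ?_) (fun j => ?_) i
    · simpa using Or.inl (hr j)
    · simpa using Or.inr (hr' j)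

theorem ProjTensor.projNorm_smul_le (c : K) (t : ProjTensor K E F) :
    ProjTensor.projNorm K (c • t) ≤ ‖c‖ * ProjTensor.projNorm K t := by
  rw [ProjTensor.projNorm, ProjTensor.projNorm, ← smul_eq_mul, ← Real.sInf_smul_of_nonneg (norm_nonneg c)]
  refine le_csInf ((ProjTensor.bounded_nonempty t).smul_set) ?_
  rintro _ ⟨r, hr, rfl⟩
  exact csInf_le (ProjTensor.bddBelow _) (hr.smul c)

/-- The projective seminorm as a seminorm of additive groups. -/
def ProjTensor.addGroupSeminorm : AddGroupSeminorm (ProjTensor K E F) where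
  toFun := ProjTensor.projNorm K
  map_zero' := by
    refine le_antisymm (csInf_le (ProjTensor.bddBelow _) ⟨le_rfl, 0, Fin.elim0, Fin.elim0, ?_⟩)
      (ProjTensor.projNorm_nonneg _)
    simp
  add_le' s t := by
    refine le_of_forall_pos_le_add fun ε hε => ?_
    obtain ⟨a, ha, ha'⟩ := exists_lt_of_csInf_lt (ProjTensor.bounded_nonempty s)
      (lt_add_of_pos_right (ProjTensor.projNorm K s) (half_pos hε))
    obtain ⟨b, hb, hb'⟩ := exists_lt_of_csInf_lt (ProjTensor.bounded_nonempty t)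
      (lt_add_of_pos_right (ProjTensor.projNorm K t) (half_pos hε))
    have h1 : ProjTensor.projNorm K (s + t) ≤ max a b :=
      csInf_le (ProjTensor.bddBelow _) (ha.add hb)
    have h2 := max_le_add_of_nonneg ha.1 hb.1
    linarith
  neg' t := by
    have h : ∀ t : ProjTensor K E F, ProjTensor.projNorm K (-t) ≤ ProjTensor.projNorm K t := by
      intro t
      simpa using ProjTensor.projNorm_smul_le (-1 : K) t
    exact le_antisymm (h t) (by simpa using h (-t))

instance : SeminormedAddCommGroup (ProjTensor K E F) :=
  ProjTensor.addGroupSeminorm.toSeminormedAddCommGroup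

instance : NormedSpace K (ProjTensor K E F) where
  norm_smul_le c t := ProjTensor.projNorm_smul_le c t

variable (K E F) in
/-- The completed tensor product `E ⊗̂_K F`: the Hausdorff completion of `E ⊗_K F` for the
ultrametric projective seminorm. -/
abbrev CompletedTensor : Type (max v w) := UniformSpace.Completion (ProjTensor K E F)

variable (K) in
/-- The image of `x ⊗ y` in `E ⊗̂_K F`. -/
def CompletedTensor.tmul (x : E) (y : F) : CompletedTensor K E F :=
  ((ProjTensor.tmul K x y : ProjTensor K E F) : UniformSpace.Completion (ProjTensor K E F))

end CompletedTensor

/-! ### Weight space decompositions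

The generalized weight space `V^λ` of an endomorphism `T` of `V`, which consists of the `v` such
that `(T - λ)^n v = 0` for some `n`, is `T.maxGenEigenspace λ`. -/

section Weights

variable {K : Type u} {V : Type v} [Field K] [AddCommGroup V] [Module K V]

/-- The set `Λ(V)` of all weights. -/
def weights (T : Module.End K V) : Set K := {l | T.maxGenEigenspace l ≠ ⊥}

/-- The subspace `V^ws`, the (automatically direct) sum of all the generalized weight spaces. -/
def wsSubspace (T : Module.End K V) : Submodule K V := ⨆ l : K, T.maxGenEigenspace l

/-- `V` admits a weight space decomposition for `T` with respect to the family `I` of weights: every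
vector is a convergent sum of generalized weight vectors with weights in `I`. -/
def HasWeightDecompositionOn [TopologicalSpace V] (T : Module.End K V) (I : Set K) : Prop :=
  I ⊆ weights T ∧
    ∀ v : V, ∃ x : I → V, (∀ l : I, x l ∈ T.maxGenEigenspace (l : K)) ∧ HasSum x v

/-- `V` admits a weight space decomposition for `T`. -/
def HasWeightDecomposition [TopologicalSpace V] (T : Module.End K V) : Prop :=
  ∃ I : Set K, HasWeightDecompositionOn T I

/-- `V` admits a semi-simple weight space decomposition for `T`. -/
def HasSemisimpleWeightDecomposition [TopologicalSpace V] (T : Module.End K V) : Prop :=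
  ∃ I : Set K, HasWeightDecompositionOn T I ∧
    ∀ l ∈ I, ∀ v ∈ T.maxGenEigenspace l, T v = l • v

end Weights

/-! ### Algebras with a triangular decomposition -/

section Triangular

/-- The commutator `ad(x) = [x, -]`. -/
def adEnd (K : Type u) {R : Type v} [Field K] [Ring R] [Algebra K R] (x : R) : Module.End K R :=
  LinearMap.mulLeft K x - LinearMap.mulRight K x

/-- The subspace `R_n` of the `x` such that `[d, x] = n x`. -/
def degreePart (K : Type u) {R : Type v} [Field K] [Ring R] [Algebra K R] (d : R) (n : ℤ) :
    Submodule K R :=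
  (adEnd K d).eigenspace (n : K)

/-- A triangular decomposition `(A, B, H, ∂)` of a noetherian `K`-algebra `R`, graded by the
eigenspaces of `ad(∂)`. -/
structure TriangularDecomposition (K : Type u) (R : Type v) [Field K] [Ring R] [Algebra K R] where
  A : Subalgebra K R
  B : Subalgebra K R
  H : Subalgebra K R
  /-- The element `∂`. -/
  del : R
  noetherian : IsNoetherianRing R
  nontrivial : Nontrivial R
  /-- `R = ⨁ R_n`, where `R_n = {x | [∂, x] = n x}`. -/
  graded : DirectSum.IsInternal (degreePart K del)
  /-- Multiplication gives an isomorphism `A ⊗ H ⊗ B = R`. -/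
  tensor : ∃ e : ((A ⊗[K] H) ⊗[K] B) ≃ₗ[K] R,
    ∀ (a : A) (h : H) (b : B), e ((a ⊗ₜ[K] h) ⊗ₜ[K] b) = (a : R) * h * b
  BH_comm : Subalgebra.toSubmodule B * Subalgebra.toSubmodule H =
    Subalgebra.toSubmodule H * Subalgebra.toSubmodule B
  HA_comm : Subalgebra.toSubmodule H * Subalgebra.toSubmodule A =
    Subalgebra.toSubmodule A * Subalgebra.toSubmodule H
  /-- `A = ⨁_{n ≥ 0} A_n`. -/
  A_graded : Subalgebra.toSubmodule A =
    ⨆ n : ℕ, Subalgebra.toSubmodule A ⊓ degreePart K del (n : ℤ)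
  /-- `B = ⨁_{n ≤ 0} B_n`. -/
  B_graded : Subalgebra.toSubmodule B =
    ⨆ n : ℕ, Subalgebra.toSubmodule B ⊓ degreePart K del (-(n : ℤ))
  /-- `A_0 = K`. -/
  A_zero : Subalgebra.toSubmodule A ⊓ degreePart K del 0 =
    Subalgebra.toSubmodule (⊥ : Subalgebra K R)
  /-- `B_0 = K`. -/
  B_zero : Subalgebra.toSubmodule B ⊓ degreePart K del 0 =
    Subalgebra.toSubmodule (⊥ : Subalgebra K R)
  /-- `H ⊆ R_0`. -/
  H_zero : Subalgebra.toSubmodule H ≤ degreePart K del 0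
  A_finite : ∀ n : ℤ, Module.Finite K ↥(Subalgebra.toSubmodule A ⊓ degreePart K del n)
  B_finite : ∀ n : ℤ, Module.Finite K ↥(Subalgebra.toSubmodule B ⊓ degreePart K del n)
  /-- `H` is a finite-dimensional split semi-simple algebra. -/
  H_split : ∃ (k : ℕ) (d : Fin k → ℕ),
    Nonempty (H ≃ₐ[K] ((i : Fin k) → Matrix (Fin (d i)) (Fin (d i)) K))

namespace TriangularDecomposition

variable {K : Type u} {R : Type v} [Field K] [Ring R] [Algebra K R]
  (D : TriangularDecomposition K R)

/-- `B^{>0} = ⨁_{n > 0} B_{-n}`. -/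
def Bpos : Submodule K R :=
  ⨆ n : ℕ, Subalgebra.toSubmodule D.B ⊓ degreePart K D.del (-((n : ℤ) + 1))

/-- The subalgebra `BH = B ⊗ H` of `R`. -/
def BH : Subalgebra K R := D.B ⊔ D.H

/-- The elements `b h` of `BH` with `b ∈ B^{>0}` and `h ∈ H`; they generate `BH^{>0}`. -/
def BHpos : Set D.BH := {x | ∃ b ∈ D.Bpos, ∃ h ∈ D.H, (x : R) = b * h}

/-- The inclusion `H → BH`. -/
def HtoBH : D.H →+* D.BH := (Subalgebra.inclusion (le_sup_right : D.H ≤ D.BH)).toRingHom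

/-- The Verma module `Δ(W) = R ⊗_{BH} (BH/BH^{>0} ⊗_H W)`. -/
abbrev Verma (W : Type w) [AddCommGroup W] [Module D.H W] : Type (max v w) :=
  InducedModule D.BH D.BHpos D.HtoBH W

/-- The simple quotient `L(W)` of `Δ(W)`. -/
abbrev L (W : Type w) [AddCommGroup W] [Module D.H W] : Type (max v w) :=
  SimpleQuotient R (D.Verma W)

end TriangularDecomposition

end Triangular

/-! ### Banach algebras with a triangular decomposition -/

section Banach

variable (K : Type u) (𝓡 : Type v) [NontriviallyNormedField K] [NormedRing 𝓡] [NormedAlgebra K 𝓡]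

/-- A dense subalgebra `R ⊆ 𝓡` with a triangular decomposition `(A, B, H, ∂)`. -/
structure DenseTriangularSubalgebra where
  R : Subalgebra K 𝓡
  dense : Dense (R : Set 𝓡)
  alg : TriangularDecomposition K R

namespace DenseTriangularSubalgebra

variable {K 𝓡} (D : DenseTriangularSubalgebra K 𝓡)

/-- The element `∂`, in `𝓡`. -/
def del : 𝓡 := (D.alg.del : 𝓡)

/-- `A` as a subalgebra of `𝓡`. -/
def A : Subalgebra K 𝓡 := D.alg.A.map D.R.val

/-- `B` as a subalgebra of `𝓡`. -/
def B : Subalgebra K 𝓡 := D.alg.B.map D.R.val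

/-- `H` as a subalgebra of `𝓡`. -/
def H : Subalgebra K 𝓡 := D.alg.H.map D.R.val

/-- The completion `𝓐` of `A`, that is, its closure in `𝓡`. -/
def cA : Subalgebra K 𝓡 := D.A.topologicalClosure

/-- The completion `𝓑` of `B`, that is, its closure in `𝓡`. -/
def cB : Subalgebra K 𝓡 := D.B.topologicalClosure

theorem ad_mem_of_graded {S : Subalgebra K D.R} {f : ℕ → ℤ}
    (hS : Subalgebra.toSubmodule S =
      ⨆ n : ℕ, Subalgebra.toSubmodule S ⊓ degreePart K D.alg.del (f n))
    {x : 𝓡} (hx : x ∈ (S.map D.R.val).topologicalClosure) :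
    adEnd K D.del x ∈ (S.map D.R.val).topologicalClosure := by
  have hcont : Continuous (adEnd K D.del) :=
    (continuous_const.mul continuous_id).sub (continuous_id.mul continuous_const)
  refine map_mem_closure hcont hx ?_
  rintro _ ⟨y, hy, rfl⟩
  refine ⟨adEnd K D.alg.del y, ?_, rfl⟩
  have h : Subalgebra.toSubmodule S ≤
      (Subalgebra.toSubmodule S).comap (adEnd K D.alg.del) := by
    conv_lhs => rw [hS]
    refine iSup_le fun n z hz => ?_
    have h2 : adEnd K D.alg.del z = ((f n : ℤ) : K) • z := Module.End.mem_eigenspace_iff.1 hz.2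
    rw [Submodule.mem_comap, h2]
    exact Submodule.smul_mem _ _ hz.1
  exact h hy

/-- The endomorphism `ad(∂)` of `𝓐`. -/
def adA : Module.End K D.cA :=
  (adEnd K D.del).restrict (p := Subalgebra.toSubmodule D.cA)
    (q := Subalgebra.toSubmodule D.cA) fun _ hx => D.ad_mem_of_graded D.alg.A_graded hx

/-- The endomorphism `ad(∂)` of `𝓑`. -/
def adB : Module.End K D.cB :=
  (adEnd K D.del).restrict (p := Subalgebra.toSubmodule D.cB)
    (q := Subalgebra.toSubmodule D.cB) fun _ hx => D.ad_mem_of_graded D.alg.B_graded hx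

/-- The subalgebra `𝓑H = 𝓑 ⊗̂ H` of `𝓡`. -/
def cBH : Subalgebra K 𝓡 := D.cB ⊔ D.H

theorem mem_cBH {h : D.R} (hh : h ∈ D.alg.H) : (h : 𝓡) ∈ D.cBH :=
  (le_sup_right : D.H ≤ D.cBH) ⟨h, hh, rfl⟩

/-- The inclusion `H → 𝓑H`. -/
def HtocBH : D.alg.H →+* D.cBH where
  toFun h := ⟨((h : D.R) : 𝓡), D.mem_cBH h.2⟩
  map_one' := rfl
  map_mul' _ _ := rfl
  map_zero' := rfl
  map_add' _ _ := rfl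

/-- The elements `b h` of `𝓑H` with `b ∈ B^{>0}` and `h ∈ H`; they generate the two-sided ideal
`𝓑H^{>0}` of `𝓑H`. -/
def cBHpos : Set D.cBH :=
  {x | ∃ b ∈ D.alg.Bpos, ∃ h ∈ D.alg.H, (x : 𝓡) = (b : 𝓡) * (h : 𝓡)}

/-- The analytic Verma module `𝓡 ⊗_{𝓑H} (𝓑H/𝓑H^{>0} ⊗_H W)`. All the modules in the tensor products
are finitely generated (for `W` irreducible) and the rings are noetherian Banach algebras, so that
no completion is needed. -/
abbrev AnalyticVerma (W : Type w) [AddCommGroup W] [Module D.alg.H W] : Type (max v w) :=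
  InducedModule D.cBH D.cBHpos D.HtocBH W

/-- The simple quotient `L̂(W)` of the analytic Verma module. -/
abbrev AnalyticL (W : Type w) [AddCommGroup W] [Module D.alg.H W] : Type (max v w) :=
  SimpleQuotient 𝓡 (D.AnalyticVerma W)

end DenseTriangularSubalgebra

/-- A triangular decomposition `(R, A, B, H, ∂)` of a Banach `K`-algebra `𝓡`. -/
structure BanachTriangularDecomposition extends DenseTriangularSubalgebra K 𝓡 where
  /-- Multiplication gives an isomorphism of Banach spaces `𝓐 ⊗̂ H ⊗̂ 𝓑 = 𝓡`. -/
  tensor : ∃ e : CompletedTensor K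
      (CompletedTensor K toDenseTriangularSubalgebra.cA toDenseTriangularSubalgebra.H)
      toDenseTriangularSubalgebra.cB ≃L[K] 𝓡,
    ∀ (a : toDenseTriangularSubalgebra.cA) (h : toDenseTriangularSubalgebra.H)
      (b : toDenseTriangularSubalgebra.cB),
      e (CompletedTensor.tmul K (CompletedTensor.tmul K a h) b) = (a : 𝓡) * h * b
  A_semisimple : HasSemisimpleWeightDecomposition toDenseTriangularSubalgebra.adA
  /-- `𝓐^ws = A`. -/
  A_ws : ∀ x : toDenseTriangularSubalgebra.cA,
    x ∈ wsSubspace toDenseTriangularSubalgebra.adA ↔ (x : 𝓡) ∈ toDenseTriangularSubalgebra.A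
  B_semisimple : HasSemisimpleWeightDecomposition toDenseTriangularSubalgebra.adB
  /-- `𝓑^ws = B`. -/
  B_ws : ∀ x : toDenseTriangularSubalgebra.cB,
    x ∈ wsSubspace toDenseTriangularSubalgebra.adB ↔ (x : 𝓡) ∈ toDenseTriangularSubalgebra.B

/-- The canonical topology of a finitely generated `𝓡`-module `M` is the quotient topology for any
surjection `𝓡^r → M`; it is the module topology. -/
theorem moduleTopology_eq_coinduced {M : Type w} [AddCommGroup M] [Module 𝓡 M] {r : ℕ}
    (f : (Fin r → 𝓡) →ₗ[𝓡] M) (hf : Function.Surjective f) :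
    moduleTopology 𝓡 M = TopologicalSpace.coinduced f inferInstance := by
  let : TopologicalSpace M := moduleTopology 𝓡 M
  have : IsModuleTopology 𝓡 M := ⟨rfl⟩
  exact ModuleTopology.eq_coinduced_of_surjective hf

variable {K 𝓡}

/-- `M` is an object of `𝒪̂`: a finitely generated `𝓡`-module which, with its canonical topology,
admits a weight space decomposition for the action of `∂`, and which is a finite `𝓐`-module. -/
def IsInO (D : BanachTriangularDecomposition K 𝓡) (M : Type w) [AddCommGroup M] [Module K M]
    [Module 𝓡 M] [IsScalarTower K 𝓡 M] : Prop :=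
  Module.Finite 𝓡 M ∧
  (letI : TopologicalSpace M := moduleTopology 𝓡 M
   HasWeightDecomposition (Algebra.lsmul K K M D.del)) ∧
  Module.Finite D.cA M

/-- The full subcategory `𝒪̂` of the category of `𝓡`-modules. -/
def catO (D : BanachTriangularDecomposition K 𝓡) :
    CategoryTheory.ObjectProperty (ModuleCat.{w} 𝓡) := fun M =>
  let _ : Module K M := Module.compHom M (algebraMap K 𝓡)
  have : IsScalarTower K 𝓡 M := IsScalarTower.of_algebraMap_smul fun _ _ => rfl
  IsInO D M

end Banach

end AnalyticO

end

/-! Everything rests on one ultrametric fact: if a convergent sum of eigenvectors with eigenvalues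
in a single coset `c + ℤ` is zero, then all its terms are zero
(`hasUniqueWeightSums_of_ultrametric`). Binomial polynomials in the operator take integer values on
the coset, integers have norm at most one, and products of such polynomials separate one term from
any finite set of others. Since `𝓡` is noetherian, submodules of finitely generated modules are
closed (`isClosed_submodule_of_isNoetherian`). So every such module is a quotient of some `𝓡^n` by a
closed submodule, the fact applies to it, and submodules contain the weight components of their
elements (`component_mem`).

The triangular decomposition gives `𝓡 = 𝓐H + 𝓡B^{>0}` with `H ∩ 𝓡B^{>0} = 0`, and `∂` is congruent
modulo `RB^{>0}` to a central element of `H`. Let `W` be a simple `H`-module and `φ : W → M` an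
`H`-linear map whose image is killed by `B^{>0}` and generates `M`. Then `M = 𝓐φ(W)`, `∂` acts on
`φ(W)` by a scalar `λ` (Schur, as `H` is split), elements of `M` are convergent sums of weight
vectors with weights in `λ + ℕ`, and each weight vector lies in a finite-dimensional sum of spaces
`A_n φ(W)`. If `φ ≠ 0`, proper submodules have no component of weight `λ`, so their sum is proper;
this makes `L(W)` and `L̂(W)` simple. The module `𝓡 ⊗_R L(W)` is nonzero, because the maximal
submodule of `Δ(W)` still generates something of positive degree over `𝓡`: its `𝓐`-span is closed
and `R` is dense. It is simple, because a nonzero submodule contains a weight vector, which comes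
from the simple module `L(W)`.

For Jordan–Hölder series, take a weight vector `x ≠ 0` of an object of `𝒪̂`. As `𝓐` is noetherian,
`B_{-n} x = 0` for large `n`, so some `bx ≠ 0` is killed by `B^{>0}` and yields a lowest weight
submodule. All lowest weight vectors inside it have bounded degree, since their weights are roots of
the minimal polynomial of the central element; minimising a dimension in that finite-dimensional
range produces a simple submodule (`IsLowest.exists_simple_submodule`). Noetherian induction gives
the series (`IsInO.hasSeries`).

For the corollary the difficulty is submodules `N ⊆ M`. Uniqueness of weight expansions for
arbitrary weights holds in each simple factor, hence by induction along a series
(`HasSeries.eq_zero_of_hasSum`). Applied to `M/N`, it shows that the components of an element of `N`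
lie in `N`. -/

noncomputable section

namespace AnalyticO

/-! ### Submodules of noetherian Banach modules are closed -/

section Closed

/-- The `K`-linear map `a ↦ ∑ a i • x i`, as a continuous linear map. -/
def linearCombinationCLM (K : Type*) [NontriviallyNormedField K] {S : Type*} [NormedRing S]
    [NormedAlgebra K S] {E : Type*} [NormedAddCommGroup E] [NormedSpace K E]
    [Module S E] [IsScalarTower K S E] [IsBoundedSMul S E] {n : ℕ} (x : Fin n → E) :
    (Fin n → S) →L[K] E where
  toLinearMap := (Fintype.linearCombination S x).restrictScalars K
  cont := by
    change Continuous fun a : Fin n → S => Fintype.linearCombination S x a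
    simp only [Fintype.linearCombination_apply]
    fun_prop

variable (K : Type*) [NontriviallyNormedField K] {S : Type*} [NormedRing S] [NormedAlgebra K S]
  {E : Type*} [NormedAddCommGroup E] [NormedSpace K E]
  [Module S E] [IsScalarTower K S E] [IsBoundedSMul S E]

theorem linearCombinationCLM_apply {n : ℕ} (x : Fin n → E) (a : Fin n → S) :
    linearCombinationCLM K x a = ∑ i, a i • x i := rfl

variable [CompleteSpace S] [CompleteSpace E]

/-- Small perturbations of a finite generating family still generate. -/
theorem exists_perturbation_surjective {n : ℕ} (x : Fin n → E)
    (hx : Function.Surjective (linearCombinationCLM K (S := S) x)) :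
    ∃ ε > 0, ∀ y : Fin n → E, (∀ i, ‖y i - x i‖ ≤ ε) →
      Function.Surjective (linearCombinationCLM K (S := S) y) := by
  have hx' : (linearCombinationCLM K (S := S) x).range = ⊤ := LinearMap.range_eq_top.2 hx
  set g := (linearCombinationCLM K (S := S) x).nonlinearRightInverseOfSurjective hx' with hg
  have hpos := (linearCombinationCLM K (S := S) x).nonlinearRightInverseOfSurjective_nnnorm_pos hx'
  rw [← hg] at hpos
  set c : NNReal := g.nnnorm⁻¹ / 2 with hc
  have hc0 : 0 < c := by positivity
  -- Each of the `n` generators contributes an error of at most `c / (n + 1)` times the norm of the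
  -- coefficients; `n + 1` in place of `n` covers `n = 0`. Since `c` is below the inverse norm of
  -- the right inverse, the perturbed map stays surjective.
  refine ⟨c / (n + 1), by positivity, fun y hy => ?_⟩
  have happ : ApproximatesLinearOn (linearCombinationCLM K (S := S) y)
      (linearCombinationCLM K (S := S) x) Set.univ c := by
    intro a _ b _
    rw [← map_sub, linearCombinationCLM_apply, linearCombinationCLM_apply,
      ← Finset.sum_sub_distrib]
    calc ‖∑ i, ((a - b) i • y i - (a - b) i • x i)‖
        ≤ ∑ i, ‖(a - b) i • y i - (a - b) i • x i‖ := norm_sum_le _ _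
      _ ≤ ∑ _i : Fin n, ‖a - b‖ * (c / (n + 1)) := by
          refine Finset.sum_le_sum fun i _ => ?_
          rw [← smul_sub]
          refine (norm_smul_le _ _).trans ?_
          exact mul_le_mul (norm_le_pi_norm _ _) (hy i) (norm_nonneg _) (norm_nonneg _)
      _ = (n / (n + 1)) * (c * ‖a - b‖) := by
          rw [Finset.sum_const, Finset.card_univ, Fintype.card_fin, nsmul_eq_mul]; ring
      _ ≤ 1 * (c * ‖a - b‖) := by
          refine mul_le_mul_of_nonneg_right ?_ (by positivity)
          rw [div_le_one (by positivity)]; linarith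
      _ = c * ‖a - b‖ := one_mul _
  have hd : (0 : ℝ) < (g.nnnorm : ℝ)⁻¹ - c := by
    have : (0 : ℝ) < (g.nnnorm : ℝ)⁻¹ := by positivity
    rw [hc]; push_cast; linarith
  intro z
  have hs := happ.surjOn_closedBall_of_nonlinearRightInverse g (b := 0)
    (show 0 ≤ ‖z‖ / ((g.nnnorm : ℝ)⁻¹ - c) by positivity) (Set.subset_univ _)
  rw [map_zero, mul_div_cancel₀ _ hd.ne'] at hs
  obtain ⟨a, -, ha⟩ := hs (show z ∈ Metric.closedBall 0 ‖z‖ by simp)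
  exact ⟨a, ha⟩

-- The closure `P` of `N` is finitely generated, by noetherianity. Its generators can be
-- approximated by elements of `N`, and by `exists_perturbation_surjective` good approximations
-- still generate `P`; hence `P = N`.
include K in
theorem isClosed_submodule_of_isNoetherian [IsNoetherian S E] (N : Submodule S E) :
    IsClosed (N : Set E) := by
  set P := N.topologicalClosure with hP
  obtain ⟨n, x, hx⟩ := Submodule.fg_iff_exists_fin_generating_family.1 (IsNoetherian.noetherian P)
  have hPc : IsClosed (P : Set E) := N.isClosed_topologicalClosure
  have hxP : ∀ i, x i ∈ P := fun i => hx ▸ Submodule.subset_span ⟨i, rfl⟩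
  let : NormedAddCommGroup P := inferInstance
  let : NormedSpace K P := inferInstanceAs (NormedSpace K (P.restrictScalars K))
  have : CompleteSpace P := hPc.completeSpace_coe
  have : IsScalarTower K S P := ⟨fun a b c => Subtype.ext (smul_assoc a b (c : E))⟩
  have : IsBoundedSMul S P := IsBoundedSMul.of_norm_smul_le fun a b => norm_smul_le a (b : E)
  let x' : Fin n → P := fun i => ⟨x i, hxP i⟩
  have hsurj : Function.Surjective (linearCombinationCLM K (S := S) x') := by
    rintro ⟨y, hy⟩
    have hy' := hy
    rw [← hx, ← Fintype.range_linearCombination] at hy'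
    obtain ⟨a, ha⟩ := hy'
    refine ⟨a, Subtype.ext ?_⟩
    rw [linearCombinationCLM_apply]
    simp [x', ← ha, Fintype.linearCombination_apply]
  obtain ⟨ε, hε, h⟩ := exists_perturbation_surjective K x' hsurj
  have hy : ∀ i, ∃ y ∈ N, ‖y - x i‖ ≤ ε := fun i => by
    obtain ⟨y, hy, hd⟩ := Metric.mem_closure_iff.1 (show x i ∈ closure (N : Set E) from hxP i) ε hε
    exact ⟨y, hy, by rw [← dist_eq_norm, dist_comm]; exact hd.le⟩
  choose y hyN hyx using hy
  have hs := h (fun i => ⟨y i, N.le_topologicalClosure (hyN i)⟩) fun i => hyx i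
  have hle : P ≤ N := fun z hz => by
    obtain ⟨a, ha⟩ := hs ⟨z, hz⟩
    have ha' := congrArg Subtype.val ha
    rw [linearCombinationCLM_apply] at ha'
    simp only [AddSubmonoidClass.coe_finsetSum, Submodule.coe_smul] at ha'
    rw [← ha']
    exact Submodule.sum_mem _ fun i _ => N.smul_mem _ (hyN i)
  have : P = N := le_antisymm hle N.le_topologicalClosure
  rw [← this]; exact hPc

include K in
/-- A Banach module over a Banach algebra, if it is finitely generated, carries the module
topology. -/
theorem isModuleTopology_of_finite [Module.Finite S E] : IsModuleTopology S E := by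
  obtain ⟨n, f, hf⟩ := Module.Finite.exists_fin' S E
  have hcont : Continuous f := IsModuleTopology.continuous_of_linearMap f
  let f' : (Fin n → S) →L[K] E := ⟨f.restrictScalars K, hcont⟩
  have hq : Topology.IsQuotientMap f := (f'.isOpenMap hf).isQuotientMap hcont hf
  refine ⟨?_⟩
  rw [moduleTopology_eq_coinduced S f hf]
  exact hq.eq_coinduced

end Closed

/-! ### Norms on quotient modules -/

section Ultra
variable {R E : Type*} [Ring R] [NormedAddCommGroup E] [IsUltrametricDist E] [Module R E]

theorem isUltrametricDist_quotient (N : Submodule R E) [IsClosed (N : Set E)] :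
    IsUltrametricDist (E ⧸ N) := by
  refine IsUltrametricDist.isUltrametricDist_of_forall_norm_add_le_max_norm fun x y => ?_
  refine le_of_forall_pos_lt_add fun ε hε => ?_
  obtain ⟨a, rfl, ha⟩ := Submodule.Quotient.norm_mk_lt x hε
  obtain ⟨b, rfl, hb⟩ := Submodule.Quotient.norm_mk_lt y hε
  rw [← Submodule.Quotient.mk_add]
  refine ((Submodule.Quotient.norm_mk_le _ _).trans 
    (IsUltrametricDist.norm_add_le_max a b)).trans_lt ?_
  rw [max_add]
  exact max_lt_max ha hb

theorem isBoundedSMul_quotient {S F : Type*} [NormedRing S] [NormedAddCommGroup F] [Module S F]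
    [IsBoundedSMul S F] (N : Submodule S F) [IsClosed (N : Set F)] :
    IsBoundedSMul S (F ⧸ N) := by
  refine IsBoundedSMul.of_norm_smul_le fun s x => ?_
  refine le_of_forall_pos_le_add fun ε hε => ?_
  obtain ⟨a, rfl, ha⟩ := Submodule.Quotient.norm_mk_lt x (show 0 < ε / (‖s‖ + 1) by positivity)
  rw [← Submodule.Quotient.mk_smul]
  calc _ ≤ ‖s • a‖ := Submodule.Quotient.norm_mk_le _ _
    _ ≤ ‖s‖ * ‖a‖ := norm_smul_le _ _
    _ ≤ ‖s‖ * (‖(Submodule.Quotient.mk a : F ⧸ N)‖ + ε / (‖s‖ + 1)) := by gcongr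
    _ = ‖s‖ * ‖(Submodule.Quotient.mk a : F ⧸ N)‖ + (‖s‖ / (‖s‖ + 1)) * ε := by ring
    _ ≤ ‖s‖ * ‖(Submodule.Quotient.mk a : F ⧸ N)‖ + 1 * ε := by
        gcongr
        rw [div_le_one (by positivity)]; linarith
    _ = _ := by rw [one_mul]

end Ultra

/-! ### Uniqueness of convergent weight expansions -/

section WeightSums

open Polynomial

/-- The polynomial is the binomial coefficient `choose(±(X - c - m), d)` with `d = |n₀ - m|` and the
sign chosen so that the upper entry is `d` at `c + n₀`. Integer values matter because integers have
norm at most one in an ultrametric field, whereas Lagrange interpolation would give no bound at the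
other weights. -/
theorem exists_integer_valued_polynomial {K : Type*} [Field K] [CharZero K] (c : K) {n₀ m : ℤ}
    (h : n₀ ≠ m) : ∃ (f : K[X]) (g : ℤ → ℤ), (∀ n : ℤ, f.eval (c + n) = g n) ∧
      g n₀ = 1 ∧ g m = 0 := by
  set d : ℕ := (n₀ - m).natAbs with hd
  set s : ℤ := (n₀ - m).sign with hs
  have hd0 : d ≠ 0 := by omega
  refine ⟨C ((d.factorial : K)⁻¹) * ((descPochhammer ℤ d).map (Int.castRingHom K)).comp
    (C (s : K) * (X - C (c + m))), fun n => Ring.choose (s * (n - m)) d, fun n => ?_, ?_, ?_⟩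
  · have h3 : (s : K) * (c + n - (c + m)) = ((s * (n - m) : ℤ) : K) := by push_cast; ring
    have h4 := Ring.map_choose (Int.castRingHom K) (s * (n - m)) d
    simp only [eq_intCast] at h4
    simp only [eval_mul, eval_C, eval_comp, eval_sub, eval_X]
    rw [h3, h4, Ring.choose_eq_smul, ← aeval_eq_smeval, eval_map, smul_eq_mul]
    rfl
  · have : s * (n₀ - m) = (d : ℤ) := by rw [hs, hd, Int.sign_mul_self_eq_natAbs]
    simp only [this]
    rw [Ring.choose_natCast, Nat.choose_self, Nat.cast_one]
  · simp only [sub_self, mul_zero]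
    exact Ring.choose_zero_pos ℤ (Nat.pos_of_ne_zero hd0)

theorem exists_separating_polynomial {K : Type*} [Field K] [CharZero K] (c : K) (n₀ : ℤ)
    (F : Finset ℤ) : ∃ (f : K[X]) (g : ℤ → ℤ), (∀ n : ℤ, f.eval (c + n) = g n) ∧ g n₀ = 1 ∧
      ∀ m ∈ F, m ≠ n₀ → g m = 0 := by
  classical
  have h : ∀ m : ℤ, ∃ (f : K[X]) (g : ℤ → ℤ), (∀ n : ℤ, f.eval (c + n) = g n) ∧ g n₀ = 1 ∧
      (m ≠ n₀ → g m = 0) := fun m => by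
    by_cases hm : m = n₀
    · exact ⟨1, 1, by simp, rfl, fun h => absurd hm h⟩
    · obtain ⟨f, g, h1, h2, h3⟩ := exists_integer_valued_polynomial c (Ne.symm hm)
      exact ⟨f, g, h1, h2, fun _ => h3⟩
  choose f g h1 h2 h3 using h
  refine ⟨∏ m ∈ F, f m, fun n => ∏ m ∈ F, g m n, fun n => ?_, ?_, fun m hm hmn => ?_⟩
  · rw [eval_prod]; push_cast; exact Finset.prod_congr rfl fun m _ => h1 m n
  · exact Finset.prod_eq_one fun m _ => h2 m
  · exact Finset.prod_eq_zero hm (h3 m hmn)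

theorem aeval_apply_of_smul {K V : Type*} [Field K] [AddCommGroup V] [Module K V]
    {T : Module.End K V} {a : K} {v : V} (h : T v = a • v) (f : K[X]) :
    aeval T f v = f.eval a • v := by
  by_cases hv : v = 0
  · simp [hv]
  · exact Module.End.aeval_apply_of_hasEigenvector ⟨Module.End.mem_eigenspace_iff.2 h, hv⟩

variable {K : Type*} [NontriviallyNormedField K] {V : Type*} [AddCommGroup V] [Module K V]
  [TopologicalSpace V]

/-- Convergent sums of eigenvectors with eigenvalues in a coset of `ℤ` have unique terms. -/
def HasUniqueWeightSums (T : Module.End K V) : Prop :=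
  ∀ (c : K) (u : ℤ → V), (∀ n, T (u n) = (c + n) • u n) → HasSum u 0 → u = 0

theorem continuous_aeval [ContinuousAdd V] [ContinuousConstSMul K V]
    {T : Module.End K V} (hT : Continuous T) (f : K[X]) : Continuous (aeval T f) := by
  induction f using Polynomial.induction_on' with
  | add p q hp hq => rw [map_add]; exact hp.add hq
  | monomial n a =>
    rw [aeval_monomial]
    have : Continuous (T ^ n) := by
      rw [Module.End.coe_pow]; exact hT.iterate n
    change Continuous fun v => algebraMap K (Module.End K V) a ((T ^ n) v)
    simp only [Module.algebraMap_end_apply]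
    exact this.const_smul a

/-- If `u n₀ ≠ 0`, only finitely many terms have norm at least `‖u n₀‖ / 2`. An integer-valued
polynomial in `T` keeps `u n₀`, kills the other large terms and does not enlarge the small ones, so
that `-u n₀` becomes a sum of terms of norm at most `‖u n₀‖ / 2`. -/
theorem hasUniqueWeightSums_of_ultrametric [IsUltrametricDist K] [CharZero K]
    {V : Type*} [NormedAddCommGroup V] [NormedSpace K V] [IsUltrametricDist V]
    {T : Module.End K V} (hT : Continuous T) : HasUniqueWeightSums T := by
  classical
  intro c u hu hs
  funext n₀
  by_contra h0
  have hpos : 0 < ‖u n₀‖ / 2 := half_pos (norm_pos_iff.2 h0)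
  have hev := (Metric.tendsto_nhds.1 hs.summable.tendsto_cofinite_zero) _ hpos
  rw [Filter.eventually_cofinite] at hev
  obtain ⟨f, g, hf, hg0, hgF⟩ := exists_separating_polynomial c n₀ hev.toFinset
  have h1 : HasSum (fun n => (g n : K) • u n) 0 := by
    have := hs.map (aeval T f) (continuous_aeval hT f)
    rw [map_zero] at this
    convert this using 2 with n
    rw [Function.comp, aeval_apply_of_smul (hu n), hf]
  have h2 := h1.update n₀ 0
  rw [hg0, Int.cast_one, one_smul, add_zero, zero_sub] at h2
  have h3 : ‖-u n₀‖ ≤ ‖u n₀‖ / 2 := by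
    rw [← h2.tsum_eq]
    refine IsUltrametricDist.norm_tsum_le_of_forall_le_of_nonneg hpos.le fun n => ?_
    by_cases hn : n = n₀
    · subst hn; simp [hpos.le]
    · rw [Function.update_of_ne hn]
      by_cases hn' : n ∈ hev.toFinset
      · rw [hgF n hn' hn]; simpa using hpos.le
      · have : ‖u n‖ < ‖u n₀‖ / 2 := by simpa using hn'
        calc _ ≤ ‖(g n : K)‖ * ‖u n‖ := norm_smul_le _ _
          _ ≤ 1 * ‖u n‖ := by gcongr; exact IsUltrametricDist.norm_intCast_le_one _ _
          _ ≤ _ := by rw [one_mul]; exact this.le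
  rw [norm_neg] at h3
  linarith

variable [IsTopologicalAddGroup V] [ContinuousConstSMul K V]

/-- The convergent sums of eigenvectors with eigenvalues in `c + ℤ_{≥ k}`. -/
def weightTail (T : Module.End K V) (c : K) (k : ℤ) : Submodule K V where
  carrier := {x | ∃ u : ℤ → V, (∀ n, T (u n) = (c + n) • u n) ∧ (∀ n < k, u n = 0) ∧ HasSum u x}
  add_mem' := by
    rintro x y ⟨u, hu, hu', hx⟩ ⟨w, hw, hw', hy⟩
    exact ⟨u + w, fun n => by simp [hu, hw], fun n hn => by simp [hu' n hn, hw' n hn], hx.add hy⟩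
  zero_mem' := ⟨0, by simp, by simp, hasSum_zero⟩
  smul_mem' := by
    rintro a x ⟨u, hu, hu', hx⟩
    exact ⟨a • u, fun n => by simp [hu, smul_comm a], fun n hn => by simp [hu' n hn],
      hx.const_smul a⟩

variable {T : Module.End K V} {c : K}

theorem mem_weightTail_iff {k : ℤ} {x : V} : x ∈ weightTail T c k ↔
    ∃ u : ℤ → V, (∀ n, T (u n) = (c + n) • u n) ∧ (∀ n < k, u n = 0) ∧ HasSum u x := Iff.rfl

theorem weightTail_anti {k l : ℤ} (h : k ≤ l) : weightTail T c l ≤ weightTail T c k := by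
  rintro x ⟨u, hu, hu', hx⟩
  exact ⟨u, hu, fun n hn => hu' n (hn.trans_le h), hx⟩

theorem weightTail_shift {k l : ℤ} : weightTail T (c + l) k = weightTail T c (k + l) := by
  ext x
  constructor
  · rintro ⟨u, hu, hu', hx⟩
    refine ⟨fun n => u (n - l), fun n => ?_, fun n hn => hu' _ (by omega),
      (Equiv.subRight l).hasSum_iff.2 hx⟩
    rw [hu]; congr 1; push_cast; ring
  · rintro ⟨u, hu, hu', hx⟩
    refine ⟨fun n => u (n + l), fun n => ?_, fun n hn => hu' _ (by omega),
      (Equiv.addRight l).hasSum_iff.2 hx⟩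
    rw [hu]; congr 1; push_cast; ring

theorem HasUniqueWeightSums.eq (hT : HasUniqueWeightSums T) {u w : ℤ → V}
    (hu : ∀ n, T (u n) = (c + n) • u n) (hw : ∀ n, T (w n) = (c + n) • w n) {x : V}
    (hx : HasSum u x) (hy : HasSum w x) : u = w := by
  rw [← sub_eq_zero]
  refine hT c _ (fun n => by simp [hu, hw, smul_sub]) ?_
  have := hx.add hy.neg
  rw [add_neg_cancel] at this
  convert this using 2 with n
  simp [sub_eq_add_neg]

/-- This is the form in which uniqueness is mostly used: a weight vector of degree `j` cannot be a
convergent sum of weight vectors of degrees `≥ k > j`. -/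
theorem HasUniqueWeightSums.eq_zero (hT : HasUniqueWeightSums T) {j k : ℤ}
    (hjk : j < k) {x : V} (hx : T x = (c + j) • x) (hx' : x ∈ weightTail T c k) : x = 0 := by
  classical
  obtain ⟨u, hu, hu', hs⟩ := hx'
  have h := hT.eq hu (w := Pi.single j x) (fun n => ?_) hs (hasSum_pi_single j x)
  · have := congrFun h j
    rw [hu' j hjk, Pi.single_eq_same] at this
    exact this.symm
  · by_cases h : n = j
    · subst h; simpa using hx
    · simp [Pi.single_eq_of_ne h]

end WeightSums

/-! ### The canonical topology of finitely generated modules -/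

section FiniteModules

variable (K : Type*) [NontriviallyNormedField K] {𝓡 : Type*} [NormedRing 𝓡] [NormedAlgebra K 𝓡]

theorem continuousConstSMul_of_isModuleTopology (𝓡 : Type*) [NormedRing 𝓡] [NormedAlgebra K 𝓡]
    (M : Type*) [AddCommGroup M] [Module K M]
    [Module 𝓡 M] [IsScalarTower K 𝓡 M] [TopologicalSpace M] [IsModuleTopology 𝓡 M] :
    ContinuousConstSMul K M :=
  ⟨fun c => by
    have h : (fun x : M => c • x) = fun x => algebraMap K 𝓡 c • x :=
      funext fun x => (algebraMap_smul 𝓡 c x).symm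
    rw [h]
    exact continuous_const_smul _⟩

variable [CompleteSpace 𝓡] [IsNoetherianRing 𝓡]

include K in
theorem exists_banach_model (M : Type*) [AddCommGroup M]
    [Module 𝓡 M] [TopologicalSpace M] [IsModuleTopology 𝓡 M] [Module.Finite 𝓡 M] :
    ∃ (n : ℕ) (N : Submodule 𝓡 (Fin n → 𝓡)), IsClosed (N : Set (Fin n → 𝓡)) ∧
      Nonempty (M ≃L[𝓡] ((Fin n → 𝓡) ⧸ N)) := by
  obtain ⟨n, f, hf⟩ := Module.Finite.exists_fin' 𝓡 M
  refine ⟨n, LinearMap.ker f, isClosed_submodule_of_isNoetherian K _, ?_⟩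
  let e := (f.quotKerEquivOfSurjective hf).symm
  have := IsModuleTopology.topologicalAddGroup 𝓡 M
  exact ⟨{ e with
    continuous_toFun := IsModuleTopology.continuous_of_linearMap e.toLinearMap
    continuous_invFun := IsModuleTopology.continuous_of_linearMap e.symm.toLinearMap }⟩

variable {M : Type*} [AddCommGroup M] [Module 𝓡 M] [TopologicalSpace M] [IsModuleTopology 𝓡 M]
    [Module.Finite 𝓡 M]

include K in
/-- Submodules of finitely generated modules carry the subspace topology. -/
theorem isModuleTopology_submodule (N : Submodule 𝓡 M) : IsModuleTopology 𝓡 N := by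
  obtain ⟨n, P, hP, ⟨e⟩⟩ := exists_banach_model K (𝓡 := 𝓡) M
  let : NormedAddCommGroup ((Fin n → 𝓡) ⧸ P) := inferInstance
  have : IsBoundedSMul 𝓡 ((Fin n → 𝓡) ⧸ P) := isBoundedSMul_quotient P
  let N' : Submodule 𝓡 ((Fin n → 𝓡) ⧸ P) := N.map e.toLinearMap
  have hN' : IsClosed (N' : Set ((Fin n → 𝓡) ⧸ P)) := isClosed_submodule_of_isNoetherian K N'
  let : NormedSpace K N' := inferInstanceAs (NormedSpace K (N'.restrictScalars K))
  have : CompleteSpace N' := hN'.completeSpace_coe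
  have : IsScalarTower K 𝓡 N' := ⟨fun a b c => Subtype.ext (smul_assoc a b c.1)⟩
  have : IsBoundedSMul 𝓡 N' := IsBoundedSMul.of_norm_smul_le fun a b => norm_smul_le a b.1
  have : IsModuleTopology 𝓡 N' := isModuleTopology_of_finite K
  let e' : N' ≃L[𝓡] N := ContinuousLinearEquiv.symm
    { e.toLinearEquiv.submoduleMap N with
      continuous_toFun := (e.continuous.comp continuous_subtype_val).subtype_mk _
      continuous_invFun := by
        refine Continuous.subtype_mk (e.symm.continuous.comp continuous_subtype_val) _ }
  exact IsModuleTopology.iso e'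

include K in
/-- If `M` is finite over the closed noetherian subalgebra `S`, then `S`-submodules of `M` are
closed, so that membership of `r • x` may be checked for `r` in a dense set. -/
theorem smul_mem_of_dense (S : Subalgebra K 𝓡) (hS : IsClosed (S : Set 𝓡)) [IsNoetherianRing S]
    [Module.Finite S M] (P : Submodule S M) {D : Set 𝓡} (hD : Dense D) {x : M}
    (hx : ∀ r ∈ D, r • x ∈ P) (r : 𝓡) : r • x ∈ P := by
  obtain ⟨n, Q, hQ, ⟨e⟩⟩ := exists_banach_model K (𝓡 := 𝓡) M
  let : NormedAddCommGroup ((Fin n → 𝓡) ⧸ Q) := inferInstance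
  have : IsBoundedSMul 𝓡 ((Fin n → 𝓡) ⧸ Q) := isBoundedSMul_quotient Q
  have : IsBoundedSMul S ((Fin n → 𝓡) ⧸ Q) :=
    IsBoundedSMul.of_norm_smul_le fun a b => norm_smul_le (a : 𝓡) b
  have : CompleteSpace S := hS.completeSpace_coe
  let e' : M ≃ₗ[S] ((Fin n → 𝓡) ⧸ Q) :=
    { e.toLinearEquiv with map_smul' := fun a b => map_smul e (a : 𝓡) b }
  have : Module.Finite S ((Fin n → 𝓡) ⧸ Q) := Module.Finite.equiv e'
  have hc : IsClosed ((P.map e'.toLinearMap : Submodule S _) : Set ((Fin n → 𝓡) ⧸ Q)) :=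
    isClosed_submodule_of_isNoetherian K _
  have hcont : Continuous fun r : 𝓡 => r • e x := continuous_id.smul continuous_const
  have h : ∀ r ∈ closure D, r • e x ∈ (P.map e'.toLinearMap : Submodule S _) := fun r hr =>
    closure_minimal (t := (fun r : 𝓡 => r • e x) ⁻¹' (P.map e'.toLinearMap : Submodule S _))
      (fun r hr => ⟨r • x, hx r hr, map_smul e r x⟩) (hc.preimage hcont) hr
  obtain ⟨y, hy, hye⟩ := h r (hD.closure_eq ▸ Set.mem_univ r)
  have : y = r • x := e.injective (hye.trans (map_smul e r x).symm)
  exact this ▸ hy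

theorem hasUniqueWeightSums_of_finite [Module K M] [IsScalarTower K 𝓡 M]
    [IsUltrametricDist K] [CharZero K]
    [IsUltrametricDist 𝓡] (x : 𝓡) : HasUniqueWeightSums (Algebra.lsmul K K M x) := by
  intro c u hu hs
  obtain ⟨n, P, hP, ⟨e⟩⟩ := exists_banach_model K (𝓡 := 𝓡) M
  have : IsUltrametricDist ((Fin n → 𝓡) ⧸ P) := isUltrametricDist_quotient P
  have : IsBoundedSMul 𝓡 ((Fin n → 𝓡) ⧸ P) := isBoundedSMul_quotient P
  have h := hasUniqueWeightSums_of_ultrametric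
    (T := Algebra.lsmul K K ((Fin n → 𝓡) ⧸ P) x) (continuous_const_smul x) c (fun n => e (u n))
    (fun n => ?_) (by have := hs.map e e.continuous; rw [map_zero] at this; exact this)
  · funext n
    exact e.injective ((congrFun h n).trans (map_zero e).symm)
  · have := congrArg e (hu n)
    rw [← algebraMap_smul 𝓡, map_smul, algebraMap_smul] at this
    rw [← this]
    exact (map_smul e x (u n)).symm

end FiniteModules

/-! ### The grading of `R` by `ad(∂)` -/

section Degrees

variable {K : Type*} {R : Type*} [Field K] [Ring R] [Algebra K R]

theorem mem_degreePart {d x : R} {n : ℤ} :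
    x ∈ degreePart K d n ↔ d * x - x * d = (n : K) • x := Module.End.mem_eigenspace_iff

theorem mul_mem_degreePart {d x y : R} {n m : ℤ} (hx : x ∈ degreePart K d n)
    (hy : y ∈ degreePart K d m) : x * y ∈ degreePart K d (n + m) := by
  rw [mem_degreePart] at *
  have : d * (x * y) - x * y * d = (d * x - x * d) * y + x * (d * y - y * d) := by noncomm_ring
  rw [this, hx, hy, smul_mul_assoc, mul_smul_comm, ← add_smul]
  push_cast; rfl

theorem degreePart_mul_le (d : R) (n m : ℤ) :
    degreePart K d n * degreePart K d m ≤ degreePart K d (n + m) :=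
  Submodule.mul_le.2 fun _ hx _ hy => mul_mem_degreePart hx hy

/-- An element of `W i` is the sum of one in `U i` and one in the span of the other `U j`; the
second lies in `W i` and in the span of the other `W j`, so it is zero. -/
theorem iSupIndep.eq_of_le_of_iSup_eq_top {ι V : Type*} [AddCommGroup V] [Module K V]
    {U W : ι → Submodule K V} (hW : iSupIndep W) (hle : ∀ i, U i ≤ W i) (hU : ⨆ i, U i = ⊤) :
    U = W := by
  classical
  funext i
  refine le_antisymm (hle i) fun x hx => ?_
  have h1 : x ∈ U i ⊔ ⨆ (j) (_ : j ≠ i), U j := by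
    rw [← iSup_split_single, hU]; trivial
  obtain ⟨y, hy, z, hz, rfl⟩ := Submodule.mem_sup.1 h1
  have hz' : z ∈ ⨆ (j) (_ : j ≠ i), W j := (iSup₂_mono fun j _ => hle j) hz
  have hz'' : z ∈ W i := by simpa using (W i).sub_mem hx (hle i hy)
  have : z = 0 := Submodule.disjoint_def.1 (hW i) z hz'' hz'
  rwa [this, add_zero]

namespace TriangularDecomposition

variable (D : TriangularDecomposition K R)

/-- The graded piece `A_n`. -/
abbrev An (n : ℕ) : Submodule K R := Subalgebra.toSubmodule D.A ⊓ degreePart K D.del n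

/-- The graded piece `B_{-n}`. -/
abbrev Bn (n : ℕ) : Submodule K R := Subalgebra.toSubmodule D.B ⊓ degreePart K D.del (-n)

theorem An_zero : D.An 0 = 1 := by
  have := D.A_zero
  rw [Algebra.toSubmodule_bot] at this
  exact_mod_cast this

theorem Bn_zero : D.Bn 0 = 1 := by
  have := D.B_zero
  rw [Algebra.toSubmodule_bot] at this
  simpa [Bn] using this

theorem Bpos_eq : D.Bpos = ⨆ n : ℕ, D.Bn (n + 1) := by
  simp only [Bpos, Bn, Nat.cast_add, Nat.cast_one]

theorem Bn_le_Bpos {n : ℕ} (hn : n ≠ 0) : D.Bn n ≤ D.Bpos := by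
  obtain ⟨m, rfl⟩ := Nat.exists_eq_succ_of_ne_zero hn
  rw [Bpos_eq]
  exact le_iSup (fun n => D.Bn (n + 1)) m

theorem toSubmodule_B_eq : Subalgebra.toSubmodule D.B = 1 ⊔ D.Bpos := by
  rw [D.B_graded, ← sup_iSup_nat_succ, Bpos]
  congr 1
  · have := D.Bn_zero
    rwa [Bn] at this

theorem Bpos_le_B : D.Bpos ≤ Subalgebra.toSubmodule D.B :=
  le_sup_right.trans D.toSubmodule_B_eq.ge

theorem iSupIndep_degreePart : iSupIndep (degreePart K D.del) :=
  D.graded.submodule_iSupIndep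

theorem mul_eq_top : Subalgebra.toSubmodule D.A * Subalgebra.toSubmodule D.H *
    Subalgebra.toSubmodule D.B = ⊤ := by
  obtain ⟨e, he⟩ := D.tensor
  rw [eq_top_iff]
  rintro x -
  obtain ⟨t, rfl⟩ := e.surjective x
  induction t with
  | zero => rw [LinearEquiv.map_zero]; exact Submodule.zero_mem _
  | add s t hs ht => rw [LinearEquiv.map_add]; exact Submodule.add_mem _ hs ht
  | tmul s b =>
    induction s with
    | zero => rw [TensorProduct.zero_tmul, LinearEquiv.map_zero]; exact Submodule.zero_mem _
    | add s t hs ht =>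
      rw [TensorProduct.add_tmul, LinearEquiv.map_add]
      exact Submodule.add_mem _ hs ht
    | tmul a h => rw [he]; exact Submodule.mul_mem_mul (Submodule.mul_mem_mul a.2 h.2) b.2

theorem Bpos_le_negative : D.Bpos ≤ ⨆ (j : ℤ) (_ : j ≠ 0), degreePart K D.del j := by
  refine iSup_le fun n => inf_le_right.trans ?_
  exact le_iSup₂ (f := fun (j : ℤ) (_ : j ≠ 0) => degreePart K D.del j) (-((n : ℤ) + 1)) (by omega)

theorem H_mul_nonzero_le : Subalgebra.toSubmodule D.H *
    (⨆ (j : ℤ) (_ : j ≠ 0), degreePart K D.del j) ≤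
      ⨆ (j : ℤ) (_ : j ≠ 0), degreePart K D.del j := by
  simp only [Submodule.mul_iSup]
  refine iSup₂_mono fun j _ => (mul_le_mul' D.H_zero le_rfl).trans ?_
  simpa using degreePart_mul_le (K := K) D.del 0 j

theorem nonzero_mul_H_le : (⨆ (j : ℤ) (_ : j ≠ 0), degreePart K D.del j) *
    Subalgebra.toSubmodule D.H ≤ ⨆ (j : ℤ) (_ : j ≠ 0), degreePart K D.del j := by
  simp only [Submodule.iSup_mul]
  refine iSup₂_mono fun j _ => (mul_le_mul' le_rfl D.H_zero).trans ?_
  simpa using degreePart_mul_le (K := K) D.del j 0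

/-- By `BH = HB` and `B = K + B^{>0}`, an element of `B^{>0}H` has the form `h + y` with `h ∈ H` and
`y ∈ HB^{>0}`. Both `B^{>0}H` and `HB^{>0}` live in nonzero degrees while `h` has degree zero, so `h
= 0`. -/
theorem Bpos_mul_H_le : D.Bpos * Subalgebra.toSubmodule D.H ≤
    Subalgebra.toSubmodule D.H * D.Bpos := by
  intro x hx
  have h1 : x ∈ Subalgebra.toSubmodule D.H * Subalgebra.toSubmodule D.B := by
    rw [← D.BH_comm]; exact mul_le_mul' D.Bpos_le_B le_rfl hx
  rw [toSubmodule_B_eq, Submodule.mul_sup, mul_one] at h1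
  obtain ⟨h, hh, y, hy, rfl⟩ := Submodule.mem_sup.1 h1
  have h2 := D.nonzero_mul_H_le (mul_le_mul' D.Bpos_le_negative le_rfl hx)
  have h3 := D.H_mul_nonzero_le (mul_le_mul' le_rfl D.Bpos_le_negative hy)
  have h4 : h ∈ ⨆ (j : ℤ) (_ : j ≠ 0), degreePart K D.del j := by
    simpa using Submodule.sub_mem _ h2 h3
  have : h = 0 := Submodule.disjoint_def.1 (D.iSupIndep_degreePart 0) h (D.H_zero hh) h4
  rwa [this, zero_add]

/-- The part of degree zero of `R` is `H + (R B^{>0})_0`. -/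
theorem degreePart_zero_le : degreePart K D.del 0 ≤
    Subalgebra.toSubmodule D.H ⊔ ⊤ * D.Bpos := by
  -- The products `A_n H B_{-m}` have degree `n - m` and together span `R`, so those with `n = m`
  -- span `R_0`: the one with `m = 0` is `H`, the others lie in `RB^{>0}`.
  let U : ℤ → Submodule K R := fun k => ⨆ (n : ℕ) (m : ℕ) (_ : (n : ℤ) - m = k),
    D.An n * Subalgebra.toSubmodule D.H * D.Bn m
  have hle : ∀ k, U k ≤ degreePart K D.del k := fun k => by
    refine iSup_le fun n => iSup_le fun m => iSup_le fun h => ?_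
    refine (mul_le_mul' (mul_le_mul' inf_le_right D.H_zero) inf_le_right).trans ?_
    refine (mul_le_mul' (degreePart_mul_le _ _ _) le_rfl).trans
      ((degreePart_mul_le _ _ _).trans_eq ?_)
    congr 1
  have htop : ⨆ k, U k = ⊤ := by
    rw [eq_top_iff, ← D.mul_eq_top]
    conv_lhs => rw [D.A_graded, D.B_graded]
    simp only [Submodule.iSup_mul, Submodule.mul_iSup]
    refine iSup_le fun m => iSup_le fun n => ?_
    refine le_trans ?_ (le_iSup U (n - m))
    exact le_iSup_of_le n (le_iSup_of_le m (le_iSup_of_le rfl le_rfl))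
  have hU := congrFun (iSupIndep.eq_of_le_of_iSup_eq_top D.iSupIndep_degreePart hle htop) 0
  rw [← hU]
  refine iSup_le fun n => iSup_le fun m => iSup_le fun h => ?_
  by_cases hn : m = 0
  · have hn' : n = 0 := by omega
    subst hn hn'
    rw [An_zero, Bn_zero, one_mul, mul_one]
    exact le_sup_left
  · exact (mul_le_mul' le_top (D.Bn_le_Bpos hn)).trans le_sup_right

theorem exists_del_sub_mem : ∃ h ∈ D.H, D.del - h ∈ (⊤ * D.Bpos : Submodule K R) := by
  have h : D.del ∈ degreePart K D.del 0 := by simp [mem_degreePart]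
  obtain ⟨h, hh, y, hy, hxy⟩ := Submodule.mem_sup.1 (D.degreePart_zero_le h)
  exact ⟨h, hh, by rwa [← hxy, add_sub_cancel_left]⟩

theorem del_mul_comm {h : R} (hh : h ∈ D.H) : D.del * h = h * D.del := by
  have := mem_degreePart.1 (D.H_zero hh)
  simpa [sub_eq_zero] using this

theorem finite_H : Module.Finite K D.H := by
  obtain ⟨k, d, ⟨e⟩⟩ := D.H_split
  exact Module.Finite.equiv e.symm.toLinearEquiv

theorem isSemisimpleRing_H : IsSemisimpleRing D.H := by
  obtain ⟨k, d, ⟨e⟩⟩ := D.H_split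
  exact e.symm.toRingEquiv.isSemisimpleRing

end TriangularDecomposition

end Degrees

/-! ### Schur's lemma for split semi-simple algebras -/

section Schur

/-- An element of a split semi-simple algebra which commutes with the action of the algebra on a
simple module acts as a scalar. -/
theorem exists_scalar_of_commute {K H W : Type*} [Field K] [Ring H] [Algebra K H]
    (hH : ∃ (k : ℕ) (d : Fin k → ℕ),
      Nonempty (H ≃ₐ[K] ((i : Fin k) → Matrix (Fin (d i)) (Fin (d i)) K)))
    [AddCommGroup W] [Module H W] [IsSimpleModule H W] (z : H)
    (hz : ∀ (h : H) (w : W), z • h • w = h • z • w) :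
    ∃ c : K, ∀ w : W, z • w = algebraMap K H c • w := by
  obtain ⟨k, d, ⟨e⟩⟩ := hH
  -- The diagonal matrix units are idempotents with sum `1`, and `E H E = K E` because the matrix
  -- blocks have entries in `K`. If `E w ≠ 0`, then `E w` generates `W`, so `z E w = h E w` for some
  -- `h`; multiplying by `E` turns `h` into a scalar, and commutation with `H` carries the scalar
  -- over to all of `W`.
  let E : (i : Fin k) → Fin (d i) → H := fun i j => e.symm (Pi.single i (Matrix.single j j 1))
  have hE : ∀ i j h, ∃ c : K, E i j * h * E i j = algebraMap K H c * E i j := fun i j h => by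
    refine ⟨e h i j j, e.injective ?_⟩
    simp only [E, map_mul, AlgEquiv.apply_symm_apply, AlgEquiv.commutes]
    funext l
    by_cases hl : l = i
    · subst hl
      ext a b
      simp [Matrix.single_mul_mul_single, Matrix.algebraMap_eq_diagonal, Matrix.single_apply,
        Matrix.diagonal_mul]
    · simp [Pi.single_eq_of_ne hl]
  have hone : ∑ i, ∑ j, E i j = 1 := by
    apply e.injective
    simp only [map_sum, E, AlgEquiv.apply_symm_apply, map_one]
    funext l
    rw [Finset.sum_apply, Finset.sum_eq_single l]
    · ext a b
      simp only [Finset.sum_apply, Pi.single_eq_same, Matrix.sum_apply, Matrix.single_apply,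
        Pi.one_apply, Matrix.one_apply]
      simp only [ite_and]
      rw [Finset.sum_ite_eq' Finset.univ a, if_pos (Finset.mem_univ _)]
    · intro i _ hi
      simp [Pi.single_eq_of_ne hi.symm]
    · simp
  have := IsSimpleModule.nontrivial H W
  obtain ⟨w, hw⟩ := exists_ne (0 : W)
  obtain ⟨i, j, hij⟩ : ∃ i j, E i j • w ≠ 0 := by
    by_contra! hcon
    apply hw
    rw [← one_smul H w, ← hone, Finset.sum_smul]
    exact Finset.sum_eq_zero fun i _ => by
      rw [Finset.sum_smul]; exact Finset.sum_eq_zero fun j _ => hcon i j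
  have hidem : E i j * E i j = E i j := by
    simp only [E, ← map_mul, ← Pi.single_mul, Matrix.single_mul_single_same, one_mul]
  have hgen : ∀ w' : W, ∃ h : H, h • E i j • w = w' := fun w' => by
    have h1 := IsSimpleModule.span_singleton_eq_top H hij
    exact Submodule.mem_span_singleton.1 (h1 ▸ Submodule.mem_top)
  obtain ⟨h, hh⟩ := hgen (z • E i j • w)
  obtain ⟨c, hc⟩ := hE i j h
  refine ⟨c, fun w' => ?_⟩
  obtain ⟨g, rfl⟩ := hgen w'
  have h2 : z • E i j • w = algebraMap K H c • E i j • w := by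
    calc z • E i j • w = z • E i j • E i j • w := by rw [← mul_smul (E i j), hidem]
      _ = E i j • h • E i j • w := by rw [hz, hh]
      _ = (E i j * h * E i j) • w := by simp only [mul_smul]
      _ = _ := by rw [hc, mul_smul]
  rw [hz, h2, ← mul_smul, ← Algebra.commutes, mul_smul]

end Schur

/-! ### Continuous bilinear maps on completed tensor products -/

section CompletedTensorLift

variable {K : Type*} [NontriviallyNormedField K] {E F G : Type*} [SeminormedAddCommGroup E]
  [NormedSpace K E] [SeminormedAddCommGroup F] [NormedSpace K F] [NormedAddCommGroup G]
  [NormedSpace K G] [CompleteSpace G] [IsUltrametricDist G]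

/-- A continuous bilinear map to an ultrametric Banach space factors over the completed tensor
product. -/
theorem CompletedTensor.exists_lift (f : E →L[K] F →L[K] G) :
    ∃ φ : CompletedTensor K E F →L[K] G, ∀ x y, φ (CompletedTensor.tmul K x y) = f x y := by
  let l : ProjTensor K E F →ₗ[K] G :=
    TensorProduct.lift ((ContinuousLinearMap.coeLM K).comp f.toLinearMap)
  have hl : ∀ x y, l (ProjTensor.tmul K x y) = f x y := fun x y => TensorProduct.lift.tmul _ _
  have hb : ∀ t, ‖l t‖ ≤ ‖f‖ * ‖t‖ := fun t => by
    have h : ∀ r, ProjTensor.Bounded K t r → ‖l t‖ ≤ ‖f‖ * r := by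
      rintro r ⟨hr, n, x, y, rfl, hxy⟩
      rw [map_sum]
      -- The target must be ultrametric, as the projective seminorm is built from maxima and
      -- controls no sum of norms.
      refine IsUltrametricDist.norm_sum_le_of_forall_le_of_nonneg (by positivity) fun i _ => ?_
      rw [hl]
      calc ‖f (x i) (y i)‖ ≤ ‖f‖ * ‖x i‖ * ‖y i‖ := f.le_opNorm₂ _ _
        _ = ‖f‖ * (‖x i‖ * ‖y i‖) := mul_assoc _ _ _
        _ ≤ ‖f‖ * r := by gcongr; exact hxy i
    change ‖l t‖ ≤ ‖f‖ * sInf {r | ProjTensor.Bounded K t r}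
    rw [← smul_eq_mul, ← Real.sInf_smul_of_nonneg (norm_nonneg f)]
    refine le_csInf (ProjTensor.bounded_nonempty t).smul_set ?_
    rintro _ ⟨r, hr, rfl⟩
    exact h r hr
  let L : ProjTensor K E F →L[K] G := l.mkContinuous _ hb
  refine ⟨L.extend UniformSpace.Completion.toComplL, fun x y => ?_⟩
  have := L.extend_eq (e := (UniformSpace.Completion.toComplL (𝕜 := K) (E := ProjTensor K E F)))
    UniformSpace.Completion.denseRange_coe
    (UniformSpace.Completion.isUniformInducing_coe _) (ProjTensor.tmul K x y)
  exact this.trans (hl x y)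

theorem CompletedTensor.exists_lift_smul (g : E →L[K] G) (ε : F →L[K] K) :
    ∃ φ : CompletedTensor K E F →L[K] G, ∀ x y, φ (CompletedTensor.tmul K x y) = ε y • g x := by
  obtain ⟨φ, hφ⟩ := CompletedTensor.exists_lift ((ContinuousLinearMap.smulRightL K F G ε).comp g)
  exact ⟨φ, fun x y => hφ x y⟩

end CompletedTensorLift

/-! ### Expansions of elements of `𝓐` and `𝓑` into homogeneous terms -/

section Expansions

variable {K : Type u} [NontriviallyNormedField K] [CharZero K] {𝓡 : Type v} [NormedRing 𝓡]
  [NormedAlgebra K 𝓡]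

/-- The weights in the hypothesis are arbitrary scalars. Since the weight vectors of the completion
lie in the graded algebra `S`, independence of the eigenspaces of `ad(∂)` forces those with a weight
outside the integers `f n` to vanish, and the sum over weights can be reindexed by `ℕ`. -/
theorem exists_expansion_of_graded (D : DenseTriangularSubalgebra K 𝓡) {S : Subalgebra K D.R}
    {f : ℕ → ℤ} (hf : Function.Injective f)
    (hS : Subalgebra.toSubmodule S =
      ⨆ n : ℕ, Subalgebra.toSubmodule S ⊓ degreePart K D.alg.del (f n))
    {T : Module.End K (S.map D.R.val).topologicalClosure}
    (hT : ∀ x, (T x : 𝓡) = adEnd K D.del x) (hss : HasSemisimpleWeightDecomposition T)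
    (hws : ∀ x, x ∈ wsSubspace T ↔ (x : 𝓡) ∈ S.map D.R.val)
    (a : (S.map D.R.val).topologicalClosure) :
    ∃ u : ℕ → D.R, (∀ n, u n ∈ Subalgebra.toSubmodule S ⊓ degreePart K D.alg.del (f n)) ∧
      HasSum (fun n => (u n : 𝓡)) a := by
  classical
  obtain ⟨I, ⟨-, hdec⟩, hI⟩ := hss
  obtain ⟨x, hx, hsum⟩ := hdec a
  have hxS : ∀ l : I, ∃ y ∈ S, (y : 𝓡) = x l := fun l => by
    obtain ⟨y, hy, h⟩ := (hws (x l)).1 (Submodule.mem_iSup_of_mem (l : K) (hx l))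
    exact ⟨y, hy, h⟩
  choose y hyS hyx using hxS
  have hyad : ∀ l : I, adEnd K D.alg.del (y l) = (l : K) • y l := fun l => by
    have h1 := congrArg Subtype.val (hI l l.2 (x l) (hx l))
    rw [hT] at h1
    refine Subtype.ext ?_
    change adEnd K D.del (y l : 𝓡) = (l : K) • (y l : 𝓡)
    rw [hyx]; exact h1
  have hzero : ∀ l : I, (∀ n : ℕ, (l : K) ≠ (f n : K)) → y l = 0 := fun l hl => by
    have h1 : y l ∈ Module.End.eigenspace (adEnd K D.alg.del) (l : K) :=
      Module.End.mem_eigenspace_iff.2 (hyad l)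
    have h2 : y l ∈ ⨆ (j : K) (_ : j ≠ l), Module.End.eigenspace (adEnd K D.alg.del) j := by
      have h3 : y l ∈ Subalgebra.toSubmodule S := hyS l
      rw [hS] at h3
      refine (iSup_le fun n => inf_le_right.trans ?_ :
        (⨆ n : ℕ, Subalgebra.toSubmodule S ⊓ degreePart K D.alg.del (f n)) ≤ _) h3
      exact le_iSup₂ (f := fun (j : K) (_ : j ≠ l) =>
        Module.End.eigenspace (adEnd K D.alg.del) j) (f n : K) (hl n).symm
    exact Submodule.disjoint_def.1
      ((Module.End.eigenspaces_iSupIndep (adEnd K D.alg.del)) (l : K)) _ h1 h2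
  let X : K → D.R := fun l => if h : l ∈ I then y ⟨l, h⟩ else 0
  have hXI : ∀ l : I, X l = y l := fun l => by simp [X]
  have hX0 : ∀ l : K, l ∉ I → X l = 0 := fun l hl => by simp [X, hl]
  have hfK : Function.Injective fun n => (f n : K) := fun m n h => hf (Int.cast_injective h)
  refine ⟨fun n => X (f n), fun n => ?_, ?_⟩
  · by_cases h : (f n : K) ∈ I
    · have := hXI ⟨_, h⟩
      change X (f n) ∈ _
      rw [this]
      exact ⟨hyS _, Module.End.mem_eigenspace_iff.2 (hyad ⟨_, h⟩)⟩
    · change X (f n) ∈ _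
      rw [hX0 _ h]; exact Submodule.zero_mem _
  · have h1 : HasSum (fun l : I => (x l : 𝓡)) a := hsum.map
      (Subalgebra.val _ : (S.map D.R.val).topologicalClosure →ₐ[K] 𝓡) continuous_subtype_val
    have h2 : HasSum (fun l : K => (X l : 𝓡)) a := by
      refine ((Subtype.val_injective (p := (· ∈ I))).hasSum_iff
        (f := fun l : K => (X l : 𝓡)) fun l hl => ?_).1 ?_
      · rw [hX0 l (by simpa using hl)]; rfl
      · convert h1 using 2 with l
        exact (congrArg Subtype.val (hXI l)).trans (hyx l)
    refine (hfK.hasSum_iff (f := fun l : K => (X l : 𝓡)) fun l hl => ?_).2 h2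
    by_cases h : l ∈ I
    · rw [hXI ⟨l, h⟩, hzero ⟨l, h⟩ fun n hn => hl ⟨n, hn.symm⟩]; rfl
    · rw [hX0 l h]; rfl

variable (D : BanachTriangularDecomposition K 𝓡)

theorem exists_expansion_cA (a : D.cA) : ∃ u : ℕ → D.R, (∀ n, u n ∈ D.alg.An n) ∧
    HasSum (fun n => (u n : 𝓡)) a :=
  exists_expansion_of_graded D.toDenseTriangularSubalgebra Nat.cast_injective D.alg.A_graded
    (T := D.adA) (fun _ => rfl) D.A_semisimple D.A_ws a

theorem exists_expansion_cB (b : D.cB) : ∃ u : ℕ → D.R, (∀ n, u n ∈ D.alg.Bn n) ∧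
    HasSum (fun n => (u n : 𝓡)) b :=
  exists_expansion_of_graded D.toDenseTriangularSubalgebra (f := fun n => -(n : ℤ))
    (fun m n h => by simpa using h) D.alg.B_graded
    (T := D.adB) (fun _ => rfl) D.B_semisimple D.B_ws b

end Expansions

section NatIndexed

variable {K : Type*} [NontriviallyNormedField K] {V : Type*} [AddCommGroup V] [Module K V]
  [TopologicalSpace V] [IsTopologicalAddGroup V] [ContinuousConstSMul K V]

theorem mem_weightTail_of_nat {T : Module.End K V} {c : K} {u : ℕ → V} {x : V}
    (hu : ∀ n, T (u n) = (c + n) • u n) (hs : HasSum u x) : x ∈ weightTail T c 0 := by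
  refine ⟨fun n => if 0 ≤ n then u n.toNat else 0, fun n => ?_, fun n hn => if_neg (by omega), ?_⟩
  · dsimp only
    split_ifs with h
    · lift n to ℕ using h
      simpa using hu n
    · simp
  · refine (Nat.cast_injective.hasSum_iff fun n hn => if_neg fun h => hn ⟨n.toNat, by simpa⟩).1 ?_
    simpa [Function.comp_def] using hs

end NatIndexed

/-! ### The augmentation of `𝓑` -/

section Counit

variable {K : Type u} [NontriviallyNormedField K] {𝓡 : Type v} [NormedRing 𝓡]
  [NormedAlgebra K 𝓡] (D : BanachTriangularDecomposition K 𝓡)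

/-- The left ideal `𝓑 B^{>0}` of `𝓑`. -/
def BanachTriangularDecomposition.augmentationB : Ideal D.cB :=
  Ideal.span {x | ∃ b ∈ D.alg.Bpos, (x : 𝓡) = b}

/-- The left ideal `𝓡 B^{>0}` of `𝓡`. -/
def BanachTriangularDecomposition.leftIdealBpos : Ideal 𝓡 :=
  Ideal.span {x | ∃ b ∈ D.alg.Bpos, x = (b : 𝓡)}

theorem isClosed_cB : IsClosed (D.cB : Set 𝓡) := Subalgebra.isClosed_topologicalClosure _

theorem isClosed_cA : IsClosed (D.cA : Set 𝓡) := Subalgebra.isClosed_topologicalClosure _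

theorem coe_mem_cB {b : D.R} (hb : b ∈ D.alg.B) : (b : 𝓡) ∈ D.cB :=
  Subalgebra.le_topologicalClosure _ ⟨b, hb, rfl⟩

theorem coe_mem_cA {a : D.R} (ha : a ∈ D.alg.A) : (a : 𝓡) ∈ D.cA :=
  Subalgebra.le_topologicalClosure _ ⟨a, ha, rfl⟩

theorem coe_mem_leftIdealBpos {b : D.R} (hb : b ∈ D.alg.Bpos) : (b : 𝓡) ∈ D.leftIdealBpos :=
  Ideal.subset_span ⟨b, hb, rfl⟩

theorem coe_mem_leftIdealBpos_of_mem_augmentationB {b : D.cB} (hb : b ∈ D.augmentationB) :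
    (b : 𝓡) ∈ D.leftIdealBpos := by
  refine Submodule.span_induction (R := D.cB)
    (p := fun (x : D.cB) _ => (x : 𝓡) ∈ D.leftIdealBpos) ?_ ?_ ?_ ?_ hb
  · rintro x ⟨b, hb, hx⟩
    rw [hx]; exact coe_mem_leftIdealBpos D hb
  · exact Submodule.zero_mem _
  · intro x y _ _ hx hy; exact Submodule.add_mem _ hx hy
  · intro a x _ hx; exact Ideal.mul_mem_left _ (a : 𝓡) hx

variable [CompleteSpace 𝓡]

theorem isClosed_leftIdealBpos [IsNoetherianRing 𝓡] : IsClosed (D.leftIdealBpos : Set 𝓡) :=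
  isClosed_submodule_of_isNoetherian K _

variable [CharZero K] [IsNoetherianRing D.cB]

theorem isClosed_augmentationB : IsClosed (D.augmentationB : Set D.cB) := by
  have : CompleteSpace D.cB := (isClosed_cB D).completeSpace_coe
  exact isClosed_submodule_of_isNoetherian K _

/-- The term of degree zero of the expansion of `b` lies in `B_0 = K`. The remaining terms lie in
`B^{>0}`, and their sum stays in the left ideal because that ideal is closed, `𝓑` being noetherian.
-/
theorem exists_sub_algebraMap_mem (b : D.cB) :
    ∃ c : K, b - algebraMap K D.cB c ∈ D.augmentationB := by
  obtain ⟨u, hu, hs⟩ := exists_expansion_cB D b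
  have hu0 : u 0 ∈ (1 : Submodule K D.R) := by rw [← D.alg.Bn_zero]; exact hu 0
  obtain ⟨c, hc⟩ := Submodule.mem_one.1 hu0
  refine ⟨c, ?_⟩
  let y : ℕ → D.cB := fun n => ⟨u n, coe_mem_cB D (hu n).1⟩
  have hy : HasSum y b :=
    (Topology.IsInducing.hasSum_iff (g := D.cB.val) Topology.IsInducing.subtypeVal y b).1 hs
  have hy0 : y 0 = algebraMap K D.cB c := by
    apply Subtype.ext
    change (u 0 : 𝓡) = _
    rw [← hc]; rfl
  rw [← hy0]
  have h1 : HasSum (fun n => y (n + 1)) (b - y 0) := by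
    rw [hasSum_nat_add_iff' 1 |>.symm] at hy
    simpa using hy
  refine (isClosed_augmentationB D).mem_of_tendsto h1 (Filter.Eventually.of_forall fun s => ?_)
  refine Submodule.sum_mem _ fun n _ => Ideal.subset_span ⟨u (n + 1), ?_, rfl⟩
  exact D.alg.Bn_le_Bpos n.succ_ne_zero (hu _)

variable [IsUltrametricDist K] [IsUltrametricDist 𝓡]

/-- Elements of `𝓑B^{>0}` are convergent sums of vectors of degree at least one, whereas a scalar
has degree zero; uniqueness of expansions separates the two. -/
theorem eq_zero_of_algebraMap_mem {c : K} (hc : algebraMap K D.cB c ∈ D.augmentationB) : c = 0 := by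
  have : Nontrivial D.R := D.alg.nontrivial
  have hTc : Continuous (-adEnd K D.del : Module.End K 𝓡) :=
    ((continuous_const.mul continuous_id).sub (continuous_id.mul continuous_const)).neg
  -- The sign turns the nonpositive degrees of `𝓑` into nonnegative weights, as `weightTail`
  -- requires.
  set T : Module.End K 𝓡 := -adEnd K D.del with hT
  have hT' : ∀ (n : ℤ) (x : D.R), x ∈ degreePart K D.alg.del (-n) →
      T (x : 𝓡) = ((0 : K) + n) • (x : 𝓡) := fun n x hx => by
    have h := congrArg Subtype.val (mem_degreePart.1 hx)
    change D.del * (x : 𝓡) - x * D.del = ((-n : ℤ) : K) • (x : 𝓡) at h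
    change -(D.del * (x : 𝓡) - x * D.del) = _
    rw [h]; push_cast; rw [zero_add, neg_smul, neg_neg]
  have hgen : ∀ b' ∈ D.alg.Bpos, ∀ b : D.cB, (b : 𝓡) * b' ∈ weightTail T 0 1 := by
    intro b' hb' b
    rw [D.alg.Bpos_eq] at hb'
    refine Submodule.iSup_induction _ (motive := fun b' : D.R => (b : 𝓡) * b' ∈ weightTail T 0 1)
      hb' (fun m x hx => ?_) (by simp) fun x y hx hy => ?_
    · obtain ⟨u, hu, hs⟩ := exists_expansion_cB D b
      have h2 : (b : 𝓡) * x ∈ weightTail T ((0 : K) + ((m + 1 : ℕ) : ℤ)) 0 := by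
        refine mem_weightTail_of_nat (fun n => ?_) (hs.mul_right (x : 𝓡))
        have h1 := mul_mem_degreePart (hu n).2 hx.2
        rw [← neg_add] at h1
        refine (hT' _ _ h1).trans ?_
        congr 1
        push_cast; ring
      rw [weightTail_shift] at h2
      exact weightTail_anti (by push_cast; omega) h2
    · push_cast; rw [mul_add]; exact Submodule.add_mem _ hx hy
  have h : ∀ x ∈ D.augmentationB, ∀ b : D.cB, (b : 𝓡) * x ∈ weightTail T 0 1 := by
    intro x hx
    refine Submodule.span_induction (R := D.cB)
      (p := fun (x : D.cB) _ => ∀ b : D.cB, (b : 𝓡) * x ∈ weightTail T 0 1) ?_ ?_ ?_ ?_ hx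
    · rintro x ⟨b', hb', hx⟩ b
      rw [hx]; exact hgen b' hb' b
    · simp
    · intro x y _ _ hx hy b
      push_cast; rw [mul_add]; exact Submodule.add_mem _ (hx b) (hy b)
    · intro a x _ hx b
      have := hx (b * a)
      rw [smul_eq_mul]
      push_cast at this ⊢
      rwa [← mul_assoc]
  have h1 := h _ hc 1
  have h3 : ((1 : D.cB) : 𝓡) * ((algebraMap K D.cB c : D.cB) : 𝓡) =
      ((algebraMap K D.R c : D.R) : 𝓡) := one_mul _
  rw [h3] at h1
  have h2 := (hasUniqueWeightSums_of_ultrametric hTc).eq_zero (c := 0) (j := 0) (by norm_num)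
    (hT' 0 (algebraMap K D.R c) (by simp [mem_degreePart, Algebra.commutes])) h1
  have h4 : algebraMap K D.R c = 0 := Subtype.ext h2
  exact (map_eq_zero _).1 h4

/-- The augmentation `𝓑 → K`. -/
theorem exists_counit : ∃ ε : D.cB →L[K] K, ε 1 = 1 ∧ (∀ b ∈ D.augmentationB, ε b = 0) ∧
    ∀ b, b - algebraMap K D.cB (ε b) ∈ D.augmentationB := by
  choose ε hε using exists_sub_algebraMap_mem D
  have huniq : ∀ (b : D.cB) (c : K), b - algebraMap K D.cB c ∈ D.augmentationB → ε b = c := by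
    intro b c hc
    have h := Submodule.sub_mem _ hc (hε b)
    rw [sub_sub_sub_cancel_left, ← map_sub] at h
    exact sub_eq_zero.1 (eq_zero_of_algebraMap_mem D h)
  let l : D.cB →ₗ[K] K :=
    { toFun := ε
      map_add' := fun x y => huniq _ _ (by
        rw [map_add, add_sub_add_comm]; exact Submodule.add_mem _ (hε x) (hε y))
      map_smul' := fun c x => huniq _ _ (by
        rw [RingHom.id_apply, smul_eq_mul, map_mul, Algebra.smul_def, ← mul_sub]
        exact Ideal.mul_mem_left _ _ (hε x)) }
  have hker : ∀ b, b ∈ D.augmentationB ↔ l b = 0 := fun b =>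
    ⟨fun h => huniq b 0 (by simpa using h), fun h => by
      have h1 := hε b
      change ε b = 0 at h
      simpa [h] using h1⟩
  have hl : Continuous l := by
    rw [LinearMap.continuous_iff_isClosed_ker]
    convert isClosed_augmentationB D using 1
    ext b
    exact (hker b).symm
  exact ⟨⟨l, hl⟩, huniq 1 1 (by simp), fun b hb => (hker b).1 hb, hε⟩

end Counit

/-! ### The quotient of `𝓡` by the left ideal `𝓡B^{>0}` -/

section Projections

variable {K : Type u} [NontriviallyNormedField K] {𝓡 : Type v} [NormedRing 𝓡]
  [NormedAlgebra K 𝓡] (D : BanachTriangularDecomposition K 𝓡)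

theorem finite_H : Module.Finite K D.H := by
  have := D.alg.finite_H
  let f : D.alg.H →ₗ[K] D.H :=
    { toFun := fun h => ⟨((h : D.R) : 𝓡), ⟨h, h.2, rfl⟩⟩
      map_add' := fun _ _ => rfl
      map_smul' := fun _ _ => rfl }
  refine Module.Finite.of_surjective f ?_
  rintro ⟨_, h, hh, rfl⟩
  exact ⟨⟨h, hh⟩, rfl⟩

theorem dense_induction {p : 𝓡 → Prop} (hp : IsClosed {x | p x})
    (hadd : ∀ x y, p x → p y → p (x + y))
    (h : ∀ a ∈ D.alg.A, ∀ h ∈ D.alg.H, ∀ b ∈ D.alg.B, p ((a : 𝓡) * h * b)) (x : 𝓡) : p x := by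
  have hR : ∀ r : D.R, p r := fun r => by
    have hr : r ∈ (⊤ : Submodule K D.R) := trivial
    rw [← D.alg.mul_eq_top] at hr
    refine Submodule.mul_induction_on hr (fun m hm b hb => ?_) fun x y hx hy => by
      push_cast; exact hadd _ _ hx hy
    refine Submodule.mul_induction_on (C := fun m : D.R => p ((m * b : D.R) : 𝓡)) hm
      (fun a ha g hg => h a ha g hg b hb) fun x y hx hy => ?_
    rw [add_mul]; push_cast at *; exact hadd _ _ hx hy
  have : closure (D.R : Set 𝓡) ⊆ {x | p x} := closure_minimal (fun r hr => hR ⟨r, hr⟩) hp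
  exact this (D.dense.closure_eq ▸ Set.mem_univ x)

variable [CompleteSpace 𝓡] [IsUltrametricDist 𝓡]

/-- The map `a h b ↦ ε(b) η(h) a` from `𝓡` to `𝓐`. -/
theorem exists_projection (ε : D.cB →L[K] K) (η : D.H →L[K] K) :
    ∃ π : 𝓡 →L[K] D.cA, ∀ (a : D.cA) (h : D.H) (b : D.cB),
      π ((a : 𝓡) * h * b) = ε b • η h • a := by
  have : CompleteSpace D.cA := (isClosed_cA D).completeSpace_coe
  obtain ⟨e, he⟩ := D.tensor
  obtain ⟨φ, hφ⟩ := CompletedTensor.exists_lift_smul (ContinuousLinearMap.id K D.cA) η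
  obtain ⟨ψ, hψ⟩ := CompletedTensor.exists_lift_smul φ ε
  refine ⟨ψ.comp e.symm.toContinuousLinearMap, fun a h b => ?_⟩
  rw [← he]
  simp [hψ, hφ]

variable [CompleteSpace K] [CharZero K] [IsNoetherianRing D.cB] [IsUltrametricDist K]

/-- This is `𝓡 = 𝓐H + 𝓡B^{>0}`. The coefficients `a i` are obtained by applying the augmentation to
the factor `𝓑` and the coordinates of a basis to the factor `H`. On a product `a h b` the difference
is `a h (b - ε(b))`; both sides are continuous and `𝓡B^{>0}` is closed, so density suffices. -/
theorem exists_sum_sub_mem_leftIdealBpos [IsNoetherianRing 𝓡] (x : 𝓡) :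
    ∃ (n : ℕ) (a : Fin n → D.cA) (h : Fin n → D.alg.H),
      x - ∑ i, (a i : 𝓡) * ((h i : D.R) : 𝓡) ∈ D.leftIdealBpos := by
  have := finite_H D
  obtain ⟨ε, -, -, hε⟩ := exists_counit D
  let B := Module.finBasis K D.H
  have hB : ∀ i, ∃ g : D.alg.H, ((g : D.R) : 𝓡) = B i := fun i => by
    obtain ⟨g, hg, h⟩ := (B i).2
    exact ⟨⟨g, hg⟩, h⟩
  choose g hg using hB
  choose π hπ using fun i => exists_projection D ε (LinearMap.toContinuousLinearMap (B.coord i))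
  refine ⟨_, fun i => π i x, g, ?_⟩
  refine dense_induction D (p := fun x => x - ∑ i, (π i x : 𝓡) * ((g i : D.R) : 𝓡) ∈
    D.leftIdealBpos) ?_ ?_ ?_ x
  · refine (isClosed_leftIdealBpos D).preimage (f := fun x => x - ∑ i, (π i x : 𝓡) *
      ((g i : D.R) : 𝓡)) ?_
    refine continuous_id.sub (continuous_finsetSum _ fun i _ => ?_)
    exact (continuous_subtype_val.comp (π i).continuous).mul continuous_const
  · intro x y hx hy
    have := Submodule.add_mem _ hx hy
    simp only [map_add, Subalgebra.coe_add, add_mul, Finset.sum_add_distrib]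
    rwa [add_sub_add_comm]
  · intro a ha h hh b hb
    have key : ∑ i, (π i ((a : 𝓡) * h * b) : 𝓡) * ((g i : D.R) : 𝓡) =
        (a : 𝓡) * h * algebraMap K 𝓡 (ε ⟨b, coe_mem_cB D hb⟩) := by
      have h1 : ∀ i, (π i ((a : 𝓡) * h * b) : 𝓡) = ε ⟨b, coe_mem_cB D hb⟩ •
          B.coord i ⟨h, ⟨h, hh, rfl⟩⟩ • (a : 𝓡) := fun i =>
        congrArg Subtype.val (hπ i ⟨a, coe_mem_cA D ha⟩ ⟨h, ⟨h, hh, rfl⟩⟩ ⟨b, coe_mem_cB D hb⟩)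
      have h2 := congrArg Subtype.val (B.sum_repr ⟨h, ⟨h, hh, rfl⟩⟩)
      simp only [h1, hg]
      rw [AddSubmonoidClass.coe_finsetSum] at h2
      change _ = (h : 𝓡) at h2
      have h3 : (a : 𝓡) * h = ∑ i, (a : 𝓡) * ((B.repr ⟨h, ⟨h, hh, rfl⟩⟩ i • B i : D.H) : 𝓡) := by
        rw [← Finset.mul_sum, h2]
      rw [h3, Finset.sum_mul]
      refine Finset.sum_congr rfl fun i _ => ?_
      rw [← Algebra.commutes, ← Algebra.smul_def]
      simp
    rw [key, ← mul_sub]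
    exact Ideal.mul_mem_left _ _ (coe_mem_leftIdealBpos_of_mem_augmentationB D
      (hε ⟨b, coe_mem_cB D hb⟩))

/-- The projections attached to the coordinates of `H` vanish on `𝓡B^{>0}`, because the augmentation
vanishes on `𝓑B^{>0}`; on `h` they return its coordinates. This is what makes the Verma modules
nonzero. -/
theorem eq_zero_of_mem_leftIdealBpos {h : D.R} (hh : h ∈ D.alg.H)
    (hJ : (h : 𝓡) ∈ D.leftIdealBpos) : h = 0 := by
  have := finite_H D
  have hnt : Nontrivial D.R := D.alg.nontrivial
  obtain ⟨ε, hε1, hε0, hε⟩ := exists_counit D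
  let B := Module.finBasis K D.H
  have hcoord : ∀ i, B.coord i ⟨h, ⟨h, hh, rfl⟩⟩ = 0 := fun i => by
    obtain ⟨π, hπ⟩ := exists_projection D ε (LinearMap.toContinuousLinearMap (B.coord i))
    have h1 : ∀ b' ∈ D.alg.Bpos, ∀ x : 𝓡, π (x * b') = 0 := by
      intro b' hb' x
      refine dense_induction D (p := fun x => π (x * b') = 0) ?_ ?_ ?_ x
      · exact isClosed_singleton.preimage (f := fun x => π (x * b'))
          (π.continuous.comp (continuous_id.mul continuous_const))
      · intro x y hx hy; rw [add_mul, map_add, hx, hy, add_zero]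
      · intro a ha g hg b hb
        have hb'' : (b' : 𝓡) ∈ D.cB := coe_mem_cB D (D.alg.Bpos_le_B hb')
        have h2 := hπ ⟨a, coe_mem_cA D ha⟩ ⟨g, ⟨g, hg, rfl⟩⟩ (⟨b, coe_mem_cB D hb⟩ * ⟨b', hb''⟩)
        rw [hε0 _ (Ideal.mul_mem_left _ _ (Ideal.subset_span ⟨b', hb', rfl⟩)), zero_smul] at h2
        rw [mul_assoc]; exact h2
    have h3 : ∀ x ∈ D.leftIdealBpos, ∀ y : 𝓡, π (y * x) = 0 := by
      intro x hx
      refine Submodule.span_induction (R := 𝓡) (p := fun (x : 𝓡) _ => ∀ y : 𝓡, π (y * x) = 0)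
        ?_ ?_ ?_ ?_ hx
      · rintro x ⟨b', hb', rfl⟩ y; exact h1 b' hb' y
      · simp
      · intro x z _ _ hx hz y; rw [mul_add, map_add, hx, hz, add_zero]
      · intro a x _ hx y; rw [smul_eq_mul, ← mul_assoc]; exact hx _
    have h4 := h3 _ hJ 1
    have h5 := hπ 1 ⟨h, ⟨h, hh, rfl⟩⟩ 1
    rw [hε1, one_smul] at h5
    have h6 : (B.coord i ⟨h, ⟨h, hh, rfl⟩⟩) • (1 : D.cA) = 0 := by
      refine h5.symm.trans (Eq.trans ?_ h4)
      congr 1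
      exact mul_one _
    have : Nontrivial D.cA := by
      refine ⟨⟨0, 1, fun h => ?_⟩⟩
      have h' : (0 : 𝓡) = 1 := congrArg Subtype.val h
      exact zero_ne_one (α := D.R) (Subtype.ext h')
    exact (smul_eq_zero.1 h6).resolve_right one_ne_zero
  have h7 : (⟨h, ⟨h, hh, rfl⟩⟩ : D.H) = 0 := B.forall_coord_eq_zero_iff.1 hcoord
  have h8 : (h : 𝓡) = 0 := congrArg Subtype.val h7
  exact Subtype.ext h8

end Projections

/-! ### Universal properties of extended and induced modules -/

section ExtendScalarsUniversal

variable {S T M : Type*} [Ring S] [Ring T] (f : S →+* T) [AddCommGroup M] [Module S M]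

/-- The map `m ↦ 1 ⊗ m`. -/
def ExtendScalars.ι : M →+ ExtendScalars f M :=
  (balancingRelations f M).mkQ.toAddMonoidHom.comp
    ((TensorProduct.mk ℤ T M 1).toAddMonoidHom)

theorem ExtendScalars.mk_tmul (x : T) (m : M) :
    (balancingRelations f M).mkQ (x ⊗ₜ[ℤ] m) = x • ExtendScalars.ι f m := by
  change _ = x • (balancingRelations f M).mkQ ((1 : T) ⊗ₜ[ℤ] m)
  rw [← map_smul, TensorProduct.smul_tmul', smul_eq_mul, mul_one]

theorem ExtendScalars.ι_smul (s : S) (m : M) :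
    ExtendScalars.ι f (s • m) = f s • ExtendScalars.ι f m := by
  rw [← ExtendScalars.mk_tmul]
  change (balancingRelations f M).mkQ ((1 : T) ⊗ₜ[ℤ] (s • m)) = _
  rw [eq_comm, ← sub_eq_zero, ← map_sub]
  refine (Submodule.Quotient.mk_eq_zero _).2 (Submodule.subset_span ⟨1, s, m, ?_⟩)
  rw [one_mul]

theorem ExtendScalars.span_range_ι :
    Submodule.span T (Set.range (ExtendScalars.ι f (M := M))) = ⊤ := by
  rw [eq_top_iff]
  rintro x -
  obtain ⟨t, rfl⟩ := (balancingRelations f M).mkQ_surjective x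
  induction t with
  | zero => rw [map_zero]; exact Submodule.zero_mem _
  | add s t hs ht => rw [map_add]; exact Submodule.add_mem _ hs ht
  | tmul x m =>
    rw [ExtendScalars.mk_tmul]
    exact Submodule.smul_mem _ _ (Submodule.subset_span ⟨m, rfl⟩)

/-- The universal property of the extension of scalars. -/
theorem ExtendScalars.exists_lift {N : Type*} [AddCommGroup N] [Module T N] (g : M →+ N)
    (hg : ∀ s m, g (s • m) = f s • g m) :
    ∃ G : ExtendScalars f M →ₗ[T] N, ∀ m, G (ExtendScalars.ι f m) = g m := by
  let l : T ⊗[ℤ] M →ₗ[T] N :=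
    TensorProduct.AlgebraTensorModule.lift
      { toFun := fun x => x • g.toIntLinearMap
        map_add' := fun x y => add_smul _ _ _
        map_smul' := fun x y => mul_smul _ _ _ }
  have hl : ∀ x m, l (x ⊗ₜ m) = x • g m := fun x m =>
    TensorProduct.AlgebraTensorModule.lift_tmul _ _ _
  refine ⟨(balancingRelations f M).liftQ l (Submodule.span_le.2 ?_), fun m => ?_⟩
  · rintro _ ⟨x, s, m, rfl⟩
    simp [hl, hg, mul_smul]
  · change l ((1 : T) ⊗ₜ[ℤ] m) = _
    rw [hl, one_smul]

end ExtendScalarsUniversal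

section InducedModuleUniversal

variable {K : Type u} {T H : Type v} {W : Type w} [Field K] [Ring T] [Algebra K T] [Ring H]
  (P : Subalgebra K T)
  (S : Set P) (f : H →+* P) [AddCommGroup W] [Module H W]

/-- The map `w ↦ 1 ⊗ (1 ⊗ w)`. -/
def InducedModule.gen : W →+ InducedModule P S f W :=
  (ExtendScalars.ι (P.val : P →+* T) (M := Restrict (TwoSidedIdeal.span S).ringCon.mk'
      (ExtendScalars ((TwoSidedIdeal.span S).ringCon.mk'.comp f) W))).comp
    (ExtendScalars.ι ((TwoSidedIdeal.span S).ringCon.mk'.comp f))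

theorem InducedModule.gen_smul (h : H) (w : W) :
    InducedModule.gen P S f (h • w) = (f h : T) • InducedModule.gen P S f w := by
  have h1 := ExtendScalars.ι_smul ((TwoSidedIdeal.span S).ringCon.mk'.comp f) h w
  exact (congrArg (ExtendScalars.ι (P.val : P →+* T) (M := Restrict
    (TwoSidedIdeal.span S).ringCon.mk'
    (ExtendScalars ((TwoSidedIdeal.span S).ringCon.mk'.comp f) W))) h1).trans
      (ExtendScalars.ι_smul (P.val : P →+* T) (M := Restrict (TwoSidedIdeal.span S).ringCon.mk'
        (ExtendScalars ((TwoSidedIdeal.span S).ringCon.mk'.comp f) W)) (f h) _)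

theorem InducedModule.smul_gen_eq_zero {s : P} (hs : s ∈ S) (w : W) :
    (s : T) • InducedModule.gen P S f w = 0 := by
  have h1 := ExtendScalars.ι_smul (P.val : P →+* T)
    (M := Restrict (TwoSidedIdeal.span S).ringCon.mk'
      (ExtendScalars ((TwoSidedIdeal.span S).ringCon.mk'.comp f) W)) s
    (ExtendScalars.ι ((TwoSidedIdeal.span S).ringCon.mk'.comp f) w)
  refine h1.symm.trans ?_
  have h2 : (TwoSidedIdeal.span S).ringCon.mk' s = 0 := by
    rw [← TwoSidedIdeal.mem_ker, TwoSidedIdeal.ker_ringCon_mk']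
    exact TwoSidedIdeal.subset_span hs
  have h3 : (TwoSidedIdeal.span S).ringCon.mk' s •
      ExtendScalars.ι ((TwoSidedIdeal.span S).ringCon.mk'.comp f) w = 0 := by
    rw [h2, zero_smul]
  exact (congrArg (ExtendScalars.ι (P.val : P →+* T)
    (M := Restrict (TwoSidedIdeal.span S).ringCon.mk'
      (ExtendScalars ((TwoSidedIdeal.span S).ringCon.mk'.comp f) W))) h3).trans (map_zero _)

theorem InducedModule.span_range_gen :
    Submodule.span T (Set.range (InducedModule.gen P S f (W := W))) = ⊤ := by
  rw [eq_top_iff, ← ExtendScalars.span_range_ι (P.val : P →+* T), Submodule.span_le]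
  rintro _ ⟨m, rfl⟩
  have hm : ∀ m : ExtendScalars ((TwoSidedIdeal.span S).ringCon.mk'.comp f) W,
      m ∈ Submodule.span (TwoSidedIdeal.span S).ringCon.Quotient (Set.range
        (ExtendScalars.ι ((TwoSidedIdeal.span S).ringCon.mk'.comp f) (M := W))) := fun m => by
    rw [ExtendScalars.span_range_ι]; trivial
  let g : ExtendScalars ((TwoSidedIdeal.span S).ringCon.mk'.comp f) W →+ InducedModule P S f W :=
    ExtendScalars.ι (P.val : P →+* T) (M := Restrict (TwoSidedIdeal.span S).ringCon.mk'
      (ExtendScalars ((TwoSidedIdeal.span S).ringCon.mk'.comp f) W))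
  have hg : ∀ (p : P) x, g ((TwoSidedIdeal.span S).ringCon.mk' p • x) = (p : T) • g x :=
    fun p x => ExtendScalars.ι_smul (P.val : P →+* T)
      (M := Restrict (TwoSidedIdeal.span S).ringCon.mk'
      (ExtendScalars ((TwoSidedIdeal.span S).ringCon.mk'.comp f) W)) p x
  refine Submodule.span_induction (p := fun m _ => g m ∈
    Submodule.span T (Set.range (InducedModule.gen P S f (W := W)))) ?_ ?_ ?_ ?_ (hm m)
  · rintro _ ⟨w, rfl⟩
    exact Submodule.subset_span ⟨w, rfl⟩
  · rw [map_zero]; exact Submodule.zero_mem _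
  · intro x y _ _ hx hy
    rw [map_add]; exact Submodule.add_mem _ hx hy
  · intro q x _ hx
    obtain ⟨p, rfl⟩ := (TwoSidedIdeal.span S).ringCon.mk'_surjective q
    rw [hg]
    exact Submodule.smul_mem _ _ hx

/-- The universal property of induced modules. -/
theorem InducedModule.exists_lift {N : Type*} [AddCommGroup N] [Module T N] (φ : W →+ N)
    (hφ : ∀ h w, φ (h • w) = (f h : T) • φ w) (hS : ∀ s ∈ S, ∀ w, ((s : P) : T) • φ w = 0)
    (hP : ∀ (p : P) (w : W), ∃ w', (p : T) • φ w = φ w') :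
    ∃ G : InducedModule P S f W →ₗ[T] N, ∀ w, G (InducedModule.gen P S f w) = φ w := by
  let N' : Submodule P N :=
    { φ.range with
      smul_mem' := by
        rintro p _ ⟨w, rfl⟩
        obtain ⟨w', hw'⟩ := hP p w
        exact ⟨w', hw'.symm⟩ }
  let ρ : P →+* AddMonoid.End N' := Module.toAddMonoidEnd P N'
  -- By `hP` the range of `φ` is a `P`-module. Its annihilator is a two-sided ideal containing `S`,
  -- so the action descends to `P/I`.
  have hρ : (TwoSidedIdeal.span S).ringCon ≤ RingCon.ker ρ := by
    have h1 : TwoSidedIdeal.span S ≤ TwoSidedIdeal.ker ρ := by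
      rw [TwoSidedIdeal.span_le]
      intro s hs
      refine (TwoSidedIdeal.mem_ker ρ).2 ?_
      ext ⟨_, w, rfl⟩
      exact hS s hs w
    exact TwoSidedIdeal.ringCon_le_iff.1 h1
  let σ : (TwoSidedIdeal.span S).ringCon.Quotient →+* AddMonoid.End N' :=
    (TwoSidedIdeal.span S).ringCon.lift ρ hρ
  let : Module (TwoSidedIdeal.span S).ringCon.Quotient N' := Module.compHom N' σ
  have hσ : ∀ (p : P) (x : N'), (TwoSidedIdeal.span S).ringCon.mk' p • x = p • x := fun p x => rfl
  let φ' : W →+ N' :=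
    { toFun := fun w => ⟨φ w, w, rfl⟩
      map_zero' := Subtype.ext (map_zero φ)
      map_add' := fun x y => Subtype.ext (map_add φ x y) }
  obtain ⟨G, hG⟩ := ExtendScalars.exists_lift ((TwoSidedIdeal.span S).ringCon.mk'.comp f) φ'
    (fun h w => Subtype.ext (hφ h w))
  let g : Restrict (TwoSidedIdeal.span S).ringCon.mk'
      (ExtendScalars ((TwoSidedIdeal.span S).ringCon.mk'.comp f) W) →+ N :=
    N'.subtype.toAddMonoidHom.comp G.toAddMonoidHom
  obtain ⟨G', hG'⟩ := ExtendScalars.exists_lift (P.val : P →+* T) g (fun p m => by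
    have h1 := G.map_smul ((TwoSidedIdeal.span S).ringCon.mk' p) m
    exact congrArg Subtype.val (h1.trans (hσ p (G m))))
  exact ⟨G', fun w => (hG' _).trans (congrArg Subtype.val (hG w))⟩

end InducedModuleUniversal

/-! ### Lowest weight maps -/

section Lowest

/-- A map from an `H`-module to an `R`-module is lowest if it is `H`-linear and its image is killed
by `B^{>0}`. -/
structure IsLowest {K R : Type*} [Field K] [Ring R] [Algebra K R] (D : TriangularDecomposition K R)
    {W M : Type*} [AddCommGroup W] [Module D.H W] [AddCommGroup M] [Module R M] (φ : W →+ M) :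
    Prop where
  map_smul : ∀ (h : D.H) (w : W), φ (h • w) = (h : R) • φ w
  kill : ∀ b ∈ D.Bpos, ∀ w, b • φ w = 0

namespace IsLowest

variable {K R : Type*} [Field K] [Ring R] [Algebra K R] {D : TriangularDecomposition K R}
    {W M N : Type*} [AddCommGroup W] [Module D.H W] [AddCommGroup M] [Module R M]
    [AddCommGroup N] [Module R N] {φ : W →+ M}

theorem comp (hφ : IsLowest D φ) (f : M →ₗ[R] N) : IsLowest D (f.toAddMonoidHom.comp φ) where
  map_smul h w := (congrArg f (hφ.map_smul h w)).trans (f.map_smul _ _)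
  kill b hb w := (f.map_smul _ _).symm.trans ((congrArg f (hφ.kill b hb w)).trans f.map_zero)

theorem smul_eq_zero (hφ : IsLowest D φ) {y : R} (hy : y ∈ (⊤ * D.Bpos : Submodule K R)) (w : W) :
    y • φ w = 0 := by
  refine Submodule.mul_induction_on (C := fun y => y • φ w = 0) hy (fun m _ b hb => ?_)
    fun x y hx hy => ?_
  · rw [mul_smul, hφ.kill b hb, smul_zero]
  · rw [add_smul, hx, hy, add_zero]

theorem del_smul (hφ : IsLowest D φ) {h₀ : D.H} (hd : D.del - h₀ ∈ (⊤ * D.Bpos : Submodule K R))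
    (w : W) : D.del • φ w = φ (h₀ • w) := by
  have h := hφ.smul_eq_zero hd w
  rw [sub_smul, sub_eq_zero] at h
  rw [h, hφ.map_smul]

theorem algebraMap_smul (hφ : IsLowest D φ) (c : K) (w : W) :
    φ (algebraMap K D.H c • w) = algebraMap K R c • φ w := hφ.map_smul _ _

end IsLowest

end Lowest

/-! ### The weight of a lowest weight map -/

section Weights

variable {K : Type u} [NontriviallyNormedField K] {𝓡 : Type v} [NormedRing 𝓡]
  [NormedAlgebra K 𝓡] [CompleteSpace K] [IsUltrametricDist K] [CharZero K] [CompleteSpace 𝓡]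
  [IsUltrametricDist 𝓡] (D : BanachTriangularDecomposition K 𝓡) [IsNoetherianRing D.cB]

/-- The element `∂` is the sum of a central element of `H` and an element of `R B^{>0}`. -/
theorem exists_central_element : ∃ h₀ : D.alg.H, (∀ h : D.alg.H, h₀ * h = h * h₀) ∧
    D.alg.del - h₀ ∈ (⊤ * D.alg.Bpos : Submodule K D.R) := by
  obtain ⟨h₀, hh₀, hd⟩ := D.alg.exists_del_sub_mem
  refine ⟨⟨h₀, hh₀⟩, fun h => ?_, hd⟩
  have hJ : ∀ y ∈ (⊤ * D.alg.Bpos : Submodule K D.R), (y : 𝓡) ∈ D.leftIdealBpos := fun y hy => by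
    refine Submodule.mul_induction_on (C := fun y : D.R => (y : 𝓡) ∈ D.leftIdealBpos) hy
      (fun m _ b hb => ?_) fun x y hx hy => ?_
    · exact Ideal.mul_mem_left _ _ (coe_mem_leftIdealBpos D hb)
    · exact Submodule.add_mem _ hx hy
  -- `RB^{>0}` is stable under right multiplication by `H` since `B^{>0}H ⊆ HB^{>0}`. As `∂`
  -- commutes with `H`, the commutator of `h₀` and `h` lies in `RB^{>0}`; it also lies in `H`, so it
  -- vanishes.
  have h1 : (D.alg.del - h₀) * h ∈ (⊤ * D.alg.Bpos : Submodule K D.R) := by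
    have h2 : (D.alg.del - h₀) * h ∈
        (⊤ * D.alg.Bpos * Subalgebra.toSubmodule D.alg.H : Submodule K D.R) :=
      Submodule.mul_mem_mul hd h.2
    rw [mul_assoc] at h2
    have h3 := mul_le_mul' (le_refl (⊤ : Submodule K D.R)) D.alg.Bpos_mul_H_le h2
    rw [← mul_assoc] at h3
    exact (mul_le_mul' le_top le_rfl : _ ≤ (⊤ * D.alg.Bpos : Submodule K D.R)) h3
  have h2 : (h : D.R) * (D.alg.del - h₀) ∈ (⊤ * D.alg.Bpos : Submodule K D.R) := by
    have h3 := Submodule.mul_mem_mul (show (h : D.R) ∈ (⊤ : Submodule K D.R) from trivial) hd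
    rw [← mul_assoc] at h3
    exact (mul_le_mul' le_top le_rfl : _ ≤ (⊤ * D.alg.Bpos : Submodule K D.R)) h3
  have h3 := Submodule.sub_mem _ h2 h1
  have h4 : (h : D.R) * (D.alg.del - h₀) - (D.alg.del - h₀) * h = h₀ * h - h * h₀ := by
    rw [mul_sub, sub_mul, D.alg.del_mul_comm h.2]; abel
  rw [h4] at h3
  have h5 := eq_zero_of_mem_leftIdealBpos D
    (D.alg.H.sub_mem (D.alg.H.mul_mem hh₀ h.2) (D.alg.H.mul_mem h.2 hh₀)) (hJ _ h3)
  exact Subtype.ext (sub_eq_zero.1 h5)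

/-- The weight by which `∂` acts on the lowest weight vectors of type `W`. -/
theorem exists_weight (W : Type*) [AddCommGroup W] [Module D.alg.H W] [IsSimpleModule D.alg.H W] :
    ∃ (h₀ : D.alg.H) (c : K), D.alg.del - h₀ ∈ (⊤ * D.alg.Bpos : Submodule K D.R) ∧
      ∀ w : W, h₀ • w = algebraMap K D.alg.H c • w := by
  obtain ⟨h₀, hc, hd⟩ := exists_central_element D
  obtain ⟨c, hc⟩ := exists_scalar_of_commute D.alg.H_split h₀ (W := W) fun h w => by
    rw [← mul_smul, hc, mul_smul]
  exact ⟨h₀, c, hd, hc⟩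

/-- The weight of the lowest weight vectors of type `W`. -/
def lowestWeight (W : Type*) [AddCommGroup W] [Module D.alg.H W] [IsSimpleModule D.alg.H W] : K :=
  (exists_weight D W).choose_spec.choose

theorem IsLowest.del_smul_eq {W M : Type*} [AddCommGroup W] [Module D.alg.H W]
    [IsSimpleModule D.alg.H W] [AddCommGroup M] [Module D.R M] {φ : W →+ M}
    (hφ : IsLowest D.alg φ) (w : W) :
    D.alg.del • φ w = algebraMap K D.R (lowestWeight D W) • φ w := by
  have h := (exists_weight D W).choose_spec.choose_spec
  rw [hφ.del_smul h.1, h.2, hφ.algebraMap_smul]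
  rfl

end Weights

/-! ### Hausdorff property and weight components -/

section Hausdorff

theorem t2Space_of_finite (K : Type*) [NontriviallyNormedField K] {𝓡 : Type*} [NormedRing 𝓡]
    [NormedAlgebra K 𝓡] [CompleteSpace 𝓡] [IsNoetherianRing 𝓡] {M : Type*} [AddCommGroup M]
    [Module 𝓡 M] [TopologicalSpace M] [IsModuleTopology 𝓡 M] [Module.Finite 𝓡 M] : T2Space M := by
  obtain ⟨n, P, hP, ⟨e⟩⟩ := exists_banach_model K (𝓡 := 𝓡) M
  exact e.toHomeomorph.symm.t2Space

variable {K : Type*} [NontriviallyNormedField K] {𝓡 : Type*} [NormedRing 𝓡] [NormedAlgebra K 𝓡]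
  [CompleteSpace 𝓡] [IsNoetherianRing 𝓡] {M : Type*} [AddCommGroup M] [Module K M]
  [Module 𝓡 M] [IsScalarTower K 𝓡 M] [TopologicalSpace M] [IsModuleTopology 𝓡 M]
  [Module.Finite 𝓡 M] [IsUltrametricDist K] [CharZero K] [IsUltrametricDist 𝓡]

/-- Submodules contain the weight components of their elements. -/
theorem component_mem {N : Submodule 𝓡 M} {x : 𝓡} {c : K} {u : ℤ → M}
    (hu : ∀ n, x • u n = (c + n) • u n) {y : M} (hy : y ∈ N) (hs : HasSum u y) (n : ℤ) :
    u n ∈ N := by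
  have h := hasUniqueWeightSums_of_finite (K := K) (M := M ⧸ N) x c (fun n => N.mkQ (u n))
    (fun n => ?_) ?_
  · exact (Submodule.Quotient.mk_eq_zero N).1 (congrFun h n)
  · have h1 := congrArg N.mkQ (hu n)
    rw [map_smul, ← algebraMap_smul 𝓡 (c + n) (u n), map_smul, algebraMap_smul] at h1
    exact h1
  · have := IsModuleTopology.toContinuousAdd 𝓡 (M ⧸ N)
    have h1 := hs.map N.mkQ (IsModuleTopology.continuous_of_linearMap N.mkQ)
    have h2 : N.mkQ y = 0 := (Submodule.Quotient.mk_eq_zero N).2 hy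
    rw [h2] at h1
    exact h1

end Hausdorff

/-! ### Structure of analytic lowest weight modules -/

section AnalyticLowest

variable {K : Type u} [NontriviallyNormedField K] {𝓡 : Type v} [NormedRing 𝓡]
  [NormedAlgebra K 𝓡] [CompleteSpace K] [IsUltrametricDist K] [CharZero K] [CompleteSpace 𝓡]
  [IsUltrametricDist 𝓡] (D : BanachTriangularDecomposition K 𝓡) [IsNoetherianRing D.cB]
  [IsNoetherianRing 𝓡]
  {W M : Type*} [AddCommGroup W] [Module D.alg.H W] [AddCommGroup M] [Module 𝓡 M]

variable {D} {φ : W →+ M}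

theorem IsLowest.smul_eq_zero_of_mem (hφ : IsLowest D.alg φ) {y : 𝓡} (hy : y ∈ D.leftIdealBpos)
    (w : W) : y • φ w = 0 := by
  refine Submodule.span_induction (p := fun y _ => y • φ w = 0) ?_ ?_ ?_ ?_ hy
  · rintro _ ⟨b, hb, rfl⟩; exact hφ.kill b hb w
  · exact zero_smul _ _
  · intro x y _ _ hx hy; rw [add_smul, hx, hy, add_zero]
  · intro a x _ hx; rw [smul_eq_mul, mul_smul, hx, smul_zero]

theorem IsLowest.smul_mem_span (hφ : IsLowest D.alg φ) (x : 𝓡) (w : W) :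
    x • φ w ∈ Submodule.span D.cA (Set.range φ) := by
  obtain ⟨n, a, h, hx⟩ := exists_sum_sub_mem_leftIdealBpos D x
  have h1 := hφ.smul_eq_zero_of_mem hx w
  rw [sub_smul, sub_eq_zero, Finset.sum_smul] at h1
  rw [h1]
  refine Submodule.sum_mem _ fun i _ => ?_
  have h2 : ((a i : 𝓡) * ((h i : D.R) : 𝓡)) • φ w = a i • φ (h i • w) := by
    rw [hφ.map_smul, mul_smul]; rfl
  rw [h2]
  exact Submodule.smul_mem _ _ (Submodule.subset_span ⟨_, rfl⟩)

theorem IsLowest.mem_span_cA (hφ : IsLowest D.alg φ) {x : M}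
    (hx : x ∈ Submodule.span 𝓡 (Set.range φ)) : x ∈ Submodule.span D.cA (Set.range φ) := by
  have h : ∀ r : 𝓡, r • x ∈ Submodule.span D.cA (Set.range φ) := by
    refine Submodule.span_induction (p := fun x _ => ∀ r : 𝓡, r • x ∈
      Submodule.span D.cA (Set.range φ)) ?_ ?_ ?_ ?_ hx
    · rintro _ ⟨w, rfl⟩ r; exact hφ.smul_mem_span r w
    · intro r; rw [smul_zero]; exact Submodule.zero_mem _
    · intro x y _ _ hx hy r; rw [smul_add]; exact Submodule.add_mem _ (hx r) (hy r)
    · intro a x _ hx r; rw [← mul_smul]; exact hx _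
  simpa using h 1

variable [IsSimpleModule D.alg.H W]

section KModule

variable [Module K M] [IsScalarTower K 𝓡 M]

/-- A simple `H`-module is the orbit of any nonzero vector, and `H` is finite-dimensional. -/
theorem IsLowest.fg_span (hφ : IsLowest D.alg φ) : (Submodule.span K (Set.range φ)).FG := by
  have := D.alg.finite_H
  have := IsSimpleModule.nontrivial D.alg.H W
  obtain ⟨w₀, hw₀⟩ := exists_ne (0 : W)
  let l : D.alg.H →ₗ[K] M :=
    { toFun := fun h => ((h : D.R) : 𝓡) • φ w₀
      map_add' := fun x y => add_smul _ _ _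
      map_smul' := fun c x => smul_assoc c ((x : D.R) : 𝓡) (φ w₀) }
  have hr : Set.range φ = Set.range l := by
    ext x
    constructor
    · rintro ⟨w, rfl⟩
      have h1 := IsSimpleModule.span_singleton_eq_top D.alg.H hw₀
      obtain ⟨h, rfl⟩ := Submodule.mem_span_singleton.1 (h1 ▸ Submodule.mem_top : w ∈ _)
      exact ⟨h, (hφ.map_smul h w₀).symm⟩
    · rintro ⟨h, rfl⟩
      exact ⟨h • w₀, hφ.map_smul h w₀⟩
  have h2 : Submodule.span K (Set.range φ) = LinearMap.range l := by
    rw [hr, ← LinearMap.coe_range]; exact Submodule.span_eq (LinearMap.range l)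
  rw [h2, LinearMap.range_eq_map]
  exact Module.Finite.fg_top.map l

theorem IsLowest.finite_span (hφ : IsLowest D.alg φ)
    (hspan : Submodule.span 𝓡 (Set.range φ) = ⊤) : Module.Finite D.cA M := by
  obtain ⟨s, hs⟩ := hφ.fg_span
  refine ⟨⟨s, eq_top_iff.2 fun x _ => ?_⟩⟩
  have hx := hφ.mem_span_cA (hspan ▸ Submodule.mem_top : x ∈ Submodule.span 𝓡 (Set.range φ))
  refine Submodule.span_le.2 ?_ hx
  rintro _ ⟨w, rfl⟩
  have hw : φ w ∈ Submodule.span K (s : Set M) := hs ▸ Submodule.subset_span ⟨w, rfl⟩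
  have hle : Submodule.span K (s : Set M) ≤
      (Submodule.span D.cA (s : Set M)).restrictScalars K :=
    Submodule.span_le.2 fun x hx => Submodule.subset_span hx
  exact hle hw

variable (D φ) in
/-- The sum of the `A_n φ(W)` for `n ≤ k`. -/
def lowPart (k : ℕ) : Submodule K M :=
  ⨆ n ∈ Finset.range (k + 1), Submodule.map₂ (Algebra.lsmul K K M : 𝓡 →ₐ[K] _).toLinearMap
    ((D.alg.An n).map D.R.val.toLinearMap) (Submodule.span K (Set.range φ))

theorem IsLowest.fg_lowPart (hφ : IsLowest D.alg φ) (k : ℕ) : (lowPart D φ k).FG := by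
  refine Submodule.fg_biSup _ _ fun n _ => ?_
  have : Module.Finite K (D.alg.An n) := D.alg.A_finite n
  exact Submodule.FG.map₂ _ ((Module.Finite.iff_fg.1 this).map _) hφ.fg_span

theorem smul_mem_lowPart {k n : ℕ} (hn : n ≤ k) {a : D.R} (ha : a ∈ D.alg.An n) (w : W) :
    (a : 𝓡) • φ w ∈ lowPart D φ k := by
  refine Submodule.mem_iSup_of_mem n (Submodule.mem_iSup_of_mem
    (Finset.mem_range.2 (by omega)) ?_)
  exact Submodule.apply_mem_map₂ _ ⟨a, ha, rfl⟩ (Submodule.subset_span ⟨w, rfl⟩)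

theorem lowPart_le {k : ℕ} {P : Submodule K M}
    (h : ∀ n ≤ k, ∀ a ∈ D.alg.An n, ∀ w, (a : 𝓡) • φ w ∈ P) : lowPart D φ k ≤ P := by
  refine iSup₂_le fun n hn => Submodule.map₂_le.2 ?_
  rintro _ ⟨a, ha, rfl⟩ y hy
  refine Submodule.span_induction (p := fun y _ => (a : 𝓡) • y ∈ P) ?_ ?_ ?_ ?_ hy
  · rintro _ ⟨w, rfl⟩; exact h n (by have := Finset.mem_range.1 hn; omega) a ha w
  · rw [smul_zero]; exact P.zero_mem
  · intro x y _ _ hx hy; rw [smul_add]; exact P.add_mem hx hy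
  · intro c x _ hx; rw [smul_comm]; exact P.smul_mem c hx

theorem del_smul_smul {a : D.R} {n : ℕ} (ha : a ∈ degreePart K D.alg.del n) {c : K} {x : M}
    (hx : D.del • x = c • x) : D.del • (a : 𝓡) • x = (c + n) • (a : 𝓡) • x := by
  have h1 : D.del * (a : 𝓡) - a * D.del = ((n : ℤ) : K) • (a : 𝓡) :=
    congrArg Subtype.val (mem_degreePart.1 ha)
  rw [sub_eq_iff_eq_add] at h1
  rw [← mul_smul, h1, add_smul, mul_smul, hx, smul_comm (a : 𝓡) c x, smul_assoc, ← add_smul,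
    add_comm]
  push_cast; rfl

theorem IsLowest.del_smul_eq' (hφ : IsLowest D.alg φ) (w : W) :
    D.del • φ w = lowestWeight D W • φ w := by
  have h := hφ.del_smul_eq D w
  rw [← _root_.algebraMap_smul 𝓡 (lowestWeight D W)]
  exact h

variable [TopologicalSpace M] [IsModuleTopology 𝓡 M] [IsTopologicalAddGroup M]
  [ContinuousConstSMul K M]

theorem smul_mem_weightTail {c : K} {x : M} (hx : D.del • x = c • x) (a : D.cA) :
    (a : 𝓡) • x ∈ weightTail (Algebra.lsmul K K M D.del) c 0 := by
  obtain ⟨u, hu, hs⟩ := exists_expansion_cA D a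
  exact mem_weightTail_of_nat (u := fun n => (u n : 𝓡) • x) (fun n => del_smul_smul (hu n).2 hx)
    (hs.smul_const x)

/-- The expansion of `a` is cut after degree `k`: the head is a finite sum in `lowPart`, and the
remainder only involves degrees above `k`. -/
theorem IsLowest.smul_mem_sup (hφ : IsLowest D.alg φ) (a : D.cA) (w : W) (k : ℕ) :
    (a : 𝓡) • φ w ∈ lowPart D φ k ⊔
      weightTail (Algebra.lsmul K K M D.del) (lowestWeight D W) (k + 1) := by
  obtain ⟨u, hu, hs⟩ := exists_expansion_cA D a
  have h1 := hs.smul_const (φ w)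
  rw [← hasSum_nat_add_iff' (k + 1)] at h1
  rw [← add_sub_cancel (∑ i ∈ Finset.range (k + 1), (u i : 𝓡) • φ w) ((a : 𝓡) • φ w)]
  refine Submodule.add_mem_sup (Submodule.sum_mem _ fun i hi => ?_) ?_
  · exact smul_mem_lowPart (by have := Finset.mem_range.1 hi; omega) (hu i) w
  · have h2 := mem_weightTail_of_nat (T := Algebra.lsmul K K M D.del)
      (c := lowestWeight D W + ((k + 1 : ℕ) : ℤ)) (fun n => ?_) h1
    · rw [weightTail_shift] at h2
      simpa using h2
    · refine (del_smul_smul (hu (n + (k + 1))).2 (hφ.del_smul_eq' w)).trans ?_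
      congr 1
      push_cast; ring

theorem IsLowest.mem_sup (hφ : IsLowest D.alg φ) {x : M}
    (hx : x ∈ Submodule.span 𝓡 (Set.range φ)) (k : ℕ) :
    x ∈ lowPart D φ k ⊔
      weightTail (Algebra.lsmul K K M D.del) (lowestWeight D W) (k + 1) := by
  have h : ∀ a : D.cA, (a : 𝓡) • x ∈ lowPart D φ k ⊔
      weightTail (Algebra.lsmul K K M D.del) (lowestWeight D W) (k + 1) := by
    refine Submodule.span_induction (p := fun x _ => ∀ a : D.cA, (a : 𝓡) • x ∈ lowPart D φ k ⊔
      weightTail (Algebra.lsmul K K M D.del) (lowestWeight D W) (k + 1)) ?_ ?_ ?_ ?_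
      (hφ.mem_span_cA hx)
    · rintro _ ⟨w, rfl⟩ a; exact hφ.smul_mem_sup a w k
    · intro r; rw [smul_zero]; exact Submodule.zero_mem _
    · intro x y _ _ hx hy r; rw [smul_add]; exact Submodule.add_mem _ (hx r) (hy r)
    · intro a x _ hx r
      have := hx (r * a)
      rw [Subalgebra.coe_mul, mul_smul] at this
      exact this
  simpa using h 1

theorem IsLowest.exists_lowPart_expansion (hφ : IsLowest D.alg φ) {k : ℕ} {x : M}
    (hx : x ∈ lowPart D φ k) : ∃ u : ℤ → M,
      (∀ n, D.del • u n = (lowestWeight D W + n) • u n) ∧ (∀ n < 0, u n = 0) ∧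
      (∀ n, (k : ℤ) < n → u n = 0) ∧ HasSum u x := by
  let P : Submodule K M :=
    { carrier := {x | ∃ u : ℤ → M, (∀ n, D.del • u n = (lowestWeight D W + n) • u n) ∧
        (∀ n < 0, u n = 0) ∧ (∀ n, (k : ℤ) < n → u n = 0) ∧ HasSum u x}
      add_mem' := by
        rintro x y ⟨u, hu, hu', hu'', hx⟩ ⟨w, hw, hw', hw'', hy⟩
        exact ⟨u + w, fun n => by simp [hu, hw], fun n hn => by simp [hu' n hn, hw' n hn],
          fun n hn => by simp [hu'' n hn, hw'' n hn], hx.add hy⟩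
      zero_mem' := ⟨0, by simp, by simp, by simp, hasSum_zero⟩
      smul_mem' := by
        rintro a x ⟨u, hu, hu', hu'', hx⟩
        exact ⟨a • u, fun n => by
          rw [Pi.smul_apply, smul_comm D.del a, hu, smul_comm a], fun n hn => by simp [hu' n hn],
          fun n hn => by simp [hu'' n hn], hx.const_smul a⟩ }
  refine lowPart_le (P := P) (fun n hn a ha w => ?_) hx
  classical
  refine ⟨Pi.single n ((a : 𝓡) • φ w), fun m => ?_, fun m hm => Pi.single_eq_of_ne (by omega) _,
    fun m hm => Pi.single_eq_of_ne (by omega) _, hasSum_pi_single _ _⟩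
  by_cases h : m = n
  · subst h
    simpa using del_smul_smul ha.2 (hφ.del_smul_eq' w)
  · simp [Pi.single_eq_of_ne h]

variable [Module.Finite 𝓡 M]

open Polynomial in
/-- Vectors killed by a polynomial in `∂` which does not vanish at large weights have small
degree. -/
theorem IsLowest.mem_lowPart (hφ : IsLowest D.alg φ) {x : M}
    (hx : x ∈ Submodule.span 𝓡 (Set.range φ)) {k : ℕ} {q : K[X]}
    (hq : aeval (Algebra.lsmul K K M D.del) q x = 0)
    (hqk : ∀ n : ℤ, (k : ℤ) < n → q.eval (lowestWeight D W + n) ≠ 0) : x ∈ lowPart D φ k := by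
  have := t2Space_of_finite K (𝓡 := 𝓡) (M := M)
  obtain ⟨s, hs, y, ⟨u, hu, hu', hsum⟩, rfl⟩ := Submodule.mem_sup.1 (hφ.mem_sup hx k)
  obtain ⟨t, ht, -, ht', htsum⟩ := hφ.exists_lowPart_expansion hs
  have hcont : Continuous (aeval (Algebra.lsmul K K M D.del) q) :=
    continuous_aeval (continuous_const_smul D.del) q
  have hw : ∀ n, (Algebra.lsmul K K M D.del) (t n + u n) =
      (lowestWeight D W + n) • (t n + u n) := fun n => by
    rw [map_add, hu, smul_add]; congr 1; exact ht n
  -- Applying `q(∂)` multiplies the term of degree `n` by `q(λ + n)`, where `λ` is the lowest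
  -- weight, and the resulting sum is zero. By uniqueness each term vanishes; for `n > k` the factor
  -- is nonzero and `t n = 0`, which leaves `u n = 0`.
  have h1 := (htsum.add hsum).map (aeval (Algebra.lsmul K K M D.del) q) hcont
  rw [hq] at h1
  have h2 : ∀ n, aeval (Algebra.lsmul K K M D.del) q (t n + u n) =
      q.eval (lowestWeight D W + n) • (t n + u n) := fun n => aeval_apply_of_smul (hw n) q
  have h3 := hasUniqueWeightSums_of_finite (K := K) (M := M) D.del (lowestWeight D W) _
    (fun n => ?_) h1
  · have h4 : u = 0 := by
      funext n
      by_cases hn : n < k + 1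
      · exact hu' n hn
      · have h5 := congrFun h3 n
        rw [Function.comp, h2, ht' n (by omega), zero_add] at h5
        exact (_root_.smul_eq_zero.1 h5).resolve_left (hqk n (by omega))
    rw [h4] at hsum
    rw [hsum.unique hasSum_zero, add_zero]
    exact hs
  · rw [Function.comp, h2, _root_.map_smul, hw, smul_comm]

end KModule

end AnalyticLowest

/-! ### The quotient by the sum of all proper submodules -/

section SimpleQuotient

variable {T X : Type*} [Ring T] [AddCommGroup X] [Module T X]

/-- The bound `Y` is only an additive subgroup, because the vectors of positive degree do not form a
submodule. -/
theorem maxSubmodule_ne_top_of_le (Y : AddSubgroup X) (hY : Y ≠ ⊤)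
    (h : ∀ N : Submodule T X, N ≠ ⊤ → ∀ x ∈ N, x ∈ Y) : maxSubmodule T X ≠ ⊤ := by
  have h1 : ∀ x ∈ maxSubmodule T X, x ∈ Y := by
    intro x hx
    rw [maxSubmodule, sSup_eq_iSup'] at hx
    refine Submodule.iSup_induction _ (motive := fun x => x ∈ Y) hx ?_ Y.zero_mem
      fun x y => Y.add_mem
    rintro ⟨N, hN⟩ x hx
    exact h N hN x hx
  intro h2
  exact hY (eq_top_iff.2 fun x _ => h1 x (h2 ▸ trivial))

theorem le_maxSubmodule {N : Submodule T X} (hN : N ≠ ⊤) : N ≤ maxSubmodule T X := le_sSup hN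

theorem isSimpleModule_simpleQuotient (h : maxSubmodule T X ≠ ⊤) :
    IsSimpleModule T (SimpleQuotient T X) := by
  rw [isSimpleModule_iff_isCoatom]
  exact ⟨h, fun N hN => by_contra fun h' => hN.not_ge (le_maxSubmodule h')⟩

/-- A simple quotient of a module with a unique maximal submodule is the simple quotient. -/
theorem nonempty_simpleQuotient_equiv {Z : Type*} [AddCommGroup Z] [Module T Z]
    [IsSimpleModule T Z] (h : maxSubmodule T X ≠ ⊤) (f : X →ₗ[T] Z) (hf : Function.Surjective f) :
    Nonempty (SimpleQuotient T X ≃ₗ[T] Z) := by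
  have h1 : IsCoatom (LinearMap.ker f) := by
    rw [← isSimpleModule_iff_isCoatom]
    exact IsSimpleModule.congr (f.quotKerEquivOfSurjective hf)
  have h2 : maxSubmodule T X = LinearMap.ker f :=
    ((h1.le_iff).1 (le_maxSubmodule h1.1)).resolve_left h
  exact ⟨(Submodule.quotEquivOfEq _ _ h2).trans (f.quotKerEquivOfSurjective hf)⟩

end SimpleQuotient

/-- The elements of `T` which map the image of `φ` to itself. -/
def rangeStabilizer {K T W N : Type*} [CommRing K] [Ring T] [Algebra K T] [AddCommGroup W]
    [AddCommGroup N] [Module T N] (φ : W →+ N)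
    (h : ∀ (c : K) w, ∃ w', algebraMap K T c • φ w = φ w') : Subalgebra K T where
  carrier := {x | ∀ w, ∃ w', x • φ w = φ w'}
  mul_mem' := fun {x y} hx hy w => by
    obtain ⟨w', hw'⟩ := hy w
    obtain ⟨w'', hw''⟩ := hx w'
    exact ⟨w'', by rw [mul_smul, hw', hw'']⟩
  add_mem' := fun {x y} hx hy w => by
    obtain ⟨w', hw'⟩ := hx w
    obtain ⟨w'', hw''⟩ := hy w
    exact ⟨w' + w'', by rw [add_smul, hw', hw'', map_add]⟩
  algebraMap_mem' := h

/-! ### Algebraic Verma modules -/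

section AlgebraicVerma

variable {K : Type u} {R : Type v} [Field K] [Ring R] [Algebra K R]
  (D : TriangularDecomposition K R) {W : Type w} [AddCommGroup W] [Module D.H W]

/-- The map `W → Δ(W)`. -/
def vermaGen (W : Type w) [AddCommGroup W] [Module D.H W] : W →+ D.Verma W :=
  InducedModule.gen D.BH D.BHpos D.HtoBH

theorem isLowest_vermaGen : IsLowest D (vermaGen D W) where
  map_smul h w := InducedModule.gen_smul D.BH D.BHpos D.HtoBH h w
  kill b hb w := by
    have hb' : b ∈ D.BH := (le_sup_left : D.B ≤ D.BH) (D.Bpos_le_B hb)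
    exact InducedModule.smul_gen_eq_zero D.BH D.BHpos D.HtoBH (s := ⟨b, hb'⟩)
      ⟨b, hb, 1, D.H.one_mem, (mul_one b).symm⟩ w

theorem span_range_vermaGen : Submodule.span R (Set.range (vermaGen D W)) = ⊤ :=
  InducedModule.span_range_gen _ _ _

variable {D} in
theorem IsLowest.exists_smul_of_mem_B {N : Type*} [AddCommGroup N] [Module R N] {φ : W →+ N}
    (hφ : IsLowest D φ) {b : R} (hb : b ∈ D.B) :
    ∃ c : K, ∀ w, b • φ w = φ (algebraMap K D.H c • w) := by
  have h : b ∈ (1 ⊔ D.Bpos : Submodule K R) := D.toSubmodule_B_eq ▸ hb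
  obtain ⟨x, hx, y, hy, rfl⟩ := Submodule.mem_sup.1 h
  obtain ⟨c, rfl⟩ := Submodule.mem_one.1 hx
  exact ⟨c, fun w => by rw [add_smul, hφ.kill y hy, add_zero, hφ.algebraMap_smul]⟩

theorem exists_vermaLift {N : Type*} [AddCommGroup N] [Module R N] {φ : W →+ N}
    (hφ : IsLowest D φ) : ∃ G : D.Verma W →ₗ[R] N, ∀ w, G (vermaGen D W w) = φ w := by
  refine InducedModule.exists_lift D.BH D.BHpos D.HtoBH φ hφ.map_smul ?_ ?_
  · rintro s ⟨b, hb, h, hh, hs⟩ w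
    rw [hs, mul_smul]
    have := hφ.map_smul ⟨h, hh⟩ w
    rw [← this, hφ.kill b hb]
  · have h : D.BH ≤ rangeStabilizer (K := K) φ fun c w => ⟨_, (hφ.algebraMap_smul c w).symm⟩ := by
      refine sup_le (fun b hb w => ?_) fun h hh w => ⟨_, (hφ.map_smul ⟨h, hh⟩ w).symm⟩
      obtain ⟨c, hc⟩ := hφ.exists_smul_of_mem_B hb
      exact ⟨_, hc w⟩
    exact fun p w => h p.2 w

/-- `X` is generated by a universal lowest map from `W`. -/
structure IsUniversalLowest.{z} {K R : Type*} [Field K] [Ring R] [Algebra K R]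
    (D : TriangularDecomposition K R) (W : Type*) [AddCommGroup W] [Module D.H W] (X : Type*)
    [AddCommGroup X] [Module R X] : Prop where
  exists_gen : ∃ ψ : W →+ X, IsLowest D ψ ∧ Submodule.span R (Set.range ψ) = ⊤ ∧
    ∀ (N : Type z) [AddCommGroup N] [Module R N] (χ : W →+ N), IsLowest D χ →
      ∃ G : X →ₗ[R] N, ∀ w, G (ψ w) = χ w

theorem isUniversalLowest_verma.{z} : IsUniversalLowest.{z} D W (D.Verma W) :=
  ⟨⟨vermaGen D W, isLowest_vermaGen D, span_range_vermaGen D,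
    fun _ _ _ _ hχ => exists_vermaLift D hχ⟩⟩

/-- The vectors of weight `c + m` with `m > 0`. -/
def positiveWeightVectors (c : K) (X : Type*) [AddCommGroup X] [Module R X] : Set X :=
  {x | ∃ m : ℕ, D.del • x = algebraMap K R (c + (m + 1)) • x}

theorem smul_mem_eigenspace {X : Type*} [AddCommGroup X] [Module R X] {a : R} {n : ℕ}
    (ha : a ∈ D.An n) {c : K} {x : X}
    (hx : D.del • x = algebraMap K R c • x) :
    D.del • a • x = algebraMap K R (c + n) • a • x := by
  have h1 : D.del * a - a * D.del = ((n : ℤ) : K) • a := mem_degreePart.1 ha.2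
  rw [sub_eq_iff_eq_add] at h1
  rw [← mul_smul, h1, add_smul, mul_smul, hx, ← mul_smul a, ← Algebra.commutes, map_add, add_smul,
    mul_smul, Algebra.smul_def, mul_smul, add_comm]
  simp

/-- On `φ(W)` the algebra `B` acts by scalars and `H` preserves the image, so only `A` moves
vectors: `A_0 = K` stays in `φ(W)`, and `A_n` with `n > 0` raises the weight. -/
theorem IsLowest.mem_add_closure {D : TriangularDecomposition K R} [Module D.H W]
    {X : Type*} [AddCommGroup X] [Module R X] {φ : W →+ X} (hφ : IsLowest D φ) (hspan : Submodule.span R (Set.range φ) = ⊤)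
    {c : K} (hc : ∀ w, D.del • φ w = algebraMap K R c • φ w) (x : X) :
    x ∈ φ.range ⊔ AddSubgroup.closure (positiveWeightVectors D c X) := by
  set P := φ.range ⊔ AddSubgroup.closure (positiveWeightVectors D c X)
  have hA : ∀ a ∈ D.A, ∀ w, a • φ w ∈ P := by
    intro a ha w
    have ha' : a ∈ (⨆ n, D.An n) := D.A_graded ▸ ha
    refine Submodule.iSup_induction _ (motive := fun a => a • φ w ∈ P) ha' ?_ ?_ ?_
    · rintro (_ | n) a ha
      · rw [D.An_zero] at ha
        obtain ⟨k, rfl⟩ := Submodule.mem_one.1 ha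
        exact (le_sup_left : φ.range ≤ P) ⟨_, hφ.algebraMap_smul k w⟩
      · refine (le_sup_right : _ ≤ P) (AddSubgroup.subset_closure ⟨n, ?_⟩)
        rw [← Nat.cast_succ]
        exact smul_mem_eigenspace D ha (hc w)
    · rw [zero_smul]; exact P.zero_mem
    · intro x y hx hy; rw [add_smul]; exact P.add_mem hx hy
  have hR : ∀ r : R, ∀ w, r • φ w ∈ P := by
    intro r w
    have hr : r ∈ Subalgebra.toSubmodule D.A * Subalgebra.toSubmodule D.H *
      Subalgebra.toSubmodule D.B := by rw [D.mul_eq_top]; trivial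
    refine Submodule.mul_induction_on (C := fun r => r • φ w ∈ P) hr (fun x hx b hb => ?_)
      fun x y hx hy => by rw [add_smul]; exact P.add_mem hx hy
    obtain ⟨k, hk⟩ := hφ.exists_smul_of_mem_B hb
    rw [mul_smul, hk]
    refine Submodule.mul_induction_on (C := fun r => r • φ _ ∈ P) hx (fun a ha h hh => ?_)
      fun x y hx hy => by rw [add_smul]; exact P.add_mem hx hy
    rw [mul_smul, ← hφ.map_smul ⟨h, hh⟩]
    exact hA a ha _
  have h : ∀ r : R, r • x ∈ P := by
    refine Submodule.span_induction (p := fun x _ => ∀ r : R, r • x ∈ P) ?_ ?_ ?_ ?_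
      (hspan ▸ Submodule.mem_top : x ∈ Submodule.span R (Set.range φ))
    · rintro _ ⟨w, rfl⟩ r; exact hR r w
    · intro r; rw [smul_zero]; exact P.zero_mem
    · intro x y _ _ hx hy r; rw [smul_add]; exact P.add_mem (hx r) (hy r)
    · intro a x _ hx r; rw [← mul_smul]; exact hx _
  simpa using h 1

theorem IsLowest.range_subset {D : TriangularDecomposition K R} [Module D.H W]
    [IsSimpleModule D.H W] {X : Type*} [AddCommGroup X] [Module R X]
    {φ : W →+ X} (hφ : IsLowest D φ) (N : Submodule R X) {w : W} (hw : φ w ∈ N)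
    (hw0 : φ w ≠ 0) : Set.range φ ⊆ N := by
  have hw1 : w ≠ 0 := by rintro rfl; exact hw0 (map_zero φ)
  rintro _ ⟨w', rfl⟩
  have h1 := IsSimpleModule.span_singleton_eq_top D.H hw1
  obtain ⟨h, rfl⟩ := Submodule.mem_span_singleton.1 (h1 ▸ Submodule.mem_top : w' ∈ _)
  rw [hφ.map_smul]
  exact N.smul_mem _ hw

open Polynomial in
-- A product of factors `X - (c + m + 1)` kills a finite sum of vectors of positive degree and does
-- not vanish at `c` in characteristic zero. It plays the role of a projection onto the weight `c`.
theorem exists_annihilating_polynomial [CharZero K] {X : Type*} [AddCommGroup X] [Module R X]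
    [Module K X] [IsScalarTower K R X] {c : K} {y : X}
    (hy : y ∈ AddSubgroup.closure (positiveWeightVectors D c X)) :
    ∃ q : K[X], q.eval c ≠ 0 ∧ aeval (Algebra.lsmul K K X D.del) q y = 0 := by
  induction hy using AddSubgroup.closure_induction with
  | mem y hy =>
    obtain ⟨m, hm⟩ := hy
    have hm' : Algebra.lsmul K K X D.del y = (c + (m + 1)) • y := by
      rw [← algebraMap_smul R]; exact hm
    refine ⟨Polynomial.X - C (c + (m + 1)), ?_, ?_⟩
    · have : (m : K) + 1 ≠ 0 := by exact_mod_cast Nat.succ_ne_zero m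
      rw [eval_sub, eval_X, eval_C, sub_add_cancel_left]
      exact neg_ne_zero.2 this
    · rw [aeval_apply_of_smul hm']; simp
  | zero => exact ⟨1, by simp, by simp⟩
  | add x y _ _ hx hy =>
    obtain ⟨q, hq, hx⟩ := hx
    obtain ⟨r, hr, hy⟩ := hy
    refine ⟨q * r, by simp [hq, hr], ?_⟩
    rw [map_add]
    nth_rw 1 [mul_comm q r]
    simp [Module.End.mul_apply, hx, hy]
  | neg x _ hx =>
    obtain ⟨q, hq, hx⟩ := hx
    exact ⟨q, hq, by simp [hx]⟩

/-- The proper submodules of an algebraic lowest weight module live in positive degrees. -/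
theorem IsLowest.mem_closure [CharZero K] {D : TriangularDecomposition K R} [Module D.H W]
    [IsSimpleModule D.H W] {X : Type*} [AddCommGroup X] [Module R X]
    {φ : W →+ X} (hφ : IsLowest D φ) (hspan : Submodule.span R (Set.range φ) = ⊤)
    {c : K} (hc : ∀ w, D.del • φ w = algebraMap K R c • φ w) {N : Submodule R X} (hN : N ≠ ⊤)
    {x : X} (hx : x ∈ N) : x ∈ AddSubgroup.closure (positiveWeightVectors D c X) := by
  let : Module K X := Module.compHom X (algebraMap K R)
  have : IsScalarTower K R X := IsScalarTower.of_algebraMap_smul fun _ _ => rfl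
  obtain ⟨_, ⟨w, rfl⟩, y, hy, rfl⟩ := AddSubgroup.mem_sup.1 (hφ.mem_add_closure hspan hc x)
  obtain ⟨q, hq, hqy⟩ := exists_annihilating_polynomial D hy
  have hstab : ∀ (q : Polynomial K), ∀ x ∈ N,
      Polynomial.aeval (Algebra.lsmul K K X D.del) q x ∈ N := by
    intro q x hx
    have h1 := Polynomial.aeval_algHom_apply (Algebra.lsmul K K X : R →ₐ[K] _) D.del q
    rw [h1]
    exact N.smul_mem _ hx
  -- `q(∂)` kills `y` and multiplies `φ w` by `q(c) ≠ 0`, so `φ w ∈ N`. If it were nonzero it would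
  -- generate the whole module.
  have h1 := hstab q _ hx
  have h2 : Algebra.lsmul K K X D.del (φ w) = c • φ w := hc w
  rw [map_add, hqy, add_zero, aeval_apply_of_smul h2] at h1
  have h3 : φ w ∈ N := by
    have h4 := (N.restrictScalars K).smul_mem (q.eval c)⁻¹ h1
    rwa [smul_smul, inv_mul_cancel₀ hq, one_smul] at h4
  have h4 : φ w = 0 := by
    by_contra h4
    exact hN (eq_top_iff.2 (hspan ▸ Submodule.span_le.2 (hφ.range_subset N h3 h4)))
  rwa [h4, zero_add]

theorem IsLowest.maxSubmodule_ne_top [CharZero K] {D : TriangularDecomposition K R} [Module D.H W]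
    [IsSimpleModule D.H W] {X : Type*} [AddCommGroup X] [Module R X]
    {φ : W →+ X} (hφ : IsLowest D φ) (hspan : Submodule.span R (Set.range φ) = ⊤)
    {c : K} (hc : ∀ w, D.del • φ w = algebraMap K R c • φ w) {w : W} (hw : φ w ≠ 0) :
    maxSubmodule R X ≠ ⊤ := by
  refine maxSubmodule_ne_top_of_le (AddSubgroup.closure (positiveWeightVectors D c X)) ?_
    fun N hN x hx => hφ.mem_closure hspan hc hN hx
  intro h
  let : Module K X := Module.compHom X (algebraMap K R)
  have : IsScalarTower K R X := IsScalarTower.of_algebraMap_smul fun _ _ => rfl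
  obtain ⟨q, hq, hqy⟩ := exists_annihilating_polynomial D (h ▸ AddSubgroup.mem_top (φ w) :
    φ w ∈ AddSubgroup.closure (positiveWeightVectors D c X))
  have h2 : Algebra.lsmul K K X D.del (φ w) = c • φ w := hc w
  rw [aeval_apply_of_smul h2] at hqy
  exact hw ((_root_.smul_eq_zero.1 hqy).resolve_left hq)

end AlgebraicVerma

/-- The map `m ↦ 1 ⊗ m` for the extension of scalars from a subalgebra. -/
def ExtendScalars.ιLinear {K 𝓡 : Type*} [CommRing K] [Ring 𝓡] [Algebra K 𝓡] (R : Subalgebra K 𝓡)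
    (L : Type*) [AddCommGroup L] [Module R L] :
    L →ₗ[R] ExtendScalars (R.val : R →+* 𝓡) L where
  toFun := ExtendScalars.ι _
  map_add' := map_add _
  map_smul' r x := ExtendScalars.ι_smul (R.val : R →+* 𝓡) r x

/-! ### Analytic Verma modules and their simple quotients -/

section AnalyticVerma

variable {K : Type u} [NontriviallyNormedField K] {𝓡 : Type v} [NormedRing 𝓡]
  [NormedAlgebra K 𝓡] [CompleteSpace K] [IsUltrametricDist K] [CharZero K] [CompleteSpace 𝓡]
  [IsUltrametricDist 𝓡] (D : BanachTriangularDecomposition K 𝓡) [IsNoetherianRing D.cB]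

section Universal

variable {W : Type w} [AddCommGroup W] [Module D.alg.H W]

/-- The map `W → Δ̂(W)`. -/
def analyticVermaGen (W : Type w) [AddCommGroup W] [Module D.alg.H W] : W →+ D.AnalyticVerma W :=
  InducedModule.gen D.cBH D.cBHpos D.HtocBH

omit [CompleteSpace K] [IsUltrametricDist K] [CharZero K] [CompleteSpace 𝓡]
  [IsUltrametricDist 𝓡] [IsNoetherianRing D.cB] in
theorem isLowest_analyticVermaGen : IsLowest D.alg (analyticVermaGen D W) where
  map_smul h w := InducedModule.gen_smul D.cBH D.cBHpos D.HtocBH h w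
  kill b hb w := by
    have hb' : (b : 𝓡) ∈ D.cBH := (le_sup_left : D.cB ≤ D.cBH) (coe_mem_cB D (D.alg.Bpos_le_B hb))
    exact InducedModule.smul_gen_eq_zero D.cBH D.cBHpos D.HtocBH (s := ⟨b, hb'⟩)
      ⟨b, hb, 1, D.alg.H.one_mem, (mul_one (b : 𝓡)).symm⟩ w

omit [CompleteSpace K] [IsUltrametricDist K] [CharZero K] [CompleteSpace 𝓡]
  [IsUltrametricDist 𝓡] [IsNoetherianRing D.cB] in
theorem span_range_analyticVermaGen :
    Submodule.span 𝓡 (Set.range (analyticVermaGen D W)) = ⊤ :=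
  InducedModule.span_range_gen _ _ _

/-- No topology on `N` is needed: `𝓑 = K + 𝓑B^{>0}` holds with the left ideal generated
algebraically, so `𝓑` acts on the image of `φ` by scalars. -/
theorem exists_analyticVermaLift [IsNoetherianRing 𝓡] {N : Type*} [AddCommGroup N]
    [Module 𝓡 N] {φ : W →+ N}
    (hφ : IsLowest D.alg φ) :
    ∃ G : D.AnalyticVerma W →ₗ[𝓡] N, ∀ w, G (analyticVermaGen D W w) = φ w := by
  refine InducedModule.exists_lift D.cBH D.cBHpos D.HtocBH φ hφ.map_smul ?_ ?_
  · rintro s ⟨b, hb, h, hh, hs⟩ w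
    rw [hs, mul_smul]
    have := hφ.map_smul ⟨h, hh⟩ w
    exact (congrArg (fun x => (b : 𝓡) • x) this).symm.trans (hφ.kill b hb _)
  · have h : D.cBH ≤ rangeStabilizer (K := K) (T := 𝓡) φ
        fun c w => ⟨_, (hφ.algebraMap_smul c w).symm⟩ := by
      refine sup_le (fun b hb w => ?_) ?_
      · obtain ⟨c, hc⟩ := exists_sub_algebraMap_mem D ⟨b, hb⟩
        have h1 := hφ.smul_eq_zero_of_mem (coe_mem_leftIdealBpos_of_mem_augmentationB D hc) w
        refine ⟨algebraMap K D.alg.H c • w, ?_⟩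
        rw [Subalgebra.coe_sub, sub_smul, sub_eq_zero] at h1
        exact h1.trans (hφ.algebraMap_smul c w).symm
      · rintro _ ⟨h, hh, rfl⟩ w
        exact ⟨_, (hφ.map_smul ⟨h, hh⟩ w).symm⟩
    exact fun p w => h p.2 w

/-- Every simple `H`-module embeds into the lowest weight vectors of some `𝓡`-module. -/
theorem exists_injective_isLowest [IsSimpleModule D.alg.H W] :
    ∃ φ : W →+ 𝓡 ⧸ D.leftIdealBpos, IsLowest D.alg φ ∧ Function.Injective φ := by
  have := D.alg.isSemisimpleRing_H
  -- By semi-simplicity `W` is a left ideal of `H`, and `H` injects into `𝓡 / 𝓡B^{>0}`.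
  obtain ⟨I, ⟨e⟩⟩ := IsSemisimpleRing.exists_linearEquiv_ideal_of_isSimpleModule D.alg.H W
  let φ : W →+ 𝓡 ⧸ D.leftIdealBpos :=
    { toFun := fun w => D.leftIdealBpos.mkQ (((e w : D.alg.H) : D.R) : 𝓡)
      map_zero' := by rw [map_zero]; exact map_zero D.leftIdealBpos.mkQ
      map_add' := fun x y => by rw [map_add]; exact map_add D.leftIdealBpos.mkQ _ _ }
  refine ⟨φ, ⟨fun h w => ?_, fun b hb w => ?_⟩, ?_⟩
  · change D.leftIdealBpos.mkQ (((e (h • w) : D.alg.H) : D.R) : 𝓡) =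
      ((h : D.R) : 𝓡) • D.leftIdealBpos.mkQ _
    rw [← map_smul, e.map_smul]
    rfl
  · change (b : 𝓡) • D.leftIdealBpos.mkQ (((e w : D.alg.H) : D.R) : 𝓡) = 0
    rw [← map_smul]
    refine (Submodule.Quotient.mk_eq_zero _).2 ?_
    have h1 := D.alg.Bpos_mul_H_le (Submodule.mul_mem_mul hb (e w : D.alg.H).2)
    refine Submodule.mul_induction_on (C := fun x : D.R => (x : 𝓡) ∈ D.leftIdealBpos) h1 ?_ ?_
    · intro h _ b hb
      exact Ideal.mul_mem_left _ _ (coe_mem_leftIdealBpos D hb)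
    · intro x y hx hy
      exact Submodule.add_mem _ hx hy
  · rw [injective_iff_map_eq_zero]
    intro w hw
    have h1 := eq_zero_of_mem_leftIdealBpos D (e w : D.alg.H).2
      ((Submodule.Quotient.mk_eq_zero _).1 hw)
    exact (map_eq_zero_iff e e.injective).1 (Subtype.ext (Subtype.ext h1))

end Universal

variable [IsNoetherianRing 𝓡] {D}
variable {W M : Type*} [AddCommGroup W] [Module D.alg.H W] [IsSimpleModule D.alg.H W]
  [AddCommGroup M] [Module 𝓡 M] {φ : W →+ M}

section Topological

variable [Module K M] [IsScalarTower K 𝓡 M] [TopologicalSpace M] [IsModuleTopology 𝓡 M]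
  [IsTopologicalAddGroup M] [ContinuousConstSMul K M] [Module.Finite 𝓡 M]

theorem IsLowest.mem_lowPart_zero {x : M} (hφ : IsLowest D.alg φ) (hx : x ∈ lowPart D φ 0) :
    ∃ w, φ w = x := by
  let P : Submodule K M :=
    { φ.range with
      smul_mem' := by
        rintro c _ ⟨w, rfl⟩
        refine ⟨algebraMap K D.alg.H c • w, ?_⟩
        rw [hφ.algebraMap_smul, ← _root_.algebraMap_smul 𝓡 c]
        rfl }
  refine lowPart_le (P := P) (fun n hn a ha w => ?_) hx
  obtain rfl : n = 0 := by omega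
  rw [D.alg.An_zero] at ha
  obtain ⟨k, rfl⟩ := Submodule.mem_one.1 ha
  exact ⟨_, hφ.algebraMap_smul k w⟩

/-- The proper submodules of an analytic lowest weight module live in positive degrees. -/
theorem IsLowest.mem_weightTail (hφ : IsLowest D.alg φ)
    (hspan : Submodule.span 𝓡 (Set.range φ) = ⊤) {N : Submodule 𝓡 M} (hN : N ≠ ⊤) {x : M}
    (hx : x ∈ N) : x ∈ weightTail (Algebra.lsmul K K M D.del) (lowestWeight D W) 1 := by
  obtain ⟨s, hs, t, ht, rfl⟩ := Submodule.mem_sup.1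
    (hφ.mem_sup (hspan ▸ Submodule.mem_top : x ∈ Submodule.span 𝓡 (Set.range φ)) 0)
  obtain ⟨w, rfl⟩ := hφ.mem_lowPart_zero hs
  rw [Nat.cast_zero, zero_add] at ht
  obtain ⟨u, hu, hu0, hsum⟩ := mem_weightTail_iff.1 ht
  have h1 : φ w ∈ N := by
    -- The component of degree zero of the element is `φ w`, because `u` starts in degree one; hence
    -- `φ w ∈ N`.
    have h2 := component_mem (x := D.del) (c := lowestWeight D W)
      (u := fun n => Pi.single (M := fun _ : ℤ => M) 0 (φ w) n + u n) (fun n => ?_) hx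
      ((hasSum_pi_single (0 : ℤ) (φ w)).add hsum) 0
    · rwa [Pi.single_eq_same, hu0 0 (by omega), add_zero] at h2
    · rw [smul_add, smul_add]
      refine congrArg₂ (· + ·) ?_ (hu n)
      by_cases hn : n = 0
      · subst hn
        rw [Pi.single_eq_same, Int.cast_zero, add_zero]
        exact hφ.del_smul_eq' w
      · rw [Pi.single_eq_of_ne hn, smul_zero, smul_zero]
  have h2 : φ w = 0 := by
    by_contra h4
    refine hN (eq_top_iff.2 (hspan ▸ Submodule.span_le.2 ?_))
    have hw1 : w ≠ 0 := by rintro rfl; exact h4 (map_zero φ)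
    rintro _ ⟨w', rfl⟩
    have h1' := IsSimpleModule.span_singleton_eq_top D.alg.H hw1
    obtain ⟨h, rfl⟩ := Submodule.mem_span_singleton.1 (h1' ▸ Submodule.mem_top : w' ∈ _)
    rw [hφ.map_smul]
    exact N.smul_mem _ h1
  rwa [h2, zero_add]

theorem IsLowest.notMem_weightTail (hφ : IsLowest D.alg φ) {w : W} (hw : φ w ≠ 0) :
    φ w ∉ weightTail (Algebra.lsmul K K M D.del) (lowestWeight D W) 1 := fun h =>
  hw ((hasUniqueWeightSums_of_finite (K := K) (M := M) D.del).eq_zero (j := 0) zero_lt_one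
    (by simpa using hφ.del_smul_eq' w) h)

omit [IsSimpleModule D.alg.H W] [Module.Finite 𝓡 M] in
theorem smul_mem_weightTail_one {X : Type*} [AddCommGroup X] [Module D.R X] (f : X →ₗ[D.R] M)
    {c : K} {y : X} (hy : y ∈ AddSubgroup.closure (positiveWeightVectors D.alg c X)) (a : D.cA) :
    (a : 𝓡) • f y ∈ weightTail (Algebra.lsmul K K M D.del) c 1 := by
  induction hy using AddSubgroup.closure_induction with
  | mem y hy =>
    obtain ⟨m, hm⟩ := hy
    have h1 : D.del • f y = (c + (m + 1)) • f y := by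
      have h2 := congrArg f hm
      rw [map_smul, map_smul] at h2
      rw [← algebraMap_smul 𝓡 (c + (m + 1))]
      exact h2
    have h2 := smul_mem_weightTail h1 a
    have h3 : (c + (m + 1) : K) = c + ((m + 1 : ℕ) : ℤ) := by push_cast; ring
    rw [h3, weightTail_shift] at h2
    exact weightTail_anti (by omega) h2
  | zero => rw [map_zero, smul_zero]; exact Submodule.zero_mem _
  | add x y _ _ hx hy => rw [map_add, smul_add]; exact Submodule.add_mem _ hx hy
  | neg x _ hx => rw [map_neg, smul_neg]; exact Submodule.neg_mem _ hx

end Topological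

variable (K) in
/-- A module generated by lowest weight vectors is finite over `𝓐` and over `𝓡`. -/
theorem IsLowest.finite_of_span (hφ : IsLowest D.alg φ)
    (hspan : Submodule.span 𝓡 (Set.range φ) = ⊤) : Module.Finite D.cA M ∧ Module.Finite 𝓡 M := by
  let : Module K M := Module.compHom M (algebraMap K 𝓡)
  have : IsScalarTower K 𝓡 M := IsScalarTower.of_algebraMap_smul fun _ _ => rfl
  have := hφ.finite_span hspan
  exact ⟨this, Module.Finite.of_restrictScalars_finite D.cA 𝓡 M⟩

theorem IsLowest.maxSubmodule_ne_top' (hφ : IsLowest D.alg φ)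
    (hspan : Submodule.span 𝓡 (Set.range φ) = ⊤) {w : W} (hw : φ w ≠ 0) :
    maxSubmodule 𝓡 M ≠ ⊤ := by
  let : Module K M := Module.compHom M (algebraMap K 𝓡)
  have : IsScalarTower K 𝓡 M := IsScalarTower.of_algebraMap_smul fun _ _ => rfl
  let : TopologicalSpace M := moduleTopology 𝓡 M
  have : IsModuleTopology 𝓡 M := ⟨rfl⟩
  have := IsModuleTopology.topologicalAddGroup 𝓡 M
  have := continuousConstSMul_of_isModuleTopology K 𝓡 M
  have := (hφ.finite_of_span K hspan).2
  refine maxSubmodule_ne_top_of_le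
    (weightTail (Algebra.lsmul K K M D.del) (lowestWeight D W) 1).toAddSubgroup ?_
    fun N hN x hx => hφ.mem_weightTail hspan hN hx
  intro h
  exact hφ.notMem_weightTail hw (h ▸ AddSubgroup.mem_top (φ w) :
    φ w ∈ (weightTail (Algebra.lsmul K K M D.del) (lowestWeight D W) 1).toAddSubgroup)

/-- The `𝓐`-span of `f(N)` is closed and contains the translates of `f(N)` by the dense subalgebra
`R`, so it contains the `𝓡`-span. Its elements are sums of vectors of positive degree, whereas `φ w`
has degree zero. Applied to the maximal submodule of `Δ(W)`, this shows that `𝓡 ⊗_R L(W)` is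
nonzero. -/
theorem IsLowest.span_image_ne_top [IsNoetherianRing D.cA] (hφ : IsLowest D.alg φ)
    (hspan : Submodule.span 𝓡 (Set.range φ) = ⊤) {w : W} (hw : φ w ≠ 0)
    {X : Type*} [AddCommGroup X] [Module D.R X] (f : X →ₗ[D.R] M) (N : Submodule D.R X)
    (hN : ∀ y ∈ N, y ∈ AddSubgroup.closure (positiveWeightVectors D.alg (lowestWeight D W) X)) :
    Submodule.span 𝓡 (f '' N) ≠ ⊤ := by
  let : Module K M := Module.compHom M (algebraMap K 𝓡)
  have : IsScalarTower K 𝓡 M := IsScalarTower.of_algebraMap_smul fun _ _ => rfl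
  let : TopologicalSpace M := moduleTopology 𝓡 M
  have : IsModuleTopology 𝓡 M := ⟨rfl⟩
  have := IsModuleTopology.topologicalAddGroup 𝓡 M
  have := continuousConstSMul_of_isModuleTopology K 𝓡 M
  have := (hφ.finite_of_span K hspan).1
  have := (hφ.finite_of_span K hspan).2
  let P : Submodule D.cA M := Submodule.span D.cA (f '' N)
  have hP : ∀ x ∈ Submodule.span 𝓡 (f '' N), x ∈ P := by
    intro x hx
    have h : ∀ r : 𝓡, r • x ∈ P := by
      refine Submodule.span_induction (p := fun x _ => ∀ r : 𝓡, r • x ∈ P) ?_ ?_ ?_ ?_ hx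
      · rintro _ ⟨n, hn, rfl⟩ r
        refine smul_mem_of_dense K D.cA (isClosed_cA D) P D.dense (fun r hr => ?_) r
        exact Submodule.subset_span ⟨(⟨r, hr⟩ : D.R) • n, N.smul_mem _ hn, f.map_smul _ _⟩
      · intro r; rw [smul_zero]; exact P.zero_mem
      · intro x y _ _ hx hy r; rw [smul_add]; exact P.add_mem (hx r) (hy r)
      · intro a x _ hx r; rw [← mul_smul]; exact hx _
    simpa using h 1
  intro htop
  refine hφ.notMem_weightTail hw ?_
  have h1 : φ w ∈ P := hP _ (htop ▸ trivial)
  have h : ∀ a : D.cA, (a : 𝓡) • φ w ∈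
      weightTail (Algebra.lsmul K K M D.del) (lowestWeight D W) 1 := by
    refine Submodule.span_induction (p := fun x _ => ∀ a : D.cA, (a : 𝓡) • x ∈
      weightTail (Algebra.lsmul K K M D.del) (lowestWeight D W) 1) ?_ ?_ ?_ ?_ h1
    · rintro _ ⟨n, hn, rfl⟩ a; exact smul_mem_weightTail_one f (hN n hn) a
    · intro r; rw [smul_zero]; exact Submodule.zero_mem _
    · intro x y _ _ hx hy r; rw [smul_add]; exact Submodule.add_mem _ (hx r) (hy r)
    · intro a x _ hx r
      have := hx (r * a)
      rw [Subalgebra.coe_mul, mul_smul] at this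
      exact this
  simpa using h 1

/-- A lowest weight module which is extended from a simple `R`-module is simple. -/
theorem IsLowest.isSimpleModule_of_isSimpleModule (hφ : IsLowest D.alg φ)
    (hspan : Submodule.span 𝓡 (Set.range φ) = ⊤) {w : W} (hw : φ w ≠ 0)
    {L : Type*} [AddCommGroup L] [Module D.R L] [IsSimpleModule D.R L] (f : L →ₗ[D.R] M)
    (hf : ∀ w, φ w ∈ LinearMap.range f) : IsSimpleModule 𝓡 M := by
  let : Module K M := Module.compHom M (algebraMap K 𝓡)
  have : IsScalarTower K 𝓡 M := IsScalarTower.of_algebraMap_smul fun _ _ => rfl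
  let : TopologicalSpace M := moduleTopology 𝓡 M
  have : IsModuleTopology 𝓡 M := ⟨rfl⟩
  have := IsModuleTopology.topologicalAddGroup 𝓡 M
  have := continuousConstSMul_of_isModuleTopology K 𝓡 M
  have := (hφ.finite_of_span K hspan).2
  have := t2Space_of_finite K (𝓡 := 𝓡) (M := M)
  have : Nontrivial M := ⟨φ w, 0, hw⟩
  refine { eq_bot_or_eq_top := fun N => or_iff_not_imp_left.2 fun hN => ?_ }
  obtain ⟨y, hy, hy0⟩ := N.ne_bot_iff.1 hN
  have h1 : y ∈ weightTail (Algebra.lsmul K K M D.del) (lowestWeight D W) 0 := by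
    have hle : lowPart D φ 0 ⊔ weightTail (Algebra.lsmul K K M D.del) (lowestWeight D W)
        ((0 : ℕ) + 1) ≤ weightTail (Algebra.lsmul K K M D.del) (lowestWeight D W) 0 := by
      refine sup_le (fun x hx => ?_) (weightTail_anti (by omega))
      obtain ⟨u, hu, hu0, -, hs⟩ := hφ.exists_lowPart_expansion hx
      exact mem_weightTail_iff.2 ⟨u, hu, hu0, hs⟩
    exact hle (hφ.mem_sup (hspan ▸ Submodule.mem_top :
      y ∈ Submodule.span 𝓡 (Set.range φ)) 0)
  obtain ⟨u, hu, -, hs⟩ := mem_weightTail_iff.1 h1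
  obtain ⟨n, hn⟩ : ∃ n, u n ≠ 0 := by
    by_contra! h
    rw [show u = 0 from funext h] at hs
    exact hy0 (hs.unique hasSum_zero)
  have hun : u n ∈ N := component_mem hu hy hs n
  -- A weight vector lies in an algebraic sum of spaces `A_m φ(W)`, hence in the image of `L`, where
  -- simplicity over `R` applies.
  have h2 : u n ∈ lowPart D φ n.toNat := by
    refine hφ.mem_lowPart (hspan ▸ trivial) (q := Polynomial.X - Polynomial.C
      (lowestWeight D W + n)) ?_ fun m hm => ?_
    · rw [aeval_apply_of_smul (hu n)]; simp
    · have : m ≠ n := by omega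
      simpa [sub_eq_zero] using this
  let P : Submodule K M :=
    { (LinearMap.range f).toAddSubgroup with
      smul_mem' := by
        rintro c _ ⟨l, rfl⟩
        refine ⟨algebraMap K D.R c • l, ?_⟩
        rw [_root_.map_smul]
        rfl }
  have h3 : lowPart D φ n.toNat ≤ P := lowPart_le fun m _ a _ w => by
    obtain ⟨l, hl⟩ := hf w
    exact ⟨a • l, by rw [_root_.map_smul, hl]; rfl⟩
  obtain ⟨l, hl⟩ := h3 h2
  have hl0 : l ≠ 0 := by
    rintro rfl
    exact hn (hl.symm.trans f.map_zero)
  rw [eq_top_iff, ← hspan, Submodule.span_le]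
  rintro _ ⟨w, rfl⟩
  obtain ⟨l', hl'⟩ := hf w
  have h4 := IsSimpleModule.span_singleton_eq_top D.R hl0
  obtain ⟨r, rfl⟩ := Submodule.mem_span_singleton.1 (h4 ▸ Submodule.mem_top : l' ∈ _)
  rw [← hl', _root_.map_smul, hl]
  exact N.smul_mem (r : 𝓡) hun

/-- Here `X`, `M`, `L`, `Q` stand for `Δ(W)`, `Δ̂(W)`, `L(W)` and `𝓡 ⊗_R L(W)`. The module `Q` is
generated by lowest weight vectors coming from the simple module `L`, so it is simple as soon as it
is nonzero; it is then a simple quotient of `M`, and `M` has only one. -/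
theorem IsLowest.nonempty_simpleQuotient_equiv [IsNoetherianRing D.cA] {X L Q : Type*}
    [AddCommGroup X] [Module D.R X] [AddCommGroup L] [Module D.R L]
    [IsSimpleModule D.R L] [AddCommGroup Q] [Module 𝓡 Q] {ψ : W →+ X}
    (hψ : IsLowest D.alg ψ)
    (hψspan : Submodule.span D.R (Set.range ψ) = ⊤) (hφ : IsLowest D.alg φ)
    (hφspan : Submodule.span 𝓡 (Set.range φ) = ⊤) {w₀ : W} (hw₀ : φ w₀ ≠ 0) (j : X →ₗ[D.R] M)
    (hj : ∀ w, j (ψ w) = φ w)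
    (p : X →ₗ[D.R] L) (hp : Function.Surjective p) (f : L →ₗ[D.R] Q)
    (hf : Submodule.span 𝓡 (Set.range f) = ⊤)
    (hfact : ∀ k : L →ₗ[D.R] SimpleQuotient 𝓡 M,
      ∃ G : Q →ₗ[𝓡] SimpleQuotient 𝓡 M, ∀ x, G (f x) = k x)
    (hlift : ∀ χ : W →+ Q, IsLowest D.alg χ → ∃ F : M →ₗ[𝓡] Q, ∀ w, F (φ w) = χ w) :
    Nonempty (SimpleQuotient 𝓡 M ≃ₗ[𝓡] Q) := by
  have hmaxM := hφ.maxSubmodule_ne_top' hφspan hw₀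
  have hker : LinearMap.ker p ≠ ⊤ := fun h => by
    have := IsSimpleModule.nontrivial D.R L
    obtain ⟨l, hl⟩ := exists_ne (0 : L)
    obtain ⟨x, rfl⟩ := hp l
    exact hl (LinearMap.mem_ker.1 (h ▸ Submodule.mem_top))
  let q := (maxSubmodule 𝓡 M).mkQ
  let χ : W →+ Q := (f.comp p).toAddMonoidHom.comp ψ
  have hχ' := hψ.comp (f.comp p)
  have hχ : IsLowest D.alg χ := ⟨hχ'.map_smul, hχ'.kill⟩
  have hspan : Submodule.span 𝓡 (Set.range χ) = ⊤ := by
    rw [eq_top_iff, ← hf, Submodule.span_le]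
    rintro _ ⟨l, rfl⟩
    obtain ⟨x, rfl⟩ := hp l
    change f (p x) ∈ Submodule.span 𝓡 (Set.range χ)
    refine Submodule.span_induction (p := fun x _ => f (p x) ∈ Submodule.span 𝓡 (Set.range χ))
      ?_ ?_ ?_ ?_ (hψspan ▸ Submodule.mem_top : x ∈ Submodule.span D.R (Set.range ψ))
    · rintro _ ⟨w, rfl⟩; exact Submodule.subset_span ⟨w, rfl⟩
    · rw [map_zero, map_zero]; exact Submodule.zero_mem _
    · intro x y _ _ hx hy; rw [map_add, map_add]; exact Submodule.add_mem _ hx hy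
    · intro r x _ hx; rw [_root_.map_smul, _root_.map_smul]; exact Submodule.smul_mem _ (r : 𝓡) hx
  have hmax : Submodule.span 𝓡 (j '' (LinearMap.ker p)) ≤ maxSubmodule 𝓡 M :=
    le_maxSubmodule <| hφ.span_image_ne_top hφspan hw₀ j _ fun y hy =>
      hψ.mem_closure hψspan (hψ.del_smul_eq D) hker hy
  -- The kernel of `p` maps into the maximal submodule of `M`, so `M → M/max` induces a map on `L`,
  -- and `hfact` extends it to `Q`. This extension is nonzero on the generators, which shows that `χ
  -- ≠ 0`.
  let k : L →ₗ[D.R] SimpleQuotient 𝓡 M :=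
    ((LinearMap.ker p).liftQ ((q.restrictScalars D.R).comp j) fun x hx =>
      (Submodule.Quotient.mk_eq_zero _).2 (hmax (Submodule.subset_span ⟨x, hx, rfl⟩))).comp
      (p.quotKerEquivOfSurjective hp).symm.toLinearMap
  have hk : ∀ x, k (p x) = q (j x) := fun x => by
    have h1 : (p.quotKerEquivOfSurjective hp).symm (p x) = (LinearMap.ker p).mkQ x :=
      (LinearEquiv.symm_apply_eq _).2 rfl
    exact congrArg _ h1
  obtain ⟨G, hG⟩ := hfact k
  have hGφ : ∀ w, G (χ w) = q (φ w) := fun w =>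
    (hG _).trans ((hk _).trans (congrArg q (hj w)))
  have hw1 : χ w₀ ≠ 0 := by
    intro h
    have h1 := hGφ w₀
    rw [h, map_zero] at h1
    have h2 := (Submodule.Quotient.mk_eq_zero _).1 h1.symm
    refine hmaxM (eq_top_iff.2 ?_)
    rw [← hφspan, Submodule.span_le]
    exact hφ.range_subset ((maxSubmodule 𝓡 M).restrictScalars D.R) h2 hw₀
  have := hχ.isSimpleModule_of_isSimpleModule hspan hw1 f fun w => ⟨_, rfl⟩
  obtain ⟨F, hF⟩ := hlift χ hχ
  refine AnalyticO.nonempty_simpleQuotient_equiv hmaxM F ?_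
  rw [← LinearMap.range_eq_top, eq_top_iff, ← hspan, Submodule.span_le]
  rintro _ ⟨w, rfl⟩
  exact ⟨_, hF w⟩

variable (D)

section Simple

/-- `Y` is generated by a universal lowest map from `W`, in the category of `𝓡`-modules. -/
structure IsUniversalAnalytic.{z} (D : BanachTriangularDecomposition K 𝓡) (W : Type*)
    [AddCommGroup W] [Module D.alg.H W] (Y : Type*) [AddCommGroup Y] [Module 𝓡 Y] : Prop where
  exists_gen : ∃ φ : W →+ Y, IsLowest D.alg φ ∧ Submodule.span 𝓡 (Set.range φ) = ⊤ ∧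
    ∀ (N : Type z) [AddCommGroup N] [Module 𝓡 N] (χ : W →+ N), IsLowest D.alg χ →
      ∃ G : Y →ₗ[𝓡] N, ∀ w, G (φ w) = χ w

theorem isUniversalAnalytic_analyticVerma.{z} (W : Type w) [AddCommGroup W] [Module D.alg.H W] :
    IsUniversalAnalytic.{u, v, z} D W (D.AnalyticVerma W) :=
  ⟨⟨analyticVermaGen D W, isLowest_analyticVermaGen D, span_range_analyticVermaGen D,
    fun _ _ _ _ hχ => exists_analyticVermaLift D hχ⟩⟩

variable {X Y : Type*} [AddCommGroup X] [Module D.R X] [AddCommGroup Y] [Module 𝓡 Y]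

theorem exists_ne_zero_isLowest (W : Type*) [AddCommGroup W] [Module D.alg.H W]
    [IsSimpleModule D.alg.H W] :
    ∃ (φ : W →+ 𝓡 ⧸ D.leftIdealBpos) (w : W), IsLowest D.alg φ ∧ φ w ≠ 0 := by
  have := IsSimpleModule.nontrivial D.alg.H W
  obtain ⟨w, hw⟩ := exists_ne (0 : W)
  obtain ⟨φ, hφ, hinj⟩ := exists_injective_isLowest D (W := W)
  exact ⟨φ, w, hφ, (map_ne_zero_iff φ hinj).2 hw⟩

variable {D} in
theorem IsUniversalLowest.isSimpleModule (hX : IsUniversalLowest.{v} D.alg W X) :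
    IsSimpleModule D.R (SimpleQuotient D.R X) := by
  obtain ⟨ψ, hψ, hspan, hlift⟩ := hX
  obtain ⟨χ, w, hχ, hw⟩ := exists_ne_zero_isLowest D W
  obtain ⟨G, hG⟩ := hlift _ χ hχ
  have hw' : ψ w ≠ 0 := fun h => hw (by rw [← hG, h, map_zero])
  exact isSimpleModule_simpleQuotient (hψ.maxSubmodule_ne_top hspan (hψ.del_smul_eq D) hw')

variable {D} in
theorem IsUniversalAnalytic.exists_lowest_ne_zero (hY : IsUniversalAnalytic.{u, v, v} D W Y) :
    ∃ (φ : W →+ Y) (w : W), IsLowest D.alg φ ∧ Submodule.span 𝓡 (Set.range φ) = ⊤ ∧ φ w ≠ 0 := by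
  obtain ⟨φ, hφ, hspan, hlift⟩ := hY
  obtain ⟨χ, w, hχ, hw⟩ := exists_ne_zero_isLowest D W
  obtain ⟨G, hG⟩ := hlift _ χ hχ
  exact ⟨φ, w, hφ, hspan, fun h => hw (by rw [← hG, h, map_zero])⟩

variable {D} in
theorem IsUniversalAnalytic.maxSubmodule_ne_top (hY : IsUniversalAnalytic.{u, v, v} D W Y) :
    maxSubmodule 𝓡 Y ≠ ⊤ := by
  obtain ⟨φ, w, hφ, hspan, hw⟩ := hY.exists_lowest_ne_zero
  exact hφ.maxSubmodule_ne_top' hspan hw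

variable {D} in
/-- A simple module generated by lowest vectors is the simple quotient of the universal one. -/
theorem IsUniversalAnalytic.nonempty_equiv_of_lowest.{z} {L : Type z} [AddCommGroup L] [Module 𝓡 L]
    [IsSimpleModule 𝓡 L] (hY : IsUniversalAnalytic.{u, v, z} D W Y)
    (hY' : IsUniversalAnalytic.{u, v, v} D W Y)
    {χ : W →+ L} (hχ : IsLowest D.alg χ) (hspan : Submodule.span 𝓡 (Set.range χ) = ⊤) :
    Nonempty (SimpleQuotient 𝓡 Y ≃ₗ[𝓡] L) := by
  obtain ⟨φ, hφ, -, hlift⟩ := hY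
  obtain ⟨F, hF⟩ := hlift _ χ hχ
  -- Each instance of the universal property fixes the universe of its test modules: `hY` is tested
  -- on `L`, `hY'` on `𝓡 / 𝓡B^{>0}`, which witnesses that the maximal submodule is proper.
  refine nonempty_simpleQuotient_equiv hY'.maxSubmodule_ne_top F ?_
  rw [← LinearMap.range_eq_top, eq_top_iff, ← hspan, Submodule.span_le]
  rintro _ ⟨w, rfl⟩
  exact ⟨_, hF w⟩

variable {D} in
theorem IsUniversalLowest.nonempty_equiv.{x, y} [IsNoetherianRing D.cA] {X : Type*}
    {L : Type x} {Y : Type y} [AddCommGroup X] [Module D.R X] [AddCommGroup L] [Module D.R L]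
    [IsSimpleModule D.R L] [AddCommGroup Y] [Module 𝓡 Y]
    (hX : IsUniversalLowest.{y} D.alg W X)
    (hY : IsUniversalAnalytic.{u, v, max v x} D W Y) (hY' : IsUniversalAnalytic.{u, v, v} D W Y)
    (p : X →ₗ[D.R] L) (hp : Function.Surjective p) :
    Nonempty (SimpleQuotient 𝓡 Y ≃ₗ[𝓡]
      ExtendScalars (D.R.val : D.R →+* 𝓡) L) := by
  have hmax := hY'.maxSubmodule_ne_top
  obtain ⟨ψ, hψ, hψspan, hψlift⟩ := hX
  obtain ⟨φ, hφ, hφspan, hφlift⟩ := hY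
  obtain ⟨j, hj⟩ := hψlift _ φ hφ
  obtain ⟨w, hw⟩ : ∃ w, φ w ≠ 0 := by
    by_contra! h
    refine hmax (eq_top_iff.2 (hφspan ▸ Submodule.span_le.2 ?_))
    rintro _ ⟨w, rfl⟩
    rw [h w]
    exact Submodule.zero_mem _
  exact hψ.nonempty_simpleQuotient_equiv hψspan hφ hφspan hw j hj p hp
    (ExtendScalars.ιLinear D.R L) (ExtendScalars.span_range_ι _)
    (fun k => ExtendScalars.exists_lift _ k.toAddMonoidHom fun r x => k.map_smul r x)
    fun χ hχ => hφlift _ χ hχ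

variable (W : Type w) [AddCommGroup W] [Module D.alg.H W] [IsSimpleModule D.alg.H W]

theorem isUniversalLowest_verma_alg.{z} (W : Type w) [AddCommGroup W] [Module D.alg.H W] :
    IsUniversalLowest.{z} D.alg W (D.alg.Verma W) :=
  isUniversalLowest_verma D.alg

theorem isSimpleModule_L : IsSimpleModule D.R (D.alg.L W) :=
  (isUniversalLowest_verma_alg D W).isSimpleModule

theorem isSimpleModule_analyticL : IsSimpleModule 𝓡 (D.AnalyticL W) :=
  isSimpleModule_simpleQuotient (isUniversalAnalytic_analyticVerma D W).maxSubmodule_ne_top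

theorem nonempty_analyticL_equiv [IsNoetherianRing D.cA] : Nonempty (D.AnalyticL W ≃ₗ[𝓡]
    ExtendScalars (D.R.val : D.R →+* 𝓡) (D.alg.L W)) :=
  have := isSimpleModule_L D W
  (isUniversalLowest_verma_alg D W).nonempty_equiv (isUniversalAnalytic_analyticVerma D W)
    (isUniversalAnalytic_analyticVerma D W) (maxSubmodule D.R (D.alg.Verma W)).mkQ
    (Submodule.mkQ_surjective _)

end Simple

end AnalyticVerma

/-! ### Existence of lowest weight vectors -/

section LowestVectors

variable {K : Type u} [NontriviallyNormedField K] {𝓡 : Type v} [NormedRing 𝓡]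
  [NormedAlgebra K 𝓡] [CompleteSpace K] [IsUltrametricDist K] [CharZero K] [CompleteSpace 𝓡]
  [IsUltrametricDist 𝓡] (D : BanachTriangularDecomposition K 𝓡) [IsNoetherianRing D.cB]
  [IsNoetherianRing 𝓡]
  {M : Type*} [AddCommGroup M] [Module 𝓡 M]

theorem TriangularDecomposition.Bn_mul_Bn {K R : Type*} [Field K] [Ring R] [Algebra K R]
    (D : TriangularDecomposition K R) {m n : ℕ} {x y : R} (hx : x ∈ D.Bn m) (hy : y ∈ D.Bn n) :
    x * y ∈ D.Bn (m + n) := by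
  refine ⟨D.B.mul_mem hx.1 hy.1, ?_⟩
  have h := mul_mem_degreePart hx.2 hy.2
  rwa [← neg_add, ← Nat.cast_add] at h

theorem TriangularDecomposition.smul_eq_zero_of_mem_Bpos {K R M : Type*} [Field K] [Ring R]
    [Algebra K R] [AddCommGroup M] [Module R M] (D : TriangularDecomposition K R) {x : M}
    (hx : ∀ n ≠ 0, ∀ b ∈ D.Bn n, b • x = 0) {b : R} (hb : b ∈ D.Bpos) : b • x = 0 := by
  rw [D.Bpos_eq] at hb
  refine Submodule.iSup_induction _ (motive := fun b => b • x = 0) hb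
    (fun n b hb => hx _ n.succ_ne_zero b hb) (zero_smul _ _) fun b c hb hc => ?_
  rw [add_smul, hb, hc, add_zero]

/-- The orbit map `h ↦ h x` of a vector killed by `B^{>0}` is lowest. -/
theorem TriangularDecomposition.isLowest_orbit {K R M : Type*} [Field K] [Ring R]
    [Algebra K R] [AddCommGroup M] [Module R M] (D : TriangularDecomposition K R) {x : M}
    (hx : ∀ b ∈ D.Bpos, b • x = 0) :
    IsLowest D (W := D.H) (LinearMap.toSpanSingleton D.H M x).toAddMonoidHom where
  map_smul h w := (LinearMap.toSpanSingleton D.H M x).map_smul h w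
  kill b hb h := by
    change b • (h : R) • x = 0
    rw [← mul_smul]
    have h1 := D.Bpos_mul_H_le (Submodule.mul_mem_mul hb h.2)
    refine Submodule.mul_induction_on (C := fun y => y • x = 0) h1 (fun h _ b hb => ?_)
      fun y z hy hz => by rw [add_smul, hy, hz, add_zero]
    rw [mul_smul, hx b hb, smul_zero]

/-- A nonzero vector killed by `B^{>0}` gives a lowest embedding of a simple left ideal of `H`. -/
theorem TriangularDecomposition.exists_simple_lowest {K R M : Type*} [Field K] [Ring R]
    [Algebra K R] [AddCommGroup M] [Module R M] (D : TriangularDecomposition K R) {x : M}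
    (hx0 : x ≠ 0) (hx : ∀ b ∈ D.Bpos, b • x = 0) :
    ∃ (I : Ideal D.H) (φ : I →+ M), IsSimpleModule D.H I ∧ IsLowest D φ ∧ Function.Injective φ ∧
      ∀ i, φ i ∈ Submodule.span R {x} := by
  have := D.isSemisimpleRing_H
  let l := LinearMap.toSpanSingleton D.H M x
  -- A complement of the annihilator of `x` in `H` embeds into `M`, and it is nonzero because `1`
  -- does not annihilate `x`.
  obtain ⟨C, hC⟩ := exists_isCompl (LinearMap.ker l)
  have hC0 : C ≠ ⊥ := by
    rintro rfl
    have h1 : LinearMap.ker l = ⊤ := by simpa using hC.sup_eq_top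
    have h2 : l 1 = 0 := LinearMap.mem_ker.1 (h1 ▸ Submodule.mem_top)
    exact hx0 (by simpa [l] using h2)
  have : Nontrivial C := (Submodule.nontrivial_iff_ne_bot).2 hC0
  obtain ⟨I, hI⟩ := IsSemisimpleModule.exists_simple_submodule D.H C
  let e := (Submodule.equivSubtypeMap C I)
  have hIC : I.map C.subtype ≤ C := by
    rintro _ ⟨y, -, rfl⟩; exact y.2
  refine ⟨I.map C.subtype, l.toAddMonoidHom.comp (I.map C.subtype).subtype.toAddMonoidHom,
    IsSimpleModule.congr (N := I) e.symm, ⟨fun h w => ?_, fun b hb w => ?_⟩, ?_, fun i => ?_⟩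
  · exact (D.isLowest_orbit hx).map_smul h w.1
  · exact (D.isLowest_orbit hx).kill b hb w.1
  · rw [injective_iff_map_eq_zero]
    intro y hy
    have h1 : (y : D.H) ∈ LinearMap.ker l ⊓ C := ⟨hy, hIC y.2⟩
    rw [hC.inf_eq_bot] at h1
    exact Subtype.ext h1
  · exact Submodule.smul_mem _ _ (Submodule.mem_span_singleton_self x)

variable [IsNoetherianRing D.cA] [Module K M] [IsScalarTower K 𝓡 M] [TopologicalSpace M]
  [IsModuleTopology 𝓡 M] [Module.Finite 𝓡 M] [Module.Finite D.cA M]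

/-- Weight vectors are killed by the elements of `B` of large negative degree. -/
theorem exists_forall_Bn_smul_eq_zero {c : K} {x : M} (hx : D.del • x = c • x) :
    ∃ N : ℕ, ∀ n > N, ∀ b ∈ D.alg.Bn n, (b : 𝓡) • x = 0 := by
  have := IsModuleTopology.topologicalAddGroup 𝓡 M
  have := continuousConstSMul_of_isModuleTopology K 𝓡 M
  let P : ℕ →o Submodule D.cA M :=
    { toFun := fun N => Submodule.span D.cA
        {y | ∃ n ≤ N, ∃ b ∈ D.alg.Bn n, (b : 𝓡) • x = y}
      monotone' := fun N N' h => Submodule.span_mono fun y ⟨n, hn, b, hb, hy⟩ =>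
        ⟨n, hn.trans h, b, hb, hy⟩ }
  -- Once the chain is stationary, `b x` with `b` of degree `-n`, `n > N`, lies in the `𝓐`-span of
  -- vectors of weights at least `c - N`. Since `𝓐` only raises weights and `b x` has weight `c -
  -- n`, it is zero.
  obtain ⟨N, hN⟩ := monotone_stabilizes_iff_noetherian.2
    (inferInstanceAs (IsNoetherian D.cA M)) P
  have hwt : ∀ (n : ℕ), ∀ b ∈ D.alg.Bn n, D.del • (b : 𝓡) • x = (c + (-n : ℤ)) • (b : 𝓡) • x := by
    intro n b hb
    have h1 : D.del * (b : 𝓡) - b * D.del = (((-n : ℤ) : ℤ) : K) • (b : 𝓡) :=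
      congrArg Subtype.val (mem_degreePart.1 hb.2)
    rw [sub_eq_iff_eq_add] at h1
    rw [← mul_smul, h1, add_smul, mul_smul, hx, smul_comm (b : 𝓡) c x, smul_assoc, ← add_smul,
      add_comm]
  refine ⟨N, fun n hn b hb => ?_⟩
  have h1 : (b : 𝓡) • x ∈ P n := Submodule.subset_span ⟨n, le_rfl, b, hb, rfl⟩
  rw [← hN n hn.le] at h1
  refine (hasUniqueWeightSums_of_finite (K := K) (M := M) D.del).eq_zero (j := -n) (k := -N)
    (by omega) (hwt n b hb) ?_
  have h2 : ∀ a : D.cA, (a : 𝓡) • (b : 𝓡) • x ∈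
      weightTail (Algebra.lsmul K K M D.del) c (-N) := by
    refine Submodule.span_induction (p := fun y _ => ∀ a : D.cA, (a : 𝓡) • y ∈
      weightTail (Algebra.lsmul K K M D.del) c (-N)) ?_ ?_ ?_ ?_ h1
    · rintro _ ⟨m, hm, b, hb, rfl⟩ a
      have h3 := smul_mem_weightTail (hwt m b hb) a
      rw [weightTail_shift] at h3
      exact weightTail_anti (by omega) h3
    · intro r; rw [smul_zero]; exact Submodule.zero_mem _
    · intro x y _ _ hx hy r; rw [smul_add]; exact Submodule.add_mem _ (hx r) (hy r)
    · intro a x _ hx r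
      have := hx (r * a)
      rw [Subalgebra.coe_mul, mul_smul] at this
      exact this
  simpa using h2 1

/-- Among the homogeneous `b ∈ B` with `b x ≠ 0` one of lowest degree exists, since these degrees
are bounded below. Then `B^{>0}` kills `b x`. -/
theorem exists_simple_lowest_of_weight {c : K} {x : M} (hx0 : x ≠ 0) (hx : D.del • x = c • x) :
    ∃ (I : Ideal D.alg.H) (φ : I →+ M), IsSimpleModule D.alg.H I ∧ IsLowest D.alg φ ∧
      Function.Injective φ ∧ ∀ i, φ i ∈ Submodule.span 𝓡 {x} := by
  obtain ⟨N, hN⟩ := exists_forall_Bn_smul_eq_zero D hx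
  let S : Set ℕ := {n | ∃ b ∈ D.alg.Bn n, (b : 𝓡) • x ≠ 0}
  have hS0 : 0 ∈ S := ⟨1, by rw [D.alg.Bn_zero]; exact Submodule.one_le.1 le_rfl, by
    rwa [OneMemClass.coe_one, one_smul]⟩
  have hS : BddAbove S := ⟨N, fun n ⟨b, hb, hbx⟩ => not_lt.1 fun h => hbx (hN n h b hb)⟩
  obtain ⟨b, hb, hbx⟩ := Nat.sSup_mem ⟨0, hS0⟩ hS
  have hb' : ∀ n ≠ 0, ∀ b' ∈ D.alg.Bn n, b' • (b : 𝓡) • x = 0 := fun n hn b' hb' => by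
    change (b' : 𝓡) • (b : 𝓡) • x = 0
    rw [← mul_smul]
    by_contra h
    have h1 : n + sSup S ∈ S := ⟨b' * b, D.alg.Bn_mul_Bn hb' hb, h⟩
    have h2 := le_csSup hS h1
    omega
  obtain ⟨I, φ, hI, hφ, hinj, hspan⟩ := D.alg.exists_simple_lowest (M := M) (x := (b : 𝓡) • x) hbx
    fun b' => D.alg.smul_eq_zero_of_mem_Bpos hb'
  refine ⟨I, φ, hI, hφ, hinj, fun i => ?_⟩
  obtain ⟨r, hr⟩ := Submodule.mem_span_singleton.1 (hspan i)
  rw [← hr]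
  exact Submodule.smul_mem _ (r : 𝓡)
    (Submodule.smul_mem _ _ (Submodule.mem_span_singleton_self x))

end LowestVectors

/-! ### Simple submodules of lowest weight modules -/

section SimpleSubmodules

variable {K : Type u} [NontriviallyNormedField K] {𝓡 : Type v} [NormedRing 𝓡]
  [NormedAlgebra K 𝓡] [CompleteSpace K] [IsUltrametricDist K] [CharZero K] [CompleteSpace 𝓡]
  [IsUltrametricDist 𝓡] {D : BanachTriangularDecomposition K 𝓡} [IsNoetherianRing D.cB]
  [IsNoetherianRing 𝓡]
  {W M : Type*} [AddCommGroup W] [Module D.alg.H W]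
  [AddCommGroup M] [Module 𝓡 M] [Module K M] [IsScalarTower K 𝓡 M]
  {φ : W →+ M}

open Polynomial in
theorem IsLowest.aeval_apply (hφ : IsLowest D.alg φ) {h₀ : D.alg.H}
    (hd : D.alg.del - h₀ ∈ (⊤ * D.alg.Bpos : Submodule K D.R)) (q : K[X]) (w : W) :
    aeval (Algebra.lsmul K K M D.del) q (φ w) = φ (aeval h₀ q • w) := by
  have hK : ∀ (c : K) (w : W), φ (algebraMap K D.alg.H c • w) = c • φ w := fun c w => by
    rw [hφ.algebraMap_smul, ← _root_.algebraMap_smul 𝓡 c]; rfl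
  induction q using Polynomial.induction_on' generalizing w with
  | add p q hp hq => rw [map_add, LinearMap.add_apply, hp, hq, map_add, add_smul, map_add]
  | monomial n a =>
    induction n generalizing w with
    | zero => rw [monomial_zero_left, aeval_C, aeval_C, hK]; rfl
    | succ n ih =>
      rw [← monomial_mul_X, map_mul, map_mul, aeval_X, aeval_X, mul_smul, ← ih,
        ← hφ.del_smul hd]
      rfl

theorem IsLowest.aeval_minpoly_apply (hφ : IsLowest D.alg φ) {h₀ : D.alg.H}
    (hd : D.alg.del - h₀ ∈ (⊤ * D.alg.Bpos : Submodule K D.R)) (w : W) :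
    Polynomial.aeval (Algebra.lsmul K K M D.del) (minpoly K h₀) (φ w) = 0 := by
  rw [hφ.aeval_apply hd, minpoly.aeval, zero_smul, map_zero]

/-- Lowest weight maps into a lowest weight module have image in bounded degree. -/
theorem IsLowest.exists_range_subset_lowPart [IsSimpleModule D.alg.H W]
    [TopologicalSpace M] [IsModuleTopology 𝓡 M] [Module.Finite 𝓡 M] (hφ : IsLowest D.alg φ) :
    ∃ k, ∀ (I : Ideal D.alg.H) (χ : I →+ M), IsLowest D.alg χ →
      (∀ i, χ i ∈ Submodule.span 𝓡 (Set.range φ)) → ∀ i, χ i ∈ lowPart D φ k := by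
  have := IsModuleTopology.topologicalAddGroup 𝓡 M
  have := continuousConstSMul_of_isModuleTopology K 𝓡 M
  have := D.alg.finite_H
  obtain ⟨h₀, -, hd⟩ := exists_central_element D
  have hint : IsIntegral K h₀ := IsIntegral.of_finite K h₀
  have hq0 : minpoly K h₀ ≠ 0 := minpoly.ne_zero hint
  -- The central element `h₀` acts as `∂` on lowest weight vectors, so its minimal polynomial in `∂`
  -- kills them. It has finitely many roots in the coset of the lowest weight, and `k` bounds the
  -- corresponding degrees.
  have hfin : {n : ℤ | (minpoly K h₀).eval (lowestWeight D W + n) = 0}.Finite := by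
    refine Set.Finite.preimage (f := fun n : ℤ => lowestWeight D W + (n : K))
      (fun a _ b _ h => ?_) (Polynomial.finite_setOfPred_isRoot hq0)
    exact_mod_cast add_left_cancel h
  obtain ⟨k, hk⟩ := hfin.bddAbove
  refine ⟨k.toNat, fun I χ hχ hspan i => ?_⟩
  refine hφ.mem_lowPart (hspan i) (q := minpoly K h₀) (hχ.aeval_minpoly_apply hd i)
    fun n hn h0 => ?_
  have := hk h0
  have := Int.self_le_toNat k
  omega

/-- Lowest weight modules are expanded in weight vectors. -/
theorem IsLowest.mem_weightTail_zero [IsSimpleModule D.alg.H W]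
    [TopologicalSpace M] [IsModuleTopology 𝓡 M] [Module.Finite 𝓡 M] [IsTopologicalAddGroup M]
    [ContinuousConstSMul K M] (hφ : IsLowest D.alg φ) {x : M}
    (hx : x ∈ Submodule.span 𝓡 (Set.range φ)) :
    x ∈ weightTail (Algebra.lsmul K K M D.del) (lowestWeight D W) 0 := by
  obtain ⟨s, hs, t, ht, rfl⟩ := Submodule.mem_sup.1 (hφ.mem_sup hx 0)
  refine Submodule.add_mem _ ?_ (weightTail_anti (by simp) ht)
  obtain ⟨u, hu, hu0, -, hsum⟩ := hφ.exists_lowPart_expansion hs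
  exact mem_weightTail_iff.2 ⟨u, hu, hu0, hsum⟩

/-- `Y` is chosen with `P ∩ Y` of least dimension. This replaces a descending chain condition, which
is not available for submodules of `M`. -/
theorem exists_inf_le_of_finiteDimensional {K R M : Type*} [Field K] [Ring R] [Algebra K R]
    [AddCommGroup M] [Module K M] [Module R M] [IsScalarTower K R M] (P : Submodule K M)
    [FiniteDimensional K P] {S : Set (Submodule R M)} (hS : S.Nonempty) :
    ∃ Y ∈ S, ∀ Z ∈ S, Z ≤ Y → ∀ x ∈ P, x ∈ Y → x ∈ Z := by
  let d : Submodule R M → ℕ := fun Y =>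
    Module.finrank K (P ⊓ Y.restrictScalars K : Submodule K M)
  obtain ⟨Y, hY, hmin⟩ : ∃ Y ∈ S, ∀ Z ∈ S, d Y ≤ d Z := by
    obtain ⟨_, ⟨Y, hY, rfl⟩, hm⟩ := WellFounded.has_min (wellFounded_lt (α := ℕ)) (d '' S)
      (hS.image d)
    exact ⟨Y, hY, fun Z hZ => not_lt.1 (hm _ ⟨Z, hZ, rfl⟩)⟩
  refine ⟨Y, hY, fun Z hZ hZY x hxP hxY => ?_⟩
  have : FiniteDimensional K (P ⊓ Y.restrictScalars K : Submodule K M) :=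
    Submodule.finiteDimensional_of_le inf_le_left
  have hle : P ⊓ Z.restrictScalars K ≤ P ⊓ Y.restrictScalars K := inf_le_inf_left _ hZY
  have h1 : (P ⊓ Z.restrictScalars K : Submodule K M) = P ⊓ Y.restrictScalars K :=
    Submodule.eq_of_le_of_finrank_le hle (hmin Z hZ)
  have h2 : x ∈ (P ⊓ Y.restrictScalars K : Submodule K M) := ⟨hxP, hxY⟩
  rw [← h1] at h2
  exact h2.2

theorem span_range_ne_bot {R H I M : Type*} [Ring R] [Ring H] [AddCommGroup I] [Module H I]
    [IsSimpleModule H I] [AddCommGroup M] [Module R M] {χ : I →+ M} (hχ : Function.Injective χ) :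
    Submodule.span R (Set.range χ) ≠ ⊥ := by
  intro h
  have := IsSimpleModule.nontrivial H I
  obtain ⟨i, hi⟩ := exists_ne (0 : I)
  refine hi (hχ ?_)
  rw [map_zero, ← Submodule.mem_bot R, ← h]
  exact Submodule.subset_span ⟨i, rfl⟩

section Finite

variable [IsNoetherianRing D.cA] [TopologicalSpace M] [IsModuleTopology 𝓡 M] [Module.Finite 𝓡 M]
  [Module.Finite D.cA M]

/-- A nonzero element of `Y` has a nonzero weight component, and this component is again in `Y`. -/
theorem IsLowest.exists_injective_lowest [IsSimpleModule D.alg.H W] (hφ : IsLowest D.alg φ)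
    {Y : Submodule 𝓡 M} (hY0 : Y ≠ ⊥) (hY : Y ≤ Submodule.span 𝓡 (Set.range φ)) :
    ∃ (I : Ideal D.alg.H) (χ : I →+ M), IsSimpleModule D.alg.H I ∧ IsLowest D.alg χ ∧
      Function.Injective χ ∧ ∀ i, χ i ∈ Y := by
  have := IsModuleTopology.topologicalAddGroup 𝓡 M
  have := continuousConstSMul_of_isModuleTopology K 𝓡 M
  obtain ⟨y, hyY, hy0⟩ := Submodule.exists_mem_ne_zero_of_ne_bot hY0
  obtain ⟨u, hu, -, hs⟩ := mem_weightTail_iff.1 (hφ.mem_weightTail_zero (hY hyY))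
  obtain ⟨n, hn⟩ : ∃ n, u n ≠ 0 := by
    by_contra! h
    have := t2Space_of_finite K (𝓡 := 𝓡) (M := M)
    rw [funext h] at hs
    exact hy0 (hs.unique hasSum_zero)
  have hunY : u n ∈ Y := component_mem (x := D.del) hu hyY hs n
  obtain ⟨J, χ, hJ, hχ, hχinj, hχspan⟩ := exists_simple_lowest_of_weight D hn (hu n)
  exact ⟨J, χ, hJ, hχ, hχinj, fun i =>
    (Submodule.span_singleton_le_iff_mem _ _).2 hunY (hχspan i)⟩

/-- The lowest weight vectors of the module lie in the finite-dimensional space `lowPart D φ k`. If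
`Y` is nonzero with least intersection with this space, every nonzero `Z ≤ Y` meets it in the same
subspace. So `Z` contains the lowest weight vectors found in `Y`, and they generate a simple module.
-/
theorem IsLowest.exists_simple_submodule [IsSimpleModule D.alg.H W] (hφ : IsLowest D.alg φ)
    (h0 : Submodule.span 𝓡 (Set.range φ) ≠ ⊥) :
    ∃ (I : Ideal D.alg.H) (χ : I →+ M), IsSimpleModule D.alg.H I ∧ IsLowest D.alg χ ∧
      IsSimpleModule 𝓡 (Submodule.span 𝓡 (Set.range χ)) := by
  obtain ⟨k, hk⟩ := hφ.exists_range_subset_lowPart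
  have hfd : FiniteDimensional K (lowPart D φ k) := Module.Finite.iff_fg.2 (hφ.fg_lowPart k)
  obtain ⟨Y, ⟨hY0, hY⟩, hmin⟩ := exists_inf_le_of_finiteDimensional (lowPart D φ k)
    (S := {Y : Submodule 𝓡 M | Y ≠ ⊥ ∧ Y ≤ Submodule.span 𝓡 (Set.range φ)}) ⟨_, h0, le_rfl⟩
  obtain ⟨J, χ, hJ, hχ, hχinj, hχY⟩ := hφ.exists_injective_lowest hY0 hY
  refine ⟨J, χ, hJ, hχ, isSimpleModule_iff_isAtom.2
    ⟨span_range_ne_bot (H := D.alg.H) hχinj, fun Z hZ => ?_⟩⟩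
  by_contra hZ0
  have hZY : Z ≤ Y := hZ.le.trans (Submodule.span_le.2 (Set.range_subset_iff.2 hχY))
  exact hZ.not_ge (Submodule.span_le.2 (Set.range_subset_iff.2 fun i =>
    hmin Z ⟨hZ0, hZY.trans hY⟩ hZY _ (hk J χ hχ (fun i => hY (hχY i)) i) (hχY i)))

variable (D) in
theorem exists_simple_of_weight {c : K} {x : M} (hx0 : x ≠ 0) (hx : D.del • x = c • x) :
    ∃ (I : Ideal D.alg.H) (χ : I →+ M), IsSimpleModule D.alg.H I ∧ IsLowest D.alg χ ∧
      IsSimpleModule 𝓡 (Submodule.span 𝓡 (Set.range χ)) := by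
  obtain ⟨I, φ, hI, hφ, hinj, -⟩ := exists_simple_lowest_of_weight D hx0 hx
  exact hφ.exists_simple_submodule (span_range_ne_bot (H := D.alg.H) hinj)

end Finite

variable (D) in
/-- A simple `𝓡`-module generated by lowest weight vectors. -/
def IsSimpleLowest (L : Type*) [AddCommGroup L] [Module 𝓡 L] : Prop :=
  IsSimpleModule 𝓡 L ∧ ∃ (W : Type v) (_ : AddCommGroup W) (_ : Module D.alg.H W) (φ : W →+ L),
    IsSimpleModule D.alg.H W ∧ IsLowest D.alg φ ∧ Submodule.span 𝓡 (Set.range φ) = ⊤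

theorem IsSimpleLowest.congr {L L' : Type*} [AddCommGroup L] [Module 𝓡 L] [AddCommGroup L']
    [Module 𝓡 L'] (h : IsSimpleLowest D L) (e : L ≃ₗ[𝓡] L') : IsSimpleLowest D L' := by
  obtain ⟨hL, W, _, _, φ, hW, hφ, hspan⟩ := h
  refine ⟨IsSimpleModule.congr e.symm, W, _, _, _, hW,
    hφ.comp (e.toLinearMap.restrictScalars D.R), ?_⟩
  have h2 : Set.range ((e.toLinearMap.restrictScalars D.R).toAddMonoidHom.comp φ) =
      e.toLinearMap '' Set.range φ := Set.range_comp e.toLinearMap φ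
  rw [h2, Submodule.span_image, hspan, Submodule.map_top, LinearEquiv.range]

omit [Module K M] [IsScalarTower K 𝓡 M] in
theorem IsSimpleLowest.of_injective {L : Type*} [AddCommGroup L] [Module 𝓡 L]
    (hL : IsSimpleModule 𝓡 L) {I : Type v} [AddCommGroup I] [Module D.alg.H I] {χ : I →+ M}
    (hI : IsSimpleModule D.alg.H I)
    (hχ : IsLowest D.alg χ) (f : L →ₗ[𝓡] M) (hf : Function.Injective f) (χ' : I →+ L)
    (h : ∀ i, f (χ' i) = χ i) (hspan : Submodule.map f ⊤ ≤ Submodule.span 𝓡 (Set.range χ)) :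
    IsSimpleLowest D L := by
  refine ⟨hL, I, inferInstance, inferInstance, χ', hI,
    ⟨fun y w => hf ?_, fun b hb w => hf ?_⟩, ?_⟩
  · rw [h, hχ.map_smul, ← h]
    exact (f.map_smul (((y : D.R) : 𝓡)) _).symm
  · rw [map_zero, ← hχ.kill b hb w, ← h]
    exact f.map_smul (b : 𝓡) _
  · refine top_le_iff.1 ((Submodule.map_le_map_iff_of_injective hf _ _).1 ?_)
    rw [Submodule.map_span, ← Set.range_comp]
    refine hspan.trans (le_of_eq (congrArg _ (congrArg _ (funext fun i => (h i).symm))))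

omit [Module K M] [IsScalarTower K 𝓡 M] in
theorem isSimpleLowest_span {I : Type v} [AddCommGroup I] [Module D.alg.H I] {χ : I →+ M}
    (hI : IsSimpleModule D.alg.H I)
    (hχ : IsLowest D.alg χ) (hs : IsSimpleModule 𝓡 (Submodule.span 𝓡 (Set.range χ))) :
    IsSimpleLowest D (Submodule.span 𝓡 (Set.range χ)) :=
  IsSimpleLowest.of_injective hs hI hχ (Submodule.subtype _) (Submodule.injective_subtype _)
    (χ.codRestrict _ fun i => Submodule.subset_span ⟨i, rfl⟩) (fun _ => rfl)
    (by rw [Submodule.map_top, Submodule.range_subtype])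

set_option maxHeartbeats 400000 in
theorem IsSimpleLowest.nonempty_equiv {L : Type w} [AddCommGroup L] [Module 𝓡 L]
    (h : IsSimpleLowest D L) : ∃ (W : Type v) (_ : AddCommGroup W) (_ : Module D.alg.H W),
      IsSimpleModule D.alg.H W ∧ Nonempty (L ≃ₗ[𝓡] D.AnalyticL W) := by
  obtain ⟨hL, W, _, _, φ, hW, hφ, hspan⟩ := h
  obtain ⟨e⟩ := (isUniversalAnalytic_analyticVerma D W).nonempty_equiv_of_lowest
    (isUniversalAnalytic_analyticVerma D W) hφ hspan
  exact ⟨W, _, _, hW, ⟨e.symm⟩⟩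

end SimpleSubmodules

/-! ### Expansions into generalized weight vectors -/

section Expandable

variable {K : Type u} [NontriviallyNormedField K] {𝓡 : Type v} [NormedRing 𝓡]
  [NormedAlgebra K 𝓡] {D : BanachTriangularDecomposition K 𝓡}
  {M : Type*} [AddCommGroup M] [Module K M] [Module 𝓡 M] [IsScalarTower K 𝓡 M]
  {N : Type*} [AddCommGroup N] [Module K N] [Module 𝓡 N] [IsScalarTower K 𝓡 N]

theorem mem_maxGenEigenspace_iff {x : 𝓡} {c : K} {v : M} :
    v ∈ (Algebra.lsmul K K M x).maxGenEigenspace c ↔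
      ∃ k : ℕ, (x - algebraMap K 𝓡 c) ^ k • v = 0 := by
  rw [Module.End.mem_maxGenEigenspace]
  have h : Algebra.lsmul K K M x - c • 1 = Algebra.lsmul K K M (x - algebraMap K 𝓡 c) := by
    rw [map_sub, AlgHom.commutes, Algebra.algebraMap_eq_smul_one]
  rw [h]
  simp only [← map_pow]
  rfl

theorem map_mem_maxGenEigenspace {x : 𝓡} {c : K} {v : M}
    (h : v ∈ (Algebra.lsmul K K M x).maxGenEigenspace c) (f : M →ₗ[𝓡] N) :
    f v ∈ (Algebra.lsmul K K N x).maxGenEigenspace c := by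
  obtain ⟨k, hk⟩ := mem_maxGenEigenspace_iff.1 h
  exact mem_maxGenEigenspace_iff.2 ⟨k, by rw [← map_smul, hk, map_zero]⟩

theorem mem_maxGenEigenspace_of_injective {x : 𝓡} {c : K} {v : M} {f : M →ₗ[𝓡] N}
    (hf : Function.Injective f) (h : f v ∈ (Algebra.lsmul K K N x).maxGenEigenspace c) :
    v ∈ (Algebra.lsmul K K M x).maxGenEigenspace c := by
  obtain ⟨k, hk⟩ := mem_maxGenEigenspace_iff.1 h
  exact mem_maxGenEigenspace_iff.2 ⟨k, hf (by rw [map_smul, hk, map_zero])⟩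

theorem exists_eigenvector {x : 𝓡} {c : K} {v : M} (hv : v ≠ 0)
    (h : v ∈ (Algebra.lsmul K K M x).maxGenEigenspace c) : ∃ y : M, y ≠ 0 ∧ x • y = c • y := by
  obtain ⟨k, hk⟩ := mem_maxGenEigenspace_iff.1 h
  induction k with
  | zero => exact absurd (by simpa using hk) hv
  | succ k ih =>
    by_cases h0 : (x - algebraMap K 𝓡 c) ^ k • v = 0
    · exact ih h0
    · refine ⟨_, h0, ?_⟩
      rw [pow_succ', mul_smul, sub_smul, sub_eq_zero] at hk
      rw [hk, algebraMap_smul]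

variable (D) in
/-- A vector is expandable if it is a convergent sum of generalized weight vectors for `∂`. -/
def IsExpandable [TopologicalSpace M] (v : M) : Prop :=
  ∃ x : K → M, (∀ l, x l ∈ (Algebra.lsmul K K M D.del).maxGenEigenspace l) ∧ HasSum x v

/-- Summing over all of `K`, with zero terms allowed, removes the choice of the index set `I`;
nothing is lost, since terms at scalars that are not weights vanish. In this form the condition is
visibly compatible with linear maps. -/
theorem hasWeightDecomposition_iff [TopologicalSpace M] :
    HasWeightDecomposition (Algebra.lsmul K K M D.del) ↔ ∀ v : M, IsExpandable D v := by
  classical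
  constructor
  · rintro ⟨I, -, hI⟩ v
    obtain ⟨x, hx, hs⟩ := hI v
    refine ⟨fun l => if h : l ∈ I then x ⟨l, h⟩ else 0, fun l => ?_, ?_⟩
    · by_cases h : l ∈ I
      · simpa only [dif_pos h] using hx ⟨l, h⟩
      · simp only [dif_neg h]; exact Submodule.zero_mem _
    · rw [← Function.Injective.hasSum_iff (Subtype.val_injective (p := (· ∈ I)))]
      · convert hs using 1
        funext l
        simp [l.2]
      · rintro l hl
        simp only [Subtype.range_coe_subtype, Set.mem_setOf_eq] at hl
        exact dif_neg hl
  · intro h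
    refine ⟨weights _, subset_rfl, fun v => ?_⟩
    obtain ⟨x, hx, hs⟩ := h v
    refine ⟨fun l => x l, fun l => hx l, ?_⟩
    rw [← Function.Injective.hasSum_iff (Subtype.val_injective
      (p := (· ∈ weights (Algebra.lsmul K K M D.del))))] at hs
    · exact hs
    · intro l hl
      by_contra h0
      refine hl ⟨⟨l, fun hb => h0 ?_⟩, rfl⟩
      rw [← Submodule.mem_bot K, ← hb]
      exact hx l

theorem isInO_iff [TopologicalSpace M] [IsModuleTopology 𝓡 M] :
    IsInO D M ↔ Module.Finite 𝓡 M ∧ (∀ v : M, IsExpandable D v) ∧ Module.Finite D.cA M := by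
  rw [← hasWeightDecomposition_iff, IsInO]
  have h : ‹TopologicalSpace M› = moduleTopology 𝓡 M := IsModuleTopology.eq_moduleTopology'
  subst h
  rfl

variable [TopologicalSpace M] [TopologicalSpace N]

theorem IsExpandable.map [IsModuleTopology 𝓡 M] [IsModuleTopology 𝓡 N] {v : M}
    (h : IsExpandable D v) (f : M →ₗ[𝓡] N) : IsExpandable D (f v) := by
  obtain ⟨x, hx, hs⟩ := h
  have := IsModuleTopology.toContinuousAdd 𝓡 N
  exact ⟨fun l => f (x l), fun l => map_mem_maxGenEigenspace (hx l) f,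
    hs.map f (IsModuleTopology.continuous_of_linearMap f)⟩

theorem IsExpandable.sum [ContinuousAdd M] {ι : Type*} {s : Finset ι} {v : ι → M}
    (h : ∀ i ∈ s, IsExpandable D (v i)) : IsExpandable D (∑ i ∈ s, v i) := by
  refine Finset.sum_induction v (IsExpandable D) ?_ ?_ h
  · rintro a b ⟨x, hx, hs⟩ ⟨y, hy, ht⟩
    exact ⟨fun l => x l + y l, fun l => Submodule.add_mem _ (hx l) (hy l), hs.add ht⟩
  · exact ⟨0, fun l => Submodule.zero_mem _, hasSum_zero⟩

theorem IsExpandable.exists_eigenvector [T2Space M] {v : M} (hv : v ≠ 0) (h : IsExpandable D v) :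
    ∃ (c : K) (y : M), y ≠ 0 ∧ D.del • y = c • y := by
  obtain ⟨x, hx, hs⟩ := h
  obtain ⟨l, hl⟩ : ∃ l, x l ≠ 0 := by
    by_contra! h0
    rw [funext h0] at hs
    exact hv (hs.unique hasSum_zero)
  exact ⟨l, AnalyticO.exists_eigenvector hl (hx l)⟩

end Expandable

/-! ### Quotients and finite products in `𝒪̂` -/

section Closure

variable {K : Type u} [NontriviallyNormedField K] {𝓡 : Type v} [NormedRing 𝓡]
  [NormedAlgebra K 𝓡] {D : BanachTriangularDecomposition K 𝓡}

theorem IsInO.of_surjective {M : Type*} [AddCommGroup M] [Module K M] [Module 𝓡 M]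
    [IsScalarTower K 𝓡 M] {N : Type*} [AddCommGroup N] [Module K N] [Module 𝓡 N]
    [IsScalarTower K 𝓡 N] (h : IsInO D M) (f : M →ₗ[𝓡] N) (hf : Function.Surjective f) :
    IsInO D N := by
  let : TopologicalSpace M := moduleTopology 𝓡 M
  have : IsModuleTopology 𝓡 M := ⟨rfl⟩
  let : TopologicalSpace N := moduleTopology 𝓡 N
  have : IsModuleTopology 𝓡 N := ⟨rfl⟩
  obtain ⟨h1, h2, h3⟩ := isInO_iff.1 h
  refine isInO_iff.2 ⟨Module.Finite.of_surjective f hf, fun v => ?_,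
    Module.Finite.of_surjective (f.restrictScalars D.cA) hf⟩
  obtain ⟨x, rfl⟩ := hf v
  exact (h2 x).map f

theorem IsInO.pi {ι : Type*} [Finite ι] {M : ι → Type*} [∀ i, AddCommGroup (M i)]
    [∀ i, Module K (M i)] [∀ i, Module 𝓡 (M i)] [∀ i, IsScalarTower K 𝓡 (M i)]
    (h : ∀ i, IsInO D (M i)) : IsInO D ((i : ι) → M i) := by
  classical
  cases nonempty_fintype ι
  let (i : ι) : TopologicalSpace (M i) := moduleTopology 𝓡 (M i)
  have (i : ι) : IsModuleTopology 𝓡 (M i) := ⟨rfl⟩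
  let : TopologicalSpace ((i : ι) → M i) := moduleTopology 𝓡 _
  have : IsModuleTopology 𝓡 ((i : ι) → M i) := ⟨rfl⟩
  have := IsModuleTopology.toContinuousAdd 𝓡 ((i : ι) → M i)
  have h1 i := (isInO_iff.1 (h i)).1
  have h2 i := (isInO_iff.1 (h i)).2.1
  have h3 i := (isInO_iff.1 (h i)).2.2
  refine isInO_iff.2 ⟨inferInstance, fun v => ?_, Module.Finite.pi⟩
  rw [← Finset.univ_sum_single v]
  exact IsExpandable.sum fun i _ => (h2 i (v i)).map (LinearMap.single 𝓡 M i)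

end Closure

/-! ### Jordan–Hölder series -/

section Series

variable {K : Type u} [NontriviallyNormedField K] {𝓡 : Type v} [NormedRing 𝓡]
  [NormedAlgebra K 𝓡] {D : BanachTriangularDecomposition K 𝓡}
  {M : Type*} [AddCommGroup M] [Module 𝓡 M]

variable (D) in
/-- Submodules with a finite filtration whose subquotients are simple and generated by lowest
weight vectors. -/
inductive HasSeries : Submodule 𝓡 M → Prop
  | bot : HasSeries ⊥
  | step (N N' : Submodule 𝓡 M) (h : HasSeries N) (hle : N ≤ N')
      (hq : IsSimpleLowest D (N' ⧸ N.submoduleOf N')) : HasSeries N'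

theorem HasSeries.exists_chain {N : Submodule 𝓡 M} (h : HasSeries D N) :
    ∃ (n : ℕ) (F : Fin (n + 1) → Submodule 𝓡 M), Monotone F ∧ F 0 = ⊥ ∧ F (Fin.last n) = N ∧
      ∀ i : Fin n, IsSimpleLowest D (F i.succ ⧸ (F i.castSucc).submoduleOf (F i.succ)) := by
  induction h with
  | bot => exact ⟨0, fun _ => ⊥, monotone_const, rfl, rfl, fun i => i.elim0⟩
  | step N N' h hle hq ih =>
    obtain ⟨n, F, hF, h0, hlast, hs⟩ := ih
    refine ⟨n + 1, Fin.snoc (α := fun _ => Submodule 𝓡 M) F N', ?_, ?_, by simp, fun i => ?_⟩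
    · refine Fin.monotone_iff_le_succ.2 fun i => ?_
      refine Fin.lastCases ?_ (fun j => ?_) i
      · rw [Fin.succ_last, Fin.snoc_last, Fin.snoc_castSucc, hlast]; exact hle
      · rw [Fin.succ_castSucc, Fin.snoc_castSucc, Fin.snoc_castSucc]
        exact hF (Fin.castSucc_le_succ j)
    · rw [← Fin.castSucc_zero, Fin.snoc_castSucc, h0]
    · refine Fin.lastCases ?_ (fun j => ?_) i
      · rw [Fin.succ_last, Fin.snoc_last, Fin.snoc_castSucc, hlast]; exact hq
      · rw [Fin.succ_castSucc, Fin.snoc_castSucc, Fin.snoc_castSucc]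
        exact hs j

variable [CompleteSpace K] [IsUltrametricDist K] [CharZero K] [CompleteSpace 𝓡]
  [IsUltrametricDist 𝓡] [IsNoetherianRing D.cB] [IsNoetherianRing D.cA] [IsNoetherianRing 𝓡]
  [Module K M] [IsScalarTower K 𝓡 M]

theorem IsInO.exists_simpleLowest_submodule (h : IsInO D M) [Nontrivial M] :
    ∃ S : Submodule 𝓡 M, IsSimpleLowest D S := by
  let : TopologicalSpace M := moduleTopology 𝓡 M
  have : IsModuleTopology 𝓡 M := ⟨rfl⟩
  obtain ⟨h1, h2, h3⟩ := isInO_iff.1 h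
  have := t2Space_of_finite K (𝓡 := 𝓡) (M := M)
  obtain ⟨v, hv⟩ := exists_ne (0 : M)
  obtain ⟨c, y, hy0, hy⟩ := (h2 v).exists_eigenvector hv
  obtain ⟨I, χ, hI, hχ, hs⟩ := exists_simple_of_weight D hy0 hy
  exact ⟨_, isSimpleLowest_span hI hχ hs⟩

/-- The comap of `S ≤ M ⧸ N` to `M`, modulo `N`, is `S`. -/
def comapMkQuotientEquiv {R M : Type*} [Ring R] [AddCommGroup M] [Module R M]
    (N : Submodule R M) (S : Submodule R (M ⧸ N)) :
    S ≃ₗ[R] (S.comap N.mkQ) ⧸ N.submoduleOf (S.comap N.mkQ) := by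
  let f : S.comap N.mkQ →ₗ[R] S := N.mkQ.restrict fun x hx => hx
  have hf : Function.Surjective f := fun ⟨y, hy⟩ => by
    obtain ⟨x, rfl⟩ := N.mkQ_surjective y
    exact ⟨⟨x, hy⟩, rfl⟩
  have hk : LinearMap.ker f = N.submoduleOf (S.comap N.mkQ) := by
    ext x
    change f x = 0 ↔ (x : M) ∈ N
    rw [← Submodule.Quotient.mk_eq_zero N, ← Submodule.coe_eq_zero]
    rfl
  exact (Submodule.quotEquivOfEq _ _ hk.symm |>.trans (f.quotKerEquivOfSurjective hf)).symm

/-- Take `N` maximal among the submodules with a series. If `M/N` were nonzero, it would be in `𝒪̂`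
as a quotient of `M` and would contain a simple lowest weight submodule, whose preimage extends the
series. Only stability under quotients enters, so the result is available for proving stability
under submodules. -/
theorem IsInO.hasSeries (h : IsInO D M) : HasSeries D (⊤ : Submodule 𝓡 M) := by
  have := h.1
  obtain ⟨N, hN, hmax⟩ := WellFounded.has_min
    (wellFounded_gt (α := Submodule 𝓡 M)) {N | HasSeries D N} ⟨⊥, HasSeries.bot⟩
  by_contra htop
  have hNtop : N ≠ ⊤ := by rintro rfl; exact htop hN
  have : Nontrivial (M ⧸ N) := Submodule.Quotient.nontrivial_iff.2 hNtop
  obtain ⟨S, hS⟩ := (h.of_surjective N.mkQ N.mkQ_surjective).exists_simpleLowest_submodule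
  have hle : N ≤ S.comap N.mkQ := fun x hx => by
    rw [Submodule.mem_comap, Submodule.mkQ_apply, (Submodule.Quotient.mk_eq_zero N).2 hx]
    exact S.zero_mem
  refine hmax _ (HasSeries.step N _ hN hle (hS.congr (comapMkQuotientEquiv N S)))
    (lt_of_le_of_ne hle fun heq => ?_)
  have := hS.1.nontrivial
  obtain ⟨⟨y, hy⟩, hy0⟩ := exists_ne (0 : S)
  obtain ⟨x, rfl⟩ := N.mkQ_surjective y
  have hx : x ∈ N := by rw [heq]; exact hy
  exact hy0 (Subtype.ext ((Submodule.Quotient.mk_eq_zero N).2 hx))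

end Series

/-! ### Uniqueness of expansions with arbitrary weights -/

section WeightVectors

variable {K : Type u} [NontriviallyNormedField K] {𝓡 : Type v} [NormedRing 𝓡]
  [NormedAlgebra K 𝓡] {D : BanachTriangularDecomposition K 𝓡}
  [CompleteSpace K] [IsUltrametricDist K] [CharZero K] [CompleteSpace 𝓡]
  [IsUltrametricDist 𝓡] [IsNoetherianRing D.cB] [IsNoetherianRing 𝓡]
  {M : Type*} [AddCommGroup M] [Module K M] [Module 𝓡 M] [IsScalarTower K 𝓡 M]
  [TopologicalSpace M] [IsModuleTopology 𝓡 M] [Module.Finite 𝓡 M]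

theorem pow_sub_algebraMap_smul {x : 𝓡} {c d : K} {y : M} (hy : x • y = c • y) (k : ℕ) :
    (x - algebraMap K 𝓡 d) ^ k • y = (c - d) ^ k • y := by
  induction k with
  | zero => simp
  | succ k ih =>
    rw [pow_succ, mul_smul, sub_smul, hy, algebraMap_smul, ← sub_smul, smul_comm, ih, smul_smul,
      ← pow_succ']

/-- In a lowest weight module the generalized weight vectors are weight vectors, with the expected
weights. -/
theorem IsLowest.eq_weight_of_mem_maxGenEigenspace {W : Type*} [AddCommGroup W]
    [Module D.alg.H W] [IsSimpleModule D.alg.H W] {φ : W →+ M} (hφ : IsLowest D.alg φ)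
    (hspan : Submodule.span 𝓡 (Set.range φ) = ⊤) {l : K} {x : M} (hx0 : x ≠ 0)
    (hx : x ∈ (Algebra.lsmul K K M D.del).maxGenEigenspace l) :
    (∃ n : ℤ, lowestWeight D W + n = l) ∧ D.del • x = l • x := by
  have := IsModuleTopology.topologicalAddGroup 𝓡 M
  have := continuousConstSMul_of_isModuleTopology K 𝓡 M
  have := t2Space_of_finite K (𝓡 := 𝓡) (M := M)
  obtain ⟨k, hk⟩ := mem_maxGenEigenspace_iff.1 hx
  obtain ⟨u, hu, -, hs⟩ := mem_weightTail_iff.1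
    (hφ.mem_weightTail_zero (x := x) (hspan ▸ Submodule.mem_top))
  have h0 : ∀ n : ℤ, lowestWeight D W + n ≠ l → u n = 0 := by
    intro n hn
    -- On the component of degree `n` the operator `(∂ - l)^k` is multiplication by `(λ + n - l)^k`,
    -- with `λ` the lowest weight. By uniqueness, a component can survive only if `λ + n = l`.
    have h1 := hs.const_smul ((D.del - algebraMap K 𝓡 l) ^ k)
    rw [hk] at h1
    have h2 : ∀ n, (D.del - algebraMap K 𝓡 l) ^ k • u n = (lowestWeight D W + n - l) ^ k • u n :=
      fun n => pow_sub_algebraMap_smul (hu n) k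
    have h3 := congrFun (hasUniqueWeightSums_of_finite (K := K) (M := M) D.del
      (lowestWeight D W) _ (fun n => ?_) h1) n
    · rw [h2 n] at h3
      exact (_root_.smul_eq_zero.1 h3).resolve_left (pow_ne_zero _ (sub_ne_zero.2 hn))
    · rw [h2 n, _root_.map_smul]
      exact (congrArg _ (hu n)).trans (smul_comm _ _ _)
  obtain ⟨n, hn⟩ : ∃ n, u n ≠ 0 := by
    by_contra! h
    rw [funext h] at hs
    exact hx0 (hs.unique hasSum_zero)
  have hnl : lowestWeight D W + n = l := by
    by_contra h
    exact hn (h0 n h)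
  have hxn : x = u n := hs.unique (hasSum_single n fun m hm => h0 m fun h => hm (by
    rw [← hnl] at h
    exact_mod_cast add_left_cancel h))
  exact ⟨⟨n, hnl⟩, by rw [hxn, ← hnl]; exact hu n⟩

theorem IsLowest.eq_zero_of_hasSum {W : Type*} [AddCommGroup W]
    [Module D.alg.H W] [IsSimpleModule D.alg.H W] {φ : W →+ M} (hφ : IsLowest D.alg φ)
    (hspan : Submodule.span 𝓡 (Set.range φ) = ⊤) {x : K → M}
    (hx : ∀ l, x l ∈ (Algebra.lsmul K K M D.del).maxGenEigenspace l) (hs : HasSum x 0) : x = 0 := by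
  have hinj : Function.Injective fun n : ℤ => lowestWeight D W + (n : K) := fun a b h => by
    exact_mod_cast add_left_cancel h
  have hsupp : ∀ l ∉ Set.range fun n : ℤ => lowestWeight D W + (n : K), x l = 0 := fun l hl => by
    by_contra h
    exact hl (hφ.eq_weight_of_mem_maxGenEigenspace hspan h (hx l)).1
  rw [← hinj.hasSum_iff hsupp] at hs
  have h := hasUniqueWeightSums_of_finite (K := K) (M := M) D.del (lowestWeight D W) _
    (fun n => ?_) hs
  · funext l
    by_cases hl : l ∈ Set.range fun n : ℤ => lowestWeight D W + (n : K)
    · obtain ⟨n, rfl⟩ := hl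
      exact congrFun h n
    · exact hsupp l hl
  · by_cases h0 : x (lowestWeight D W + n) = 0
    · simp [h0]
    · exact (hφ.eq_weight_of_mem_maxGenEigenspace hspan h0 (hx _)).2

omit [Module.Finite 𝓡 M] in
theorem IsSimpleLowest.eq_zero_of_hasSum (h : IsSimpleLowest D M) {x : K → M}
    (hx : ∀ l, x l ∈ (Algebra.lsmul K K M D.del).maxGenEigenspace l) (hs : HasSum x 0) : x = 0 := by
  obtain ⟨-, W, _, _, φ, hW, hφ, hspan⟩ := h
  have := (hφ.finite_of_span K hspan).2
  exact hφ.eq_zero_of_hasSum hspan hx hs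

/-- The integer-valued polynomials only handle weights in one coset of `ℤ`, whereas here they are
arbitrary. In each simple factor all weights lie in one coset, so the terms vanish in `N'/N` and
therefore lie in `N`; induction down the series finishes. -/
theorem HasSeries.eq_zero_of_hasSum {N : Submodule 𝓡 M} (h : HasSeries D N) {x : K → M}
    (hxN : ∀ l, x l ∈ N) (hx : ∀ l, x l ∈ (Algebra.lsmul K K M D.del).maxGenEigenspace l)
    (hs : HasSum x 0) : x = 0 := by
  induction h with
  | bot => exact funext fun l => (Submodule.mem_bot 𝓡).1 (hxN l)
  | step N N' h hle hq ih =>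
    refine ih fun l => ?_
    have := isModuleTopology_submodule K (𝓡 := 𝓡) N'
    let : TopologicalSpace (N' ⧸ N.submoduleOf N') := moduleTopology 𝓡 _
    have : IsModuleTopology 𝓡 (N' ⧸ N.submoduleOf N') := ⟨rfl⟩
    have := IsModuleTopology.toContinuousAdd 𝓡 (N' ⧸ N.submoduleOf N')
    let f := (N.submoduleOf N').mkQ
    let y : K → N' := fun l => ⟨x l, hxN l⟩
    have hy : HasSum y 0 := Topology.IsInducing.subtypeVal.hasSum_iff (g := N'.subtype) y 0 |>.1 hs
    have h1 := hy.map f (IsModuleTopology.continuous_of_linearMap f)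
    rw [map_zero] at h1
    have h2 := hq.eq_zero_of_hasSum (fun l => map_mem_maxGenEigenspace
      (mem_maxGenEigenspace_of_injective N'.injective_subtype (hx l)) f) h1
    exact (Submodule.Quotient.mk_eq_zero (N.submoduleOf N')).1 (congrFun h2 l)

end WeightVectors

/-! ### Submodules of objects of `𝒪̂` -/

section Submodules

variable {K : Type u} [NontriviallyNormedField K] {𝓡 : Type v} [NormedRing 𝓡]
  [NormedAlgebra K 𝓡] {D : BanachTriangularDecomposition K 𝓡}
  [CompleteSpace K] [IsUltrametricDist K] [CharZero K] [CompleteSpace 𝓡]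
  [IsUltrametricDist 𝓡] [IsNoetherianRing D.cB] [IsNoetherianRing D.cA] [IsNoetherianRing 𝓡]
  {M : Type*} [AddCommGroup M] [Module K M] [Module 𝓡 M] [IsScalarTower K 𝓡 M]

/-- An element of `N` is expanded in `M`. In `M/N`, which is in `𝒪̂` and so has a series, the terms
sum to zero; hence each vanishes there, that is, lies in `N`. The subspace topology on `N` is its
canonical one, so the expansion converges in `N`. -/
theorem IsInO.submodule (h : IsInO D M) (N : Submodule 𝓡 M) : IsInO D N := by
  let : TopologicalSpace M := moduleTopology 𝓡 M
  have : IsModuleTopology 𝓡 M := ⟨rfl⟩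
  obtain ⟨h1, h2, h3⟩ := isInO_iff.1 h
  have := isModuleTopology_submodule K (𝓡 := 𝓡) N
  refine isInO_iff.2 ⟨inferInstance, fun v => ?_, ?_⟩
  · let : TopologicalSpace (M ⧸ N) := moduleTopology 𝓡 _
    have : IsModuleTopology 𝓡 (M ⧸ N) := ⟨rfl⟩
    have := IsModuleTopology.toContinuousAdd 𝓡 (M ⧸ N)
    obtain ⟨x, hx, hs⟩ := h2 v
    have h4 := hs.map N.mkQ (IsModuleTopology.continuous_of_linearMap N.mkQ)
    have hv : N.mkQ v = 0 := (Submodule.Quotient.mk_eq_zero N).2 v.2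
    rw [hv] at h4
    have h5 := (h.of_surjective N.mkQ N.mkQ_surjective).hasSeries.eq_zero_of_hasSum
      (fun l => Submodule.mem_top) (fun l => map_mem_maxGenEigenspace (hx l) N.mkQ) h4
    have hxN : ∀ l, x l ∈ N := fun l => (Submodule.Quotient.mk_eq_zero N).1 (congrFun h5 l)
    exact ⟨fun l => ⟨x l, hxN l⟩,
      fun l => mem_maxGenEigenspace_of_injective N.injective_subtype (hx l),
      Topology.IsInducing.subtypeVal.hasSum_iff (g := N.subtype) _ v |>.1 hs⟩
  · exact Module.Finite.of_injective (N.subtype.restrictScalars D.cA) N.injective_subtype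

theorem IsInO.exists_jordanHolder {M : Type w} [AddCommGroup M] [Module K M] [Module 𝓡 M]
    [IsScalarTower K 𝓡 M] (h : IsInO D M) :
    ∃ (n : ℕ) (F : Fin (n + 1) → Submodule 𝓡 M),
      Monotone F ∧ F 0 = ⊥ ∧ F (Fin.last n) = ⊤ ∧ (∀ i, IsInO D (F i)) ∧
      ∀ i : Fin n, ∃ (W : Type v) (_ : AddCommGroup W) (_ : Module D.alg.H W),
        IsSimpleModule D.alg.H W ∧
        Nonempty ((F i.succ ⧸ (F i.castSucc).submoduleOf (F i.succ)) ≃ₗ[𝓡] D.AnalyticL W) := by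
  obtain ⟨n, F, hF, h0, h1, hs⟩ := h.hasSeries.exists_chain
  exact ⟨n, F, hF, h0, h1, fun i => h.submodule _, fun i => (hs i).nonempty_equiv⟩

end Submodules

/-! ### Abelian category structure -/

section Category

open CategoryTheory CategoryTheory.Limits

variable {K : Type u} [NontriviallyNormedField K] {𝓡 : Type v} [NormedRing 𝓡]
  [NormedAlgebra K 𝓡] {D : BanachTriangularDecomposition K 𝓡}

theorem isInO_of_subsingleton {M : Type*} [AddCommGroup M] [Module K M] [Module 𝓡 M]
    [IsScalarTower K 𝓡 M] [Subsingleton M] : IsInO D M := by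
  let : TopologicalSpace M := moduleTopology 𝓡 M
  have : IsModuleTopology 𝓡 M := ⟨rfl⟩
  refine isInO_iff.2 ⟨inferInstance, fun v => ⟨0, fun l => Submodule.zero_mem _, ?_⟩, inferInstance⟩
  rw [Subsingleton.elim v 0]
  exact hasSum_zero

instance : (catO D : ObjectProperty (ModuleCat.{w} 𝓡)).ContainsZero where
  exists_zero := ⟨ModuleCat.of 𝓡 PUnit.{w + 1}, ModuleCat.isZero_of_subsingleton _, by
    let : Module K (ModuleCat.of 𝓡 PUnit.{w + 1}) := Module.compHom _ (algebraMap K 𝓡)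
    have : IsScalarTower K 𝓡 (ModuleCat.of 𝓡 PUnit.{w + 1}) :=
      IsScalarTower.of_algebraMap_smul fun _ _ => rfl
    exact isInO_of_subsingleton (D := D) (M := ModuleCat.of 𝓡 PUnit.{w + 1})⟩

instance : (catO D : ObjectProperty (ModuleCat.{w} 𝓡)).IsClosedUnderQuotients where
  prop_of_epi {X Y} f hf hX := by
    let : Module K X := Module.compHom _ (algebraMap K 𝓡)
    have : IsScalarTower K 𝓡 X := IsScalarTower.of_algebraMap_smul fun _ _ => rfl
    let : Module K Y := Module.compHom _ (algebraMap K 𝓡)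
    have : IsScalarTower K 𝓡 Y := IsScalarTower.of_algebraMap_smul fun _ _ => rfl
    exact IsInO.of_surjective (D := D) (M := X) hX f.hom ((ModuleCat.epi_iff_surjective f).1 hf)

instance : (catO D : ObjectProperty (ModuleCat.{w} 𝓡)).IsClosedUnderFiniteProducts :=
  .of_isClosedUnderLimitsOfShape.{0} fun J _ => ⟨fun X ⟨p⟩ => by
    let F (j : J) : ModuleCat.{w} 𝓡 := p.diag.obj ⟨j⟩
    let (j : J) : Module K (F j) := Module.compHom _ (algebraMap K 𝓡)
    have (j : J) : IsScalarTower K 𝓡 (F j) := IsScalarTower.of_algebraMap_smul fun _ _ => rfl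
    let : Module K X := Module.compHom _ (algebraMap K 𝓡)
    have : IsScalarTower K 𝓡 X := IsScalarTower.of_algebraMap_smul fun _ _ => rfl
    have h : IsInO D ((j : J) → F j) := IsInO.pi fun j => p.prop_diag_obj ⟨j⟩
    let c : Cone p.diag := ⟨ModuleCat.of 𝓡 ((j : J) → F j),
      Discrete.natTrans fun j => ModuleCat.ofHom (LinearMap.proj j.as)⟩
    -- An abstract product `X` is a retract of the explicit product of modules, hence a quotient of
    -- it.
    let r : X ⟶ c.pt := ModuleCat.ofHom (LinearMap.pi fun j => (p.π.app ⟨j⟩).hom)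
    have hr : r ≫ p.isLimit.lift c = 𝟙 X := p.isLimit.hom_ext fun j => by
      rw [Category.assoc, p.isLimit.fac, Category.id_comp]
      rfl
    exact h.of_surjective (p.isLimit.lift c).hom fun x =>
      ⟨r.hom x, DFunLike.congr_fun (congrArg ModuleCat.Hom.hom hr) x⟩⟩

variable [CompleteSpace K] [IsUltrametricDist K] [CharZero K] [CompleteSpace 𝓡]
  [IsUltrametricDist 𝓡] [IsNoetherianRing D.cB] [IsNoetherianRing D.cA] [IsNoetherianRing 𝓡]

instance : (catO D : ObjectProperty (ModuleCat.{w} 𝓡)).IsClosedUnderSubobjects where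
  prop_of_mono {X Y} f hf hY := by
    let : Module K X := Module.compHom _ (algebraMap K 𝓡)
    have : IsScalarTower K 𝓡 X := IsScalarTower.of_algebraMap_smul fun _ _ => rfl
    let : Module K Y := Module.compHom _ (algebraMap K 𝓡)
    have : IsScalarTower K 𝓡 Y := IsScalarTower.of_algebraMap_smul fun _ _ => rfl
    let e := LinearEquiv.ofInjective f.hom ((ModuleCat.mono_iff_injective f).1 hf)
    exact IsInO.of_surjective (D := D)
      (IsInO.submodule (M := Y) hY (LinearMap.range f.hom)) e.symm.toLinearMap e.symm.surjective

theorem _root_.CategoryTheory.ObjectProperty.preservesFiniteLimits_ι {C : Type*} [Category C]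
    [Abelian C] (P : ObjectProperty C) [P.ContainsZero] [P.IsClosedUnderKernels]
    [P.IsClosedUnderCokernels] [P.IsClosedUnderFiniteProducts] : PreservesFiniteLimits P.ι :=
  have := P.preservesKernels_ι
  Functor.preservesFiniteLimits_of_preservesKernels P.ι

theorem _root_.CategoryTheory.ObjectProperty.preservesFiniteColimits_ι {C : Type*} [Category C]
    [Abelian C] (P : ObjectProperty C) [P.ContainsZero] [P.IsClosedUnderKernels]
    [P.IsClosedUnderCokernels] [P.IsClosedUnderFiniteProducts] : PreservesFiniteColimits P.ι :=
  have := P.preservesCokernels_ι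
  Functor.preservesFiniteColimits_of_preservesCokernels P.ι

theorem nonempty_abelian_catO :
    Nonempty (Abelian (catO D : ObjectProperty (ModuleCat.{w} 𝓡)).FullSubcategory) :=
  ⟨inferInstance⟩

end Category

end AnalyticO

end

theorem mainTheorem8 {p : ℕ} [Fact p.Prime] {K : Type u} [NontriviallyNormedField K]
    [IsUltrametricDist K] [CompleteSpace K] [NormedAlgebra ℚ_[p] K]
    [IsDiscreteValuationRing (NormedField.valuation (K := K)).integer]
    {𝓡 : Type v} [NormedRing 𝓡] [NormedAlgebra K 𝓡] [IsUltrametricDist 𝓡] [CompleteSpace 𝓡]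
    [IsNoetherianRing 𝓡] (D : AnalyticO.BanachTriangularDecomposition K 𝓡)
    [IsNoetherianRing D.cA] [IsNoetherianRing D.cB] :
    -- The modules `L(W)` and `L̂(W)` are simple, and `L̂(W) = 𝓡 ⊗_R L(W)`.
    (∀ (W : Type v) [AddCommGroup W] [Module D.alg.H W] [IsSimpleModule D.alg.H W],
      IsSimpleModule D.R (D.alg.L W) ∧ IsSimpleModule 𝓡 (D.AnalyticL W) ∧
      Nonempty (D.AnalyticL W ≃ₗ[𝓡]
        AnalyticO.ExtendScalars (D.R.val : D.R →+* 𝓡) (D.alg.L W))) ∧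
    -- Every object of `𝒪̂` has a finite Jordan-Hölder series in `𝒪̂` with quotients `L̂(W)`.
    (∀ (M : Type w) [AddCommGroup M] [Module K M] [Module 𝓡 M] [IsScalarTower K 𝓡 M],
      AnalyticO.IsInO D M →
      ∃ (n : ℕ) (F : Fin (n + 1) → Submodule 𝓡 M),
        Monotone F ∧ F 0 = ⊥ ∧ F (Fin.last n) = ⊤ ∧
        (∀ i, AnalyticO.IsInO D (F i)) ∧
        ∀ i : Fin n, ∃ (W : Type v) (_ : AddCommGroup W) (_ : Module D.alg.H W),
          IsSimpleModule D.alg.H W ∧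
          Nonempty ((F i.succ ⧸ (F i.castSucc).submoduleOf (F i.succ)) ≃ₗ[𝓡]
            D.AnalyticL W)) ∧
    -- `𝒪̂` is a full abelian subcategory of the category of `𝓡`-modules: it is abelian and the
    -- inclusion functor is exact.
    Nonempty (CategoryTheory.Abelian
      (AnalyticO.catO D : CategoryTheory.ObjectProperty (ModuleCat.{w} 𝓡)).FullSubcategory) ∧
    CategoryTheory.Limits.PreservesFiniteLimits
      (AnalyticO.catO D : CategoryTheory.ObjectProperty (ModuleCat.{w} 𝓡)).ι ∧
    CategoryTheory.Limits.PreservesFiniteColimits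
      (AnalyticO.catO D : CategoryTheory.ObjectProperty (ModuleCat.{w} 𝓡)).ι ∧
    -- `𝒪̂` is closed under submodules.
    (∀ (M : Type w) [AddCommGroup M] [Module K M] [Module 𝓡 M] [IsScalarTower K 𝓡 M],
      AnalyticO.IsInO D M → ∀ N : Submodule 𝓡 M, AnalyticO.IsInO D N) ∧
    -- `𝒪̂` is closed under finite direct sums.
    (∀ (n : ℕ) (M : Fin n → Type w) [∀ i, AddCommGroup (M i)] [∀ i, Module K (M i)]
      [∀ i, Module 𝓡 (M i)] [∀ i, IsScalarTower K 𝓡 (M i)],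
      (∀ i, AnalyticO.IsInO D (M i)) → AnalyticO.IsInO D ((i : Fin n) → M i)) := by
  have : CharZero K := charZero_of_injective_algebraMap (algebraMap ℚ_[p] K).injective
  refine ⟨fun W _ _ _ => ⟨AnalyticO.isSimpleModule_L D W, AnalyticO.isSimpleModule_analyticL D W,
      AnalyticO.nonempty_analyticL_equiv D W⟩, fun M _ _ _ _ h => h.exists_jordanHolder,
    AnalyticO.nonempty_abelian_catO,
    CategoryTheory.ObjectProperty.preservesFiniteLimits_ι _,
    CategoryTheory.ObjectProperty.preservesFiniteColimits_ι _,
    fun M _ _ _ _ h N => h.submodule N, fun n M _ _ _ _ h => AnalyticO.IsInO.pi h⟩
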